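/- Let $-1<a<0$, $s=\frac{1-a}{2}\in(\frac12,1)$, let $D_s>0$ be a constant, let $\alpha'<\beta'$ be real numbers and $I'=\{\alpha',\beta'\}$. Let $V:\mathbb R\to[0,\infty)$ be continuous with $V(t)=0$ if and only if $t\in I'$. Suppose that for some $m$ with $-m\le\alpha',\beta'\le m$ the function $V$ is non-decreasing on $[m,\infty)$ and non-increasing on $(-\infty,-m]$, and that $V$ grows at least linearly at infinity: there are $c>0$ and $R$ with $V(t)\ge c|t|$ whenever $|t|\ge R$. For $\epsilon>0$ set $\Lambda_\epsilon=\epsilon^{\frac{1-a}{-a}}$ and $\lambda_\epsilon=1/\Lambda_\epsilon$. For an interval $J\subset\mathbb R$ and a measurable $v:J\to\mathbb R$ set $$G^a_\epsilon[v,J]=\frac{\epsilon^{1-a}}{D_s}\int_{J^2}\frac{|v(x')-v(x)|^2}{|x'-x|^{1+2s}}\,dx'\,dx+\lambda_\epsilon\int_J V(v)\,dx\in[0,+\infty],$$ and let $H^s(J)$ be the set of $v\in L^2(J)$ for which the double integral is finite. Put $$\kappa_s=\inf\Big\{G^a_1[v,\mathbb R]\;:\;v\in H^s_{\mathrm{loc}}(\mathbb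 R),\ \lim_{x\to-\infty}v(x)=\alpha',\ \lim_{x\to+\infty}v(x)=\beta'\Big\}.$$ **Proposition.** One has $0<\kappa_s<\infty$. Let $E\subset\mathbb R$ be a bounded interval. Let $BV(E,I')$ be the set of $v\in L^1(E)$ with values in $I'$ almost everywhere and with a distributional derivative of finite total variation in the interior of $E$; for such $v$ let $S_v$ be the set of interior points of $E$ at which $v$ has no approximate limit, and $\mathcal H^0(S_v)$ the number of its points. On $L^1(E)$ define $$\bar G^a_\epsilon[v,E]=\begin{cases}G^a_\epsilon[v,E]&\text{if }v\in H^s(E),\\+\infty&\text{otherwise,}\end{cases}\qquad \bar G^a_0[v,E]=\begin{cases}\kappa_s\,\mathcal H^0(S_v)&\text{if }v\in BV(E,I'),\\+\infty&\text{otherwise.}\end{cases}$$ Then $\bar G^a_\epsilon[\cdot,E]$ $\Gamma$-converges to $\bar G^a_0[\cdot,E]$ in $L^1(E)$ as $\epsilon\to0$. That is, for every sequence of positive numbers $\epsilon_n\to0$ and every $v\in L^1(E)$: (i) if $v_n\to v$ in $L^1(E)$, then $\liminf_{n\to\infty}\bar G^a_{\epsilon_n}[v_n,E]\ge\bar G^a_0[v,E]$;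 (ii) there is a sequence $v_n\to v$ in $L^1(E)$ with $\lim_{n\to\infty}\bar G^a_{\epsilon_n}[v_n,E]=\bar G^a_0[v,E]$. Moreover, if $\epsilon_n>0$, $\epsilon_n\to0$, and $(v_n)\subset L^1(E)$ satisfies $\sup_n G^a_{\epsilon_n}[v_n,E]<\infty$, then $(v_n)$ is precompact in $L^1(E)$, and every cluster point of the sequence belongs to $BV(E,I')$. -/

import Mathlib

open Set Filter Topology MeasureTheory
open scoped NNReal ENNReal

noncomputable section

namespace FractionalGamma

/-- A double-well potential `V : ℝ → [0, ∞)` with wells `α' < β'`: continuous, nonnegative, vanishing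
exactly at the wells, monotone outside some `[-m, m]` that contains the wells, with at least linear
growth at infinity. -/
structure IsDoubleWell (V : ℝ → ℝ) (α' β' : ℝ) : Prop where
  continuous : Continuous V
  nonneg : ∀ t, 0 ≤ V t
  eq_zero_iff : ∀ t, V t = 0 ↔ t = α' ∨ t = β'
  exists_monotone : ∃ m : ℝ, -m ≤ α' ∧ α' ≤ m ∧ -m ≤ β' ∧ β' ≤ m ∧
    MonotoneOn V (Ici m) ∧ AntitoneOn V (Iic (-m))
  linear_growth : ∃ c R : ℝ, 0 < c ∧ ∀ t, R ≤ |t| → c * |t| ≤ V t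

/-- The squared Gagliardo seminorm `∫_{E × E} |v(x) - v(x')|² / |x - x'|^{1+2s} dx dx'`,
with values in `[0, ∞]`. -/
def gagliardoSq (s : ℝ) (v : ℝ → ℝ) (E : Set ℝ) : ℝ≥0∞ :=
  ∫⁻ z in E ×ˢ E, ENNReal.ofReal (|v z.1 - v z.2| ^ 2 / |z.1 - z.2| ^ (1 + 2 * s))

/-- `v ∈ H^s(E)`: `v ∈ L²(E)` with finite Gagliardo seminorm. -/
def MemHs (s : ℝ) (v : ℝ → ℝ) (E : Set ℝ) : Prop :=
  MemLp v 2 (volume.restrict E) ∧ gagliardoSq s v E < ⊤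

/-- `v ∈ H^s_loc(ℝ)`: `v ∈ H^s(J)` for every bounded open interval `J`. -/
def MemHsLoc (s : ℝ) (v : ℝ → ℝ) : Prop :=
  ∀ p q : ℝ, MemHs s v (Ioo p q)

/-- The length scale `Λ_ε = ε^{(1-a)/(-a)}`. -/
def lengthScale (a ε : ℝ) : ℝ := ε ^ ((1 - a) / (-a))

/-- The energy
`G_ε[v, E] = (ε^{1-a} / D) ∫_{E×E} |v(x') - v(x)|² / |x' - x|^{1+2s} + λ_ε ∫_E V(v)`,
with `s = (1-a)/2` and `λ_ε = 1 / Λ_ε`. -/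
def energy (a D : ℝ) (V : ℝ → ℝ) (ε : ℝ) (v : ℝ → ℝ) (E : Set ℝ) : ℝ≥0∞ :=
  ENNReal.ofReal (ε ^ (1 - a) / D) * gagliardoSq ((1 - a) / 2) v E +
    ENNReal.ofReal (1 / lengthScale a ε) * ∫⁻ x in E, ENNReal.ofReal (V (v x))

/-- The optimal profile constant: the infimum of `G_1[v, ℝ]` over the `v ∈ H^s_loc(ℝ)` with limits
`α'` at `-∞` and `β'` at `+∞`. -/
def optimalProfile (a D : ℝ) (V : ℝ → ℝ) (α' β' : ℝ) : ℝ≥0∞ :=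
  ⨅ v ∈ {v : ℝ → ℝ | MemHsLoc ((1 - a) / 2) v ∧
    Tendsto v atBot (𝓝 α') ∧ Tendsto v atTop (𝓝 β')}, energy a D V 1 v univ

/-- The space `L¹(E)`. -/
abbrev L1 (E : Set ℝ) : Type := Lp ℝ 1 (volume.restrict E)

/-- `v ∈ BV(E, {α', β'})`: `v` takes the values `α'` and `β'` almost everywhere in `E`, and its
distributional derivative on the interior of `E` has finite total variation. -/
def MemBVTwo (E : Set ℝ) (α' β' : ℝ) (v : L1 E) : Prop :=
  (∀ᵐ x ∂(volume.restrict E), v x = α' ∨ v x = β') ∧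
  ∃ C : ℝ, ∀ φ : ℝ → ℝ, ContDiff ℝ 1 φ → HasCompactSupport φ → tsupport φ ⊆ interior E →
    (∀ x, |φ x| ≤ 1) → ∫ x in E, v x * deriv φ x ≤ C

/-- `z` is the approximate limit of `v` at `x`: for every `η > 0` the set `{|v - z| ≥ η}` has
Lebesgue density `0` at `x`. -/
def HasApproxLimit (v : ℝ → ℝ) (x z : ℝ) : Prop :=
  ∀ η : ℝ, 0 < η →
    Tendsto (fun r : ℝ => volume (Metric.ball x r ∩ {y | η ≤ |v y - z|}) / volume (Metric.ball x r))
      (𝓝[>] 0) (𝓝 0)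

/-- The singular set `S_v`: the interior points of `E` where `v` has no approximate limit. -/
def singularSet (E : Set ℝ) (v : ℝ → ℝ) : Set ℝ :=
  {x ∈ interior E | ¬ ∃ z : ℝ, HasApproxLimit v x z}

open Classical in
/-- The functional on `L¹(E)` equal to the energy on `H^s(E)` and to `+∞` elsewhere. -/
def energyExt (a D : ℝ) (V : ℝ → ℝ) (ε : ℝ) (E : Set ℝ) (v : L1 E) : ℝ≥0∞ :=
  if MemHs ((1 - a) / 2) v E then energy a D V ε v E else ⊤

open Classical in
/-- The limit functional on `L¹(E)`: `κ_s` times the number of points of `S_v` on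
`BV(E, {α', β'})`, and `+∞` elsewhere. -/
def limitEnergy (a D : ℝ) (V : ℝ → ℝ) (α' β' : ℝ) (E : Set ℝ) (v : L1 E) : ℝ≥0∞ :=
  if MemBVTwo E α' β' v then
    optimalProfile a D V α' β' * ((singularSet E v).encard : ℝ≥0∞)
  else ⊤

/-- Γ-convergence of a sequence of `[0, ∞]`-valued functionals on a metric space. -/
def GammaConverges {X : Type*} [PseudoMetricSpace X] (F : ℕ → X → ℝ≥0∞) (F₀ : X → ℝ≥0∞) : Prop :=
  (∀ (u : X) (w : ℕ → X), Tendsto w atTop (𝓝 u) →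
    F₀ u ≤ liminf (fun n => F n (w n)) atTop) ∧
  (∀ u : X, ∃ w : ℕ → X, Tendsto w atTop (𝓝 u) ∧
    Tendsto (fun n => F n (w n)) atTop (𝓝 (F₀ u)))

end FractionalGamma

end

/-!
Write `κ` for the optimal profile constant. In the variable `x / Λ_ε` the energy `G_ε` becomes `G_1`
(`energy_comp_affine`): the exponent in `Λ_ε` is the one that makes the seminorm and the potential
scale alike. So all the estimates concern `G_1` on long intervals.

*Isolated transitions.* Since `2s > 1`, two half-lines at distance `L` interact through the
kernel `|x - y|^{-(1+2s)}` with an energy that tends to `0` as `L → ∞`. Therefore a function that is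
`L¹`-close to a well on a window of fixed large length may be replaced by that well on one side of
the window at a small cost (`exists_energy_cutoff_le`); since `2s < 2`, the piecewise affine cut-off
inside the window costs little as well. Doing this at both ends (`exists_bridge`) turns a function
close to `α'` on one window and to `β'` on another into a competitor for `κ`. This shows that `κ` is
approached by profiles constant outside a bounded interval (`exists_profile`), and that a sequence
converging to a function with a jump at `x` has, asymptotically, energy at least `κ` in every ball
around `x`: truncation to `[α', β']` lowers the energy, and convergence in `L¹` provides the two
windows. The energy is superadditive on disjoint sets, whence the lower bound
(`card_mul_optimalProfile_le_liminf`). The Gagliardo kernel is symmetric, so upward and downward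
jumps cost the same.

*Positivity and compactness.* The mass of a phase in the window `(y, y + H]` is continuous in `y`.
Hence on an interval where the potential energy is small, either one phase is negligible in every
window, or some window contains a definite part of both phases (`window_trichotomy`). In the second
case the seminorm in that window is bounded below (`le_gagliardoSq_of_window`). For a competitor of
`κ` only the second case is possible, so `0 < κ`. Under an energy bound, cut a bounded interval into
cells of a fixed small length: the number of cells in the second case is bounded independently of
that length, and on every other cell the function is `L¹`-close to one of the wells, by the linear
growth of `V`. So the sequence stays close to a finite set of step functions
(`exists_cellFunction_close`) and is totally bounded.

*The limit functional.* The set of points near which `u` is not almost everywhere constant, the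
`jumpSet`, is the quantity that the lower bound controls. For a two-valued `u` it is finite exactly
when `u` is of bounded variation (`memBVTwo_of_finite_jumpSet`, `finite_jumpSet_of_memBVTwo`), and
it is then equal to the approximate discontinuity set (`singularSet_eq_jumpSet`).

*Recovery.* Near each of the finitely many jumps of a two-valued `u`, place a rescaled almost optimal
profile. Distinct profiles interact only at distances bounded below, so the interaction is
`O(ε^{1-a})` and vanishes in the limit (`energy_le_of_placed`, `eventually_exists_recovery`).
-/

namespace FractionalGamma

section

/-! ### Elementary properties of the energy -/

theorem gagliardoSq_mono_set (s : ℝ) (v : ℝ → ℝ) {E F : Set ℝ} (h : E ⊆ F) :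
    gagliardoSq s v E ≤ gagliardoSq s v F :=
  lintegral_mono_set (prod_mono h h)

theorem gagliardoSq_mono_of_abs_sub_le (s : ℝ) {v w : ℝ → ℝ} {E : Set ℝ}
    (h : ∀ x y, |v x - v y| ≤ |w x - w y|) : gagliardoSq s v E ≤ gagliardoSq s w E := by
  refine lintegral_mono fun z => ENNReal.ofReal_le_ofReal ?_
  have := h z.1 z.2
  have h0 : 0 ≤ |z.1 - z.2| ^ (1 + 2 * s) := by positivity
  gcongr

theorem gagliardoSq_congr_ae (s : ℝ) {v w : ℝ → ℝ} {E : Set ℝ}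
    (h : v =ᵐ[volume.restrict E] w) : gagliardoSq s v E = gagliardoSq s w E := by
  unfold gagliardoSq
  rw [Measure.volume_eq_prod, ← Measure.prod_restrict]
  refine lintegral_congr_ae ?_
  have h1 : ∀ᵐ z ∂((volume.restrict E).prod (volume.restrict E)), v z.1 = w z.1 :=
    Measure.quasiMeasurePreserving_fst.ae h
  have h2 : ∀ᵐ z ∂((volume.restrict E).prod (volume.restrict E)), v z.2 = w z.2 :=
    Measure.quasiMeasurePreserving_snd.ae h
  filter_upwards [h1, h2] with z hz1 hz2
  rw [hz1, hz2]

theorem gagliardoSq_congr_set (s : ℝ) (v : ℝ → ℝ) {E F : Set ℝ}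
    (h : volume.restrict E = volume.restrict F) : gagliardoSq s v E = gagliardoSq s v F := by
  unfold gagliardoSq
  rw [Measure.volume_eq_prod, ← Measure.prod_restrict, ← Measure.prod_restrict, h]

theorem gagliardoSq_superadd (s : ℝ) (v : ℝ → ℝ) {ι : Type*} (F : Finset ι) (A : ι → Set ℝ)
    (hA : ∀ i ∈ F, MeasurableSet (A i)) (hd : (F : Set ι).PairwiseDisjoint A) {E : Set ℝ}
    (hE : ∀ i ∈ F, A i ⊆ E) : ∑ i ∈ F, gagliardoSq s v (A i) ≤ gagliardoSq s v E := by
  unfold gagliardoSq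
  rw [← lintegral_biUnion_finset (t := fun i => A i ×ˢ A i)]
  · exact lintegral_mono_set (iUnion₂_subset fun i hi => prod_mono (hE i hi) (hE i hi))
  · intro i hi j hj hij
    exact Disjoint.set_prod_left (hd hi hj hij) _ _
  · exact fun i hi => (hA i hi).prod (hA i hi)

variable {a D : ℝ} {V : ℝ → ℝ}

theorem energy_one (a D : ℝ) (V v : ℝ → ℝ) (E : Set ℝ) :
    energy a D V 1 v E = ENNReal.ofReal (1 / D) * gagliardoSq ((1 - a) / 2) v E +
      ∫⁻ x in E, ENNReal.ofReal (V (v x)) := by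
  simp [energy, lengthScale]

theorem energy_mono_set (a D : ℝ) (V : ℝ → ℝ) (ε : ℝ) (v : ℝ → ℝ) {E F : Set ℝ} (h : E ⊆ F) :
    energy a D V ε v E ≤ energy a D V ε v F := by
  unfold energy
  gcongr
  exact gagliardoSq_mono_set _ _ h

theorem energy_congr_ae (a D : ℝ) (V : ℝ → ℝ) (ε : ℝ) {v w : ℝ → ℝ} {E : Set ℝ}
    (h : v =ᵐ[volume.restrict E] w) : energy a D V ε v E = energy a D V ε w E := by
  unfold energy
  rw [gagliardoSq_congr_ae _ h]
  congr 2
  refine lintegral_congr_ae ?_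
  filter_upwards [h] with x hx
  rw [hx]

theorem energy_congr_set (a D : ℝ) (V : ℝ → ℝ) (ε : ℝ) (v : ℝ → ℝ) {E F : Set ℝ}
    (h : volume.restrict E = volume.restrict F) :
    energy a D V ε v E = energy a D V ε v F := by
  unfold energy
  rw [gagliardoSq_congr_set _ _ h, h]

theorem energy_superadd (a D : ℝ) (V : ℝ → ℝ) (ε : ℝ) (v : ℝ → ℝ) {ι : Type*} (F : Finset ι)
    (A : ι → Set ℝ) (hA : ∀ i ∈ F, MeasurableSet (A i)) (hd : (F : Set ι).PairwiseDisjoint A)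
    {E : Set ℝ} (hE : ∀ i ∈ F, A i ⊆ E) :
    ∑ i ∈ F, energy a D V ε v (A i) ≤ energy a D V ε v E := by
  unfold energy
  rw [Finset.sum_add_distrib, ← Finset.mul_sum, ← Finset.mul_sum]
  gcongr
  · exact gagliardoSq_superadd _ _ F A hA hd hE
  · rw [← lintegral_biUnion_finset hd hA]
    exact lintegral_mono_set (iUnion₂_subset hE)

/-! ### Truncation at the wells -/

/-- The projection of `ℝ` onto `[α, β]`. -/
def clamp (α β t : ℝ) : ℝ := max α (min β t)

theorem clamp_mem {α β : ℝ} (h : α ≤ β) (t : ℝ) : clamp α β t ∈ Icc α β :=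
  ⟨le_max_left _ _, max_le h (min_le_left _ _)⟩

theorem clamp_of_mem {α β t : ℝ} (h : t ∈ Icc α β) : clamp α β t = t := by
  simp [clamp, h.1, h.2]

theorem abs_clamp_sub_clamp_le (α β t u : ℝ) : |clamp α β t - clamp α β u| ≤ |t - u| := by
  unfold clamp
  refine (abs_max_sub_max_le_max _ _ _ _).trans ?_
  rw [sub_self, abs_zero, max_eq_right (abs_nonneg _)]
  refine (abs_min_sub_min_le_max _ _ _ _).trans ?_
  rw [sub_self, abs_zero, max_eq_right (abs_nonneg _)]

theorem continuous_clamp (α β : ℝ) : Continuous (clamp α β) := by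
  unfold clamp; fun_prop

theorem measurable_clamp (α β : ℝ) : Measurable (clamp α β) := (continuous_clamp α β).measurable

theorem IsDoubleWell.apply_left {α' β' : ℝ} (hV : IsDoubleWell V α' β') : V α' = 0 :=
  (hV.eq_zero_iff _).2 (Or.inl rfl)

theorem IsDoubleWell.apply_right {α' β' : ℝ} (hV : IsDoubleWell V α' β') : V β' = 0 :=
  (hV.eq_zero_iff _).2 (Or.inr rfl)

theorem IsDoubleWell.apply_clamp_le {α' β' : ℝ} (hV : IsDoubleWell V α' β') (h : α' ≤ β')
    (t : ℝ) : V (clamp α' β' t) ≤ V t := by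
  rcases le_total t α' with h1 | h1
  · have : clamp α' β' t = α' := by simp [clamp, h1]
    rw [this, hV.apply_left]; exact hV.nonneg t
  rcases le_total β' t with h2 | h2
  · have : clamp α' β' t = β' := by simp [clamp, h, h2]
    rw [this, hV.apply_right]; exact hV.nonneg t
  · rw [clamp_of_mem ⟨h1, h2⟩]

theorem energy_clamp_le {α' β' : ℝ} (hV : IsDoubleWell V α' β') (h : α' ≤ β') (a D ε : ℝ)
    (v : ℝ → ℝ) (E : Set ℝ) :
    energy a D V ε (fun x => clamp α' β' (v x)) E ≤ energy a D V ε v E := by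
  unfold energy
  gcongr
  · exact gagliardoSq_mono_of_abs_sub_le _ fun x y => abs_clamp_sub_clamp_le _ _ _ _
  · exact hV.apply_clamp_le h _

/-! ### Scaling -/

theorem measurableEmbedding_affine (c : ℝ) {k : ℝ} (hk : k ≠ 0) :
    MeasurableEmbedding fun x : ℝ => c + k * x :=
  ((Homeomorph.mulLeft₀ k hk).trans (Homeomorph.addLeft c)).measurableEmbedding

theorem map_affine_volume (c : ℝ) {k : ℝ} (hk : k ≠ 0) :
    (volume : Measure ℝ).map (fun x => c + k * x) = ENNReal.ofReal |k⁻¹| • volume := by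
  have : (fun x : ℝ => c + k * x) = (fun x => c + x) ∘ fun x => k * x := rfl
  rw [this, ← Measure.map_map (by fun_prop) (by fun_prop), Real.map_volume_mul_left hk,
    Measure.map_smul, map_add_left_eq_self]

theorem setLIntegral_comp_affine (c : ℝ) {k : ℝ} (hk : k ≠ 0) (f : ℝ → ℝ≥0∞) (E : Set ℝ) :
    ∫⁻ x in (fun x => c + k * x) ⁻¹' E, f (c + k * x) =
      ENNReal.ofReal |k⁻¹| * ∫⁻ x in E, f x := by
  have he := measurableEmbedding_affine c hk
  rw [← he.lintegral_map (μ := volume.restrict ((fun x => c + k * x) ⁻¹' E)) f,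
    ← he.restrict_map, map_affine_volume c hk, Measure.restrict_smul, lintegral_smul_measure,
    smul_eq_mul]

theorem setLIntegral_prod_comp_affine (c : ℝ) {k : ℝ} (hk : k ≠ 0) (f : ℝ × ℝ → ℝ≥0∞)
    (E : Set ℝ) :
    ∫⁻ z in ((fun x => c + k * x) ⁻¹' E) ×ˢ ((fun x => c + k * x) ⁻¹' E),
        f (c + k * z.1, c + k * z.2) =
      ENNReal.ofReal |k⁻¹| * (ENNReal.ofReal |k⁻¹| * ∫⁻ z in E ×ˢ E, f z) := by
  have he := (measurableEmbedding_affine c hk)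
  have he2 := he.prodMap he
  have hpre : ((fun x => c + k * x) ⁻¹' E) ×ˢ ((fun x => c + k * x) ⁻¹' E) =
    Prod.map (fun x => c + k * x) (fun x => c + k * x) ⁻¹' (E ×ˢ E) := by
    ext z; simp
  have hmap : (volume : Measure (ℝ × ℝ)).map
      (Prod.map (fun x => c + k * x) (fun x => c + k * x)) =
      ENNReal.ofReal |k⁻¹| • ENNReal.ofReal |k⁻¹| • (volume : Measure (ℝ × ℝ)) := by
    rw [Measure.volume_eq_prod, ← Measure.map_prod_map _ _ he.measurable he.measurable,
      map_affine_volume c hk, Measure.prod_smul_left, Measure.prod_smul_right]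
  have := he2.lintegral_map (μ := volume.restrict (Prod.map (fun x => c + k * x)
    (fun x => c + k * x) ⁻¹' (E ×ˢ E))) f
  simp only [Prod.map] at this
  rw [hpre, ← this, ← he2.restrict_map, hmap, Measure.restrict_smul, Measure.restrict_smul, lintegral_smul_measure,
    lintegral_smul_measure]
  rfl

theorem gagliardoSq_comp_affine (s : ℝ) (c : ℝ) {k : ℝ} (hk : k ≠ 0) (v : ℝ → ℝ) (E : Set ℝ) :
    gagliardoSq s (fun x => v (c + k * x)) ((fun x => c + k * x) ⁻¹' E) =
      ENNReal.ofReal (|k| ^ (2 * s - 1)) * gagliardoSq s v E := by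
  unfold gagliardoSq
  have hk0 : 0 < |k| := abs_pos.2 hk
  have h := setLIntegral_prod_comp_affine c hk (fun z => ENNReal.ofReal (|k| ^ (1 + 2 * s)) *
    ENNReal.ofReal (|v z.1 - v z.2| ^ 2 / |z.1 - z.2| ^ (1 + 2 * s))) E
  rw [lintegral_const_mul' _ (fun z : ℝ × ℝ =>
    ENNReal.ofReal (|v z.1 - v z.2| ^ 2 / |z.1 - z.2| ^ (1 + 2 * s))) ENNReal.ofReal_ne_top,
    ← mul_assoc, ← mul_assoc,
    ← ENNReal.ofReal_mul (by positivity), ← ENNReal.ofReal_mul (by positivity)] at h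
  have hc : |k⁻¹| * |k⁻¹| * |k| ^ (1 + 2 * s) = |k| ^ (2 * s - 1) := by
    rw [abs_inv, show (1 + 2 * s) = (2 * s - 1) + 2 by ring, Real.rpow_add hk0]
    norm_num
    field_simp
    rw [sq_abs]
  rw [hc] at h
  rw [← h]
  refine lintegral_congr fun z => ?_
  rw [← ENNReal.ofReal_mul (by positivity)]
  congr 1
  have : c + k * z.1 - (c + k * z.2) = k * (z.1 - z.2) := by ring
  simp only [this, abs_mul]
  rw [Real.mul_rpow (abs_nonneg _) (abs_nonneg _)]
  have : |k| ^ (1 + 2 * s) ≠ 0 := by positivity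
  field_simp

theorem lengthScale_pos (a : ℝ) {ε : ℝ} (hε : 0 < ε) : 0 < lengthScale a ε :=
  Real.rpow_pos_of_pos hε _

/-- The exponent in `Λ_ε` makes both parts of the energy scale alike: in the variable `x / Λ_ε`
the energy `G_ε` becomes `G_1`. Translations and reflections are allowed as well. -/
theorem energy_comp_affine (ha : a < 0) (D : ℝ) (V : ℝ → ℝ) {ε : ℝ} (hε : 0 < ε) (c : ℝ) {k : ℝ}
    (hk : |k| = lengthScale a ε) (v : ℝ → ℝ) (E : Set ℝ) :
    energy a D V 1 (fun x => v (c + k * x)) ((fun x => c + k * x) ⁻¹' E) =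
      energy a D V ε v E := by
  have hL := lengthScale_pos a hε
  have hk0 : k ≠ 0 := abs_pos.1 (hk ▸ hL)
  rw [energy_one, energy, gagliardoSq_comp_affine _ _ hk0, hk,
    setLIntegral_comp_affine c hk0 (fun y => ENNReal.ofReal (V (v y))) E, abs_inv, hk, one_div,
    one_div, ← mul_assoc]
  have : lengthScale a ε ^ (2 * ((1 - a) / 2) - 1) = ε ^ (1 - a) := by
    rw [lengthScale, ← Real.rpow_mul hε.le]
    congr 1
    have : a ≠ 0 := ha.ne
    field_simp
    ring
  rw [this, ← ENNReal.ofReal_mul' (by positivity), mul_comm D⁻¹, ← div_eq_mul_inv]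

theorem energy_one_comp_neg (ha : a < 0) (D : ℝ) (V : ℝ → ℝ) (v : ℝ → ℝ) (E : Set ℝ) :
    energy a D V 1 (fun x => v (-x)) ((fun x => -x) ⁻¹' E) = energy a D V 1 v E := by
  have := energy_comp_affine ha D V one_pos 0 (k := -1) (by simp [lengthScale]) v E
  simpa using this

end

section

/-! ### Integrals of the singular kernel -/

/-- The kernel `|x - y|^{-(1+2s)}` of the Gagliardo seminorm. On the diagonal its value is `0`,
since division by zero is `0`. -/
noncomputable def singularKernel (s : ℝ) (z : ℝ × ℝ) : ℝ≥0∞ :=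
  ENNReal.ofReal (1 / |z.1 - z.2| ^ (1 + 2 * s))

theorem measurable_singularKernel (s : ℝ) : Measurable (singularKernel s) := by
  unfold singularKernel; fun_prop

theorem ofReal_sq_div (s t : ℝ) (z : ℝ × ℝ) :
    ENNReal.ofReal (t ^ 2 / |z.1 - z.2| ^ (1 + 2 * s)) =
      ENNReal.ofReal (t ^ 2) * singularKernel s z := by
  rw [singularKernel, ← ENNReal.ofReal_mul (sq_nonneg _), mul_one_div]

theorem gagliardoSq_eq (s : ℝ) (v : ℝ → ℝ) (E : Set ℝ) :
    gagliardoSq s v E =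
      ∫⁻ z in E ×ˢ E, ENNReal.ofReal (|v z.1 - v z.2| ^ 2) * singularKernel s z := by
  simp only [gagliardoSq, ofReal_sq_div]

theorem lintegral_rpow_Ici {r c : ℝ} (hr : 1 < r) (hc : 0 < c) :
    ∫⁻ t in Ici c, ENNReal.ofReal (t ^ (-r)) = ENNReal.ofReal (c ^ (1 - r) / (r - 1)) := by
  rw [setLIntegral_congr Ioi_ae_eq_Ici.symm, ← ofReal_integral_eq_lintegral_ofReal
    (integrableOn_Ioi_rpow_of_lt (by linarith) hc)]
  · rw [integral_Ioi_rpow_of_lt (by linarith) hc]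
    congr 1
    rw [show -r + 1 = 1 - r by ring, ← neg_sub r 1, div_neg, neg_div, neg_neg]
  · filter_upwards [ae_restrict_mem measurableSet_Ioi] with t ht
    exact Real.rpow_nonneg (hc.trans ht).le _

theorem lintegral_singularKernel_Ici {s x q : ℝ} (hs : 0 < s) (hx : x < q) :
    ∫⁻ y in Ici q, singularKernel s (x, y) = ENNReal.ofReal ((q - x) ^ (-(2 * s)) / (2 * s)) := by
  have h := setLIntegral_comp_affine (-x) (one_ne_zero)
    (fun t => ENNReal.ofReal (t ^ (-(1 + 2 * s)))) (Ici (q - x))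
  rw [lintegral_rpow_Ici (by linarith) (by linarith)] at h
  have hset : (fun y : ℝ => -x + 1 * y) ⁻¹' Ici (q - x) = Ici q := by
    ext y; simp
  rw [hset] at h
  simp only [inv_one, abs_one, ENNReal.ofReal_one, one_mul] at h
  have h2 : (q - x) ^ (-(2 * s)) / (2 * s) = (q - x) ^ (1 - (1 + 2 * s)) / (1 + 2 * s - 1) := by
    congr 2 <;> ring
  rw [h2, ← h]
  refine setLIntegral_congr_fun measurableSet_Ici fun y hy => ?_
  have hy' : 0 < y - x := by have := mem_Ici.1 hy; linarith
  simp only [singularKernel]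
  rw [abs_sub_comm, abs_of_pos hy', Real.rpow_neg (by linarith), one_div, neg_add_eq_sub]

/-- The interaction of two half-lines at distance `q - p`. -/
theorem lintegral_singularKernel_halfLines {s p q : ℝ} (hs : 1 / 2 < s) (hpq : p < q) :
    ∫⁻ x in Iic p, ∫⁻ y in Ici q, singularKernel s (x, y) =
      ENNReal.ofReal ((q - p) ^ (1 - 2 * s) / (2 * s - 1) / (2 * s)) := by
  have h1 : ∫⁻ x in Iic p, ∫⁻ y in Ici q, singularKernel s (x, y) =
      ∫⁻ x in Iic p, ENNReal.ofReal ((q - x) ^ (-(2 * s))) * ENNReal.ofReal (1 / (2 * s)) := by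
    refine setLIntegral_congr_fun measurableSet_Iic fun x hx => ?_
    have hx' : 0 < q - x := by have := mem_Iic.1 hx; linarith
    rw [lintegral_singularKernel_Ici (by linarith) (by linarith), div_eq_mul_one_div,
      ENNReal.ofReal_mul (by positivity)]
  rw [h1, lintegral_mul_const' _ _ ENNReal.ofReal_ne_top]
  have h := setLIntegral_comp_affine q (neg_ne_zero.2 one_ne_zero)
    (fun t => ENNReal.ofReal (t ^ (-(2 * s)))) (Ici (q - p))
  rw [lintegral_rpow_Ici (by linarith) (by linarith)] at h
  have hset : (fun y : ℝ => q + -1 * y) ⁻¹' Ici (q - p) = Iic p := by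
    ext y
    simp only [mem_preimage, mem_Ici, mem_Iic]
    constructor <;> intro h <;> linarith
  rw [hset] at h
  simp only [neg_mul, one_mul, inv_neg, inv_one, abs_neg, abs_one, ENNReal.ofReal_one,
    ← sub_eq_add_neg] at h
  have h0 : (0 : ℝ) ≤ (q - p) ^ (1 - 2 * s) / (2 * s - 1) :=
    div_nonneg (Real.rpow_nonneg (by linarith) _) (by linarith)
  rw [h, ← ENNReal.ofReal_mul h0, mul_one_div]

/-- The bound for the interaction of two half-lines at distance `L`. -/
noncomputable def tailBound (s L : ℝ) : ℝ := L ^ (1 - 2 * s) / (2 * s - 1) / (2 * s)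

theorem tailBound_nonneg {s L : ℝ} (hs : 1 / 2 < s) (hL : 0 ≤ L) : 0 ≤ tailBound s L :=
  div_nonneg (div_nonneg (Real.rpow_nonneg hL _) (by linarith)) (by linarith)

theorem tendsto_tailBound {s : ℝ} (hs : 1 / 2 < s) : Tendsto (tailBound s) atTop (𝓝 0) := by
  have := tendsto_rpow_neg_atTop (y := 2 * s - 1) (by linarith)
  have h2 := (this.div_const (2 * s - 1)).div_const (2 * s)
  rw [zero_div, zero_div, neg_sub] at h2
  exact h2

theorem lintegral_singularKernel_Iic_prod_Ici {s p q : ℝ} (hs : 1 / 2 < s) (hpq : p < q) :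
    ∫⁻ z in Iic p ×ˢ Ici q, singularKernel s z = ENNReal.ofReal (tailBound s (q - p)) := by
  rw [Measure.volume_eq_prod, ← Measure.prod_restrict,
    lintegral_prod _ (measurable_singularKernel s).aemeasurable,
    lintegral_singularKernel_halfLines hs hpq, tailBound]

theorem lintegral_singularKernel_Ici_prod_Iic {s p q : ℝ} (hs : 1 / 2 < s) (hpq : p < q) :
    ∫⁻ z in Ici q ×ˢ Iic p, singularKernel s z = ENNReal.ofReal (tailBound s (q - p)) := by
  rw [Measure.volume_eq_prod, ← Measure.prod_restrict,
    lintegral_prod_symm _ (measurable_singularKernel s).aemeasurable, tailBound,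
    ← lintegral_singularKernel_halfLines hs hpq]
  refine lintegral_congr fun x => lintegral_congr fun y => ?_
  simp [singularKernel, abs_sub_comm]

/-! ### The ramp -/

/-- The piecewise affine cutoff, `0` on `(-∞, 0]` and `1` on `[1, ∞)`. -/
def ramp (t : ℝ) : ℝ := clamp 0 1 t

theorem ramp_mem (t : ℝ) : ramp t ∈ Icc (0 : ℝ) 1 := clamp_mem zero_le_one t

theorem ramp_of_nonpos {t : ℝ} (h : t ≤ 0) : ramp t = 0 := by
  simp [ramp, clamp, h]

theorem ramp_of_one_le {t : ℝ} (h : 1 ≤ t) : ramp t = 1 := by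
  simp [ramp, clamp, h]

theorem measurable_ramp : Measurable ramp := measurable_clamp 0 1

theorem abs_ramp_sub_le (t u : ℝ) : |ramp t - ramp u| ≤ |t - u| := abs_clamp_sub_clamp_le _ _ _ _

theorem abs_ramp_sub_le_one (t u : ℝ) : |ramp t - ramp u| ≤ 1 := by
  have h1 := ramp_mem t; have h2 := ramp_mem u
  rw [abs_le]; constructor <;> linarith [h1.1, h1.2, h2.1, h2.2]

theorem sq_abs_ramp_sub_le (t u : ℝ) : |ramp t - ramp u| ^ 2 ≤ min 1 (|t - u| ^ 2) := by
  refine le_min ?_ ?_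
  · exact pow_le_one₀ (abs_nonneg _) (abs_ramp_sub_le_one t u)
  · exact pow_le_pow_left₀ (abs_nonneg _) (abs_ramp_sub_le t u) 2

/-- The constant `∫ min(1, h²) |h|^{-(1+2s)} dh`. -/
noncomputable def localConst (s : ℝ) : ℝ≥0∞ :=
  ∫⁻ h : ℝ, ENNReal.ofReal (min 1 (|h| ^ 2) * (1 / |h| ^ (1 + 2 * s)))

theorem localConst_lt_top {s : ℝ} (hs : 1 / 2 < s) (hs1 : s < 1) : localConst s < ⊤ := by
  set f : ℝ → ℝ≥0∞ := fun h => ENNReal.ofReal (min 1 (|h| ^ 2) * (1 / |h| ^ (1 + 2 * s)))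
  have hpos : ∫⁻ h in Ioi 0, f h < ⊤ := by
    rw [← Ioc_union_Ioi_eq_Ioi (zero_le_one (α := ℝ))]
    refine (lintegral_union_le _ _ _).trans_lt (ENNReal.add_lt_top.2 ⟨?_, ?_⟩)
    · have hi : IntegrableOn (fun t : ℝ => t ^ (1 - 2 * s)) (Ioc 0 1) := by
        rw [← intervalIntegrable_iff_integrableOn_Ioc_of_le zero_le_one]
        exact intervalIntegral.intervalIntegrable_rpow' (by linarith)
      refine lt_of_le_of_lt ?_ hi.lintegral_lt_top
      refine setLIntegral_mono' measurableSet_Ioc fun t ht => ENNReal.ofReal_le_ofReal ?_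
      rw [abs_of_pos ht.1, mul_one_div]
      calc min 1 (t ^ 2) / t ^ (1 + 2 * s) ≤ t ^ 2 / t ^ (1 + 2 * s) := by
            have := ht.1
            gcongr
            exact min_le_right _ _
        _ = t ^ (1 - 2 * s) := by
            rw [← Real.rpow_natCast, ← Real.rpow_sub ht.1]
            congr 1; push_cast; ring
    · have hi := integrableOn_Ioi_rpow_of_lt (a := -(1 + 2 * s)) (by linarith)
        (zero_lt_one (α := ℝ))
      refine lt_of_le_of_lt ?_ hi.lintegral_lt_top
      refine setLIntegral_mono' measurableSet_Ioi fun t ht => ENNReal.ofReal_le_ofReal ?_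
      have ht0 : 0 < t := zero_lt_one.trans ht
      rw [abs_of_pos ht0, Real.rpow_neg ht0.le, one_div]
      exact mul_le_of_le_one_left (by positivity) (min_le_left _ _)
  have hneg : ∫⁻ h in Iio 0, f h < ⊤ := by
    have h := setLIntegral_comp_affine 0 (neg_ne_zero.2 one_ne_zero) f (Ioi 0)
    have hset : (fun y : ℝ => 0 + -1 * y) ⁻¹' Ioi 0 = Iio 0 := by
      ext y; simp
    have hf : ∀ y, f (0 + -1 * y) = f y := fun y => by simp [f]
    simp only [hset, hf] at h
    rw [h]
    simpa using hpos
  have : localConst s = ∫⁻ h in Iio 0 ∪ Ici 0, f h := by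
    rw [Iio_union_Ici]; simp [localConst, f]
  rw [this]
  refine (lintegral_union_le _ _ _).trans_lt (ENNReal.add_lt_top.2 ⟨hneg, ?_⟩)
  rwa [setLIntegral_congr Ioi_ae_eq_Ici.symm]

theorem lintegral_ramp_le (s p y : ℝ) :
    ∫⁻ x, ENNReal.ofReal (|ramp (x - p) - ramp (y - p)| ^ 2) * singularKernel s (x, y) ≤
      localConst s := by
  rw [localConst, ← lintegral_sub_right_eq_self
    (fun h : ℝ => ENNReal.ofReal (min 1 (|h| ^ 2) * (1 / |h| ^ (1 + 2 * s)))) y]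
  refine lintegral_mono fun x => ?_
  rw [singularKernel, ← ENNReal.ofReal_mul (by positivity)]
  refine ENNReal.ofReal_le_ofReal ?_
  have := sq_abs_ramp_sub_le (x - p) (y - p)
  rw [sub_sub_sub_cancel_right] at this
  gcongr

end

section

/-! ### Cutting a profile off at a well -/

theorem lintegral_le_singularKernel (s : ℝ) {f : ℝ × ℝ → ℝ≥0∞} {A B C : Set (ℝ × ℝ)}
    (hA : MeasurableSet A) (hB : MeasurableSet B) (hC : C ⊆ A ∪ B) {c : ℝ≥0∞} (hc : c ≠ ⊤)
    (hfA : ∀ z ∈ A, f z ≤ c * singularKernel s z) (hfB : ∀ z ∈ B, f z = 0) :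
    ∫⁻ z in C, f z ≤ c * ∫⁻ z in A, singularKernel s z := by
  calc ∫⁻ z in C, f z ≤ ∫⁻ z in A ∪ B, f z := lintegral_mono_set hC
    _ ≤ (∫⁻ z in A, f z) + ∫⁻ z in B, f z := lintegral_union_le _ _ _
    _ ≤ c * (∫⁻ z in A, singularKernel s z) + 0 := by
        gcongr
        · rw [← lintegral_const_mul' _ _ hc]
          exact setLIntegral_mono' hA hfA
        · rw [setLIntegral_congr_fun hB hfB]; simp
    _ = _ := add_zero _

/-- The profile that equals `γ` on `(-∞, p]` and `w` on `[p + 1, ∞)`, with an affine mixture in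
between. -/
noncomputable def cutoff (γ p : ℝ) (w : ℝ → ℝ) (x : ℝ) : ℝ := γ + ramp (x - p) * (w x - γ)

theorem cutoff_of_le {γ p : ℝ} (w : ℝ → ℝ) {x : ℝ} (h : x ≤ p) : cutoff γ p w x = γ := by
  simp [cutoff, ramp_of_nonpos (sub_nonpos.2 h)]

theorem cutoff_of_add_one_le {γ p : ℝ} (w : ℝ → ℝ) {x : ℝ} (h : p + 1 ≤ x) :
    cutoff γ p w x = w x := by
  simp [cutoff, ramp_of_one_le (show 1 ≤ x - p by linarith)]

theorem measurable_cutoff (γ p : ℝ) {w : ℝ → ℝ} (hw : Measurable w) :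
    Measurable (cutoff γ p w) :=
  ((measurable_ramp.comp (measurable_id.sub_const p)).mul (hw.sub_const γ)).const_add γ

theorem abs_cutoff_sub_le (γ p : ℝ) (w : ℝ → ℝ) (x : ℝ) : |cutoff γ p w x - γ| ≤ |w x - γ| := by
  have := ramp_mem (x - p)
  rw [cutoff, add_sub_cancel_left, abs_mul, abs_of_nonneg this.1]
  exact mul_le_of_le_one_left (abs_nonneg _) this.2

theorem cutoff_mem {α β γ p : ℝ} {w : ℝ → ℝ} (hγ : γ ∈ Icc α β) {x : ℝ} (hw : w x ∈ Icc α β) :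
    cutoff γ p w x ∈ Icc α β := by
  have h := ramp_mem (x - p)
  have := (convex_Icc α β) hγ hw (sub_nonneg.2 h.2) h.1 (by ring)
  simp only [smul_eq_mul] at this
  convert this using 1
  rw [cutoff]; ring

theorem sq_add_le {δ : ℝ} (hδ : 0 < δ) (x y : ℝ) :
    (x + y) ^ 2 ≤ (1 + δ) * x ^ 2 + (1 + 1 / δ) * y ^ 2 := by
  have : (1 + δ) * x ^ 2 + (1 + 1 / δ) * y ^ 2 - (x + y) ^ 2 = (δ * x - y) ^ 2 / δ := by
    field_simp; ring
  have h2 : 0 ≤ (δ * x - y) ^ 2 / δ := by positivity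
  linarith

theorem sq_abs_cutoff_sub_le {δ : ℝ} (hδ : 0 < δ) (γ p : ℝ) (w : ℝ → ℝ) (x y : ℝ) :
    |cutoff γ p w x - cutoff γ p w y| ^ 2 ≤ (1 + δ) * |w x - w y| ^ 2 +
      (1 + 1 / δ) * (|w y - γ| ^ 2 * |ramp (x - p) - ramp (y - p)| ^ 2) := by
  have h1 : cutoff γ p w x - cutoff γ p w y =
      ramp (x - p) * (w x - w y) + (w y - γ) * (ramp (x - p) - ramp (y - p)) := by
    simp only [cutoff]; ring
  have h2 := ramp_mem (x - p)
  rw [h1, sq_abs, sq_abs, sq_abs, sq_abs, ← mul_pow]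
  refine (sq_add_le hδ _ _).trans ?_
  refine add_le_add_left (mul_le_mul_of_nonneg_left ?_ (by positivity)) _
  rw [mul_pow]
  exact mul_le_of_le_one_left (sq_nonneg _) (pow_le_one₀ h2.1 h2.2)

section

variable {s : ℝ} (hs : 1 / 2 < s) {d γ p L : ℝ} (hL : 0 < L) {w : ℝ → ℝ}

include hs hL

/-- The error made by the cutoff in the Gagliardo seminorm. Near the ramp it is controlled by the
distance of `w` to `γ`, and away from it by the decay of the kernel. -/
theorem lintegral_ramp_error_le (hw : Measurable w) (hd : ∀ x, |w x - γ| ≤ d) :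
    ∫⁻ z : ℝ × ℝ, ENNReal.ofReal (|w z.2 - γ| ^ 2 * |ramp (z.1 - p) - ramp (z.2 - p)| ^ 2) *
        singularKernel s z ≤
      localConst s * (∫⁻ y in Icc (p - L) (p + 1 + L), ENNReal.ofReal (|w y - γ| ^ 2)) +
        2 * (ENNReal.ofReal (d ^ 2) * ENNReal.ofReal (tailBound s L)) := by
  set f : ℝ × ℝ → ℝ≥0∞ := fun z =>
    ENNReal.ofReal (|w z.2 - γ| ^ 2 * |ramp (z.1 - p) - ramp (z.2 - p)| ^ 2) * singularKernel s z
  have hfd : ∀ z, f z ≤ ENNReal.ofReal (d ^ 2) * singularKernel s z := fun z => by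
    refine mul_le_mul_left (ENNReal.ofReal_le_ofReal ?_) _
    have h1 : |ramp (z.1 - p) - ramp (z.2 - p)| ^ 2 ≤ 1 :=
      pow_le_one₀ (abs_nonneg _) (abs_ramp_sub_le_one _ _)
    calc _ ≤ |w z.2 - γ| ^ 2 * 1 := by gcongr
      _ ≤ d ^ 2 := by rw [mul_one]; gcongr; exact hd _
  have hmid : ∫⁻ z in univ ×ˢ Icc (p - L) (p + 1 + L), f z ≤
      localConst s * ∫⁻ y in Icc (p - L) (p + 1 + L), ENNReal.ofReal (|w y - γ| ^ 2) := by
    have hf : Measurable f := by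
      have := measurable_ramp
      have := measurable_singularKernel s
      fun_prop
    rw [Measure.volume_eq_prod, ← Measure.prod_restrict, lintegral_prod_symm _ hf.aemeasurable,
      Measure.restrict_univ, ← lintegral_const_mul _ (by fun_prop)]
    refine lintegral_mono fun y => ?_
    have h1 : ∀ x, f (x, y) = ENNReal.ofReal (|w y - γ| ^ 2) *
        (ENNReal.ofReal (|ramp (x - p) - ramp (y - p)| ^ 2) * singularKernel s (x, y)) :=
      fun x => by
        simp only [f]
        rw [ENNReal.ofReal_mul (by positivity), mul_assoc]
    simp only [h1]
    rw [lintegral_const_mul' _ _ ENNReal.ofReal_ne_top, mul_comm]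
    gcongr
    exact lintegral_ramp_le s p y
  have hleft : ∫⁻ z in univ ×ˢ Iic (p - L), f z ≤
      ENNReal.ofReal (d ^ 2) * ENNReal.ofReal (tailBound s L) := by
    have h := lintegral_singularKernel_Ici_prod_Iic hs (show p - L < p by linarith)
    rw [sub_sub_cancel] at h
    rw [← h]
    refine lintegral_le_singularKernel s (B := Iio p ×ˢ Iic (p - L))
      (measurableSet_Ici.prod measurableSet_Iic)
      (measurableSet_Iio.prod measurableSet_Iic) ?_ ENNReal.ofReal_ne_top (fun z _ => hfd z) ?_
    · rintro ⟨x, y⟩ ⟨-, hy⟩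
      rcases lt_or_ge x p with h | h
      · exact Or.inr ⟨h, hy⟩
      · exact Or.inl ⟨h, hy⟩
    · rintro ⟨x, y⟩ ⟨hx, hy⟩
      simp only [mem_Iio, mem_Iic] at hx hy
      simp [f, ramp_of_nonpos (show x - p ≤ 0 by linarith),
        ramp_of_nonpos (show y - p ≤ 0 by linarith)]
  have hright : ∫⁻ z in univ ×ˢ Ici (p + 1 + L), f z ≤
      ENNReal.ofReal (d ^ 2) * ENNReal.ofReal (tailBound s L) := by
    have h := lintegral_singularKernel_Iic_prod_Ici hs (show p + 1 < p + 1 + L by linarith)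
    rw [add_sub_cancel_left] at h
    rw [← h]
    refine lintegral_le_singularKernel s (B := Ioi (p + 1) ×ˢ Ici (p + 1 + L))
      (measurableSet_Iic.prod measurableSet_Ici)
      (measurableSet_Ioi.prod measurableSet_Ici) ?_ ENNReal.ofReal_ne_top (fun z _ => hfd z) ?_
    · rintro ⟨x, y⟩ ⟨-, hy⟩
      rcases le_or_gt x (p + 1) with h | h
      · exact Or.inl ⟨h, hy⟩
      · exact Or.inr ⟨h, hy⟩
    · rintro ⟨x, y⟩ ⟨hx, hy⟩
      simp only [mem_Ioi, mem_Ici] at hx hy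
      simp [f, ramp_of_one_le (show 1 ≤ x - p by linarith),
        ramp_of_one_le (show 1 ≤ y - p by linarith)]
  have hU : (univ : Set (ℝ × ℝ)) ⊆ univ ×ˢ Icc (p - L) (p + 1 + L) ∪
      (univ ×ˢ Iic (p - L) ∪ univ ×ˢ Ici (p + 1 + L)) := by
    rintro ⟨x, y⟩ -
    simp only [mem_union, mem_prod, mem_univ, true_and, mem_Icc, mem_Iic, mem_Ici]
    by_contra! h
    linarith [h.1 h.2.1.le, h.2.2]
  calc ∫⁻ z, f z = ∫⁻ z in univ, f z := by rw [Measure.restrict_univ]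
    _ ≤ _ := lintegral_mono_set hU
    _ ≤ _ := lintegral_union_le _ _ _
    _ ≤ _ := add_le_add hmid ((lintegral_union_le _ _ _).trans (add_le_add hleft hright))
    _ = _ := by rw [two_mul]

theorem gagliardoSq_cutoff_le (hw : Measurable w) (hd : ∀ x, |w x - γ| ≤ d) {δ : ℝ} (hδ : 0 < δ)
    (J : Set ℝ) :
    gagliardoSq s (cutoff γ p w) J ≤ ENNReal.ofReal (1 + δ) * gagliardoSq s w J +
      ENNReal.ofReal (1 + 1 / δ) *
        (localConst s * (∫⁻ y in Icc (p - L) (p + 1 + L), ENNReal.ofReal (|w y - γ| ^ 2)) +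
        2 * (ENNReal.ofReal (d ^ 2) * ENNReal.ofReal (tailBound s L))) := by
  have hker := measurable_singularKernel s
  rw [gagliardoSq_eq, gagliardoSq_eq]
  calc ∫⁻ z in J ×ˢ J, ENNReal.ofReal (|cutoff γ p w z.1 - cutoff γ p w z.2| ^ 2) *
          singularKernel s z
      ≤ ∫⁻ z in J ×ˢ J, (ENNReal.ofReal (1 + δ) *
          (ENNReal.ofReal (|w z.1 - w z.2| ^ 2) * singularKernel s z) +
          ENNReal.ofReal (1 + 1 / δ) * (ENNReal.ofReal (|w z.2 - γ| ^ 2 *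
            |ramp (z.1 - p) - ramp (z.2 - p)| ^ 2) * singularKernel s z)) := by
        refine lintegral_mono fun z => ?_
        rw [← mul_assoc, ← mul_assoc, ← add_mul, ← ENNReal.ofReal_mul (by positivity),
          ← ENNReal.ofReal_mul (by positivity), ← ENNReal.ofReal_add (by positivity)
          (by positivity)]
        gcongr
        exact sq_abs_cutoff_sub_le hδ γ p w z.1 z.2
    _ = ENNReal.ofReal (1 + δ) * (∫⁻ z in J ×ˢ J,
          ENNReal.ofReal (|w z.1 - w z.2| ^ 2) * singularKernel s z) +
          ENNReal.ofReal (1 + 1 / δ) * ∫⁻ z in J ×ˢ J, ENNReal.ofReal (|w z.2 - γ| ^ 2 *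
            |ramp (z.1 - p) - ramp (z.2 - p)| ^ 2) * singularKernel s z := by
        rw [lintegral_add_left (by fun_prop), lintegral_const_mul' _ _ ENNReal.ofReal_ne_top,
          lintegral_const_mul' _ _ ENNReal.ofReal_ne_top]
    _ ≤ _ := by
        gcongr
        exact (setLIntegral_le_lintegral _ _).trans (lintegral_ramp_error_le hs hL hw hd)

/-- A profile that has been cut off may be continued by the constant `γ` far to the left at a
small cost. -/
theorem gagliardoSq_cutoff_union_le (hd : ∀ x, |w x - γ| ≤ d) (J : Set ℝ) :
    gagliardoSq s (cutoff γ p w) (J ∪ Iic (p - L)) ≤ gagliardoSq s (cutoff γ p w) J +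
      2 * (ENNReal.ofReal (d ^ 2) * ENNReal.ofReal (tailBound s L)) := by
  rw [gagliardoSq_eq, gagliardoSq_eq]
  set W := cutoff γ p w
  set f : ℝ × ℝ → ℝ≥0∞ := fun z => ENNReal.ofReal (|W z.1 - W z.2| ^ 2) * singularKernel s z
  have h1 : ∫⁻ z in Iic (p - L) ×ˢ univ, f z ≤
      ENNReal.ofReal (d ^ 2) * ENNReal.ofReal (tailBound s L) := by
    have h := lintegral_singularKernel_Iic_prod_Ici hs (show p - L < p by linarith)
    rw [sub_sub_cancel] at h
    rw [← h]
    refine lintegral_le_singularKernel s (B := Iic (p - L) ×ˢ Iio p)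
      (measurableSet_Iic.prod measurableSet_Ici)
      (measurableSet_Iic.prod measurableSet_Iio) ?_ ENNReal.ofReal_ne_top ?_ ?_
    · rintro ⟨x, y⟩ ⟨hx, -⟩
      rcases lt_or_ge y p with h | h
      · exact Or.inr ⟨hx, h⟩
      · exact Or.inl ⟨hx, h⟩
    · rintro ⟨x, y⟩ ⟨hx, -⟩
      simp only [mem_Iic] at hx
      refine mul_le_mul_left (ENNReal.ofReal_le_ofReal ?_) _
      have : W x = γ := cutoff_of_le w (by linarith)
      simp only [this]
      rw [abs_sub_comm]
      exact pow_le_pow_left₀ (abs_nonneg _) ((abs_cutoff_sub_le γ p w y).trans (hd y)) 2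
    · rintro ⟨x, y⟩ ⟨hx, hy⟩
      simp only [mem_Iic, mem_Iio] at hx hy
      have hx' : W x = γ := cutoff_of_le w (by linarith)
      have hy' : W y = γ := cutoff_of_le w hy.le
      simp [f, hx', hy']
  have h2 : ∫⁻ z in univ ×ˢ Iic (p - L), f z ≤
      ENNReal.ofReal (d ^ 2) * ENNReal.ofReal (tailBound s L) := by
    have h := lintegral_singularKernel_Ici_prod_Iic hs (show p - L < p by linarith)
    rw [sub_sub_cancel] at h
    rw [← h]
    refine lintegral_le_singularKernel s (B := Iio p ×ˢ Iic (p - L))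
      (measurableSet_Ici.prod measurableSet_Iic)
      (measurableSet_Iio.prod measurableSet_Iic) ?_ ENNReal.ofReal_ne_top ?_ ?_
    · rintro ⟨y, x⟩ ⟨-, hx⟩
      rcases lt_or_ge y p with h | h
      · exact Or.inr ⟨h, hx⟩
      · exact Or.inl ⟨h, hx⟩
    · rintro ⟨y, x⟩ ⟨-, hx⟩
      simp only [mem_Iic] at hx
      refine mul_le_mul_left (ENNReal.ofReal_le_ofReal ?_) _
      have : W x = γ := cutoff_of_le w (by linarith)
      simp only [this]
      exact pow_le_pow_left₀ (abs_nonneg _) ((abs_cutoff_sub_le γ p w y).trans (hd y)) 2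
    · rintro ⟨y, x⟩ ⟨hy, hx⟩
      simp only [mem_Iic, mem_Iio] at hx hy
      have hx' : W x = γ := cutoff_of_le w (by linarith)
      have hy' : W y = γ := cutoff_of_le w hy.le
      simp [f, hx', hy']
  have hU : (J ∪ Iic (p - L)) ×ˢ (J ∪ Iic (p - L)) ⊆
      J ×ˢ J ∪ (Iic (p - L) ×ˢ univ ∪ univ ×ˢ Iic (p - L)) := by
    rintro ⟨x, y⟩ ⟨hx, hy⟩
    rcases hx with hx | hx
    · rcases hy with hy | hy
      · exact Or.inl ⟨hx, hy⟩
      · exact Or.inr (Or.inr ⟨mem_univ _, hy⟩)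
    · exact Or.inr (Or.inl ⟨hx, mem_univ _⟩)
  calc ∫⁻ z in (J ∪ Iic (p - L)) ×ˢ (J ∪ Iic (p - L)), f z
      ≤ _ := lintegral_mono_set hU
    _ ≤ _ := lintegral_union_le _ _ _
    _ ≤ _ := add_le_add le_rfl ((lintegral_union_le _ _ _).trans (add_le_add h1 h2))
    _ = _ := by rw [two_mul]

end

variable {a D : ℝ} {V : ℝ → ℝ} {α' β' : ℝ}

theorem IsDoubleWell.exists_le_add_mul (hV : IsDoubleWell V α' β') {τ : ℝ} (hτ : 0 < τ) :
    ∃ C : ℝ, 0 ≤ C ∧ ∀ γ, γ = α' ∨ γ = β' → ∀ t ∈ Icc α' β', V t ≤ τ + C * |t - γ| := by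
  obtain ⟨M, hM⟩ := (isCompact_Icc (a := α') (b := β')).bddAbove_image hV.continuous.continuousOn
  have hM' : ∀ t ∈ Icc α' β', V t ≤ max M 0 := fun t ht =>
    (hM (mem_image_of_mem V ht)).trans (le_max_left _ _)
  have key : ∀ γ, V γ = 0 → ∃ C : ℝ, 0 ≤ C ∧ ∀ t ∈ Icc α' β', V t ≤ τ + C * |t - γ| := by
    intro γ hγ
    obtain ⟨ρ, hρ, h⟩ := Metric.continuousAt_iff.1 (hV.continuous.continuousAt (x := γ)) τ hτ
    refine ⟨max M 0 / ρ, by positivity, fun t ht => ?_⟩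
    by_cases hd : |t - γ| < ρ
    · have := h (x := t) (by rwa [Real.dist_eq])
      rw [hγ, Real.dist_eq, sub_zero, abs_of_nonneg (hV.nonneg t)] at this
      have : 0 ≤ max M 0 / ρ * |t - γ| := by positivity
      linarith
    · push Not at hd
      have h1 : max M 0 ≤ max M 0 / ρ * |t - γ| := by
        rw [div_mul_eq_mul_div, le_div_iff₀ hρ]
        gcongr
      linarith [hM' t ht]
  obtain ⟨C₁, hC₁, h₁⟩ := key α' hV.apply_left
  obtain ⟨C₂, hC₂, h₂⟩ := key β' hV.apply_right
  refine ⟨max C₁ C₂, hC₁.trans (le_max_left _ _), ?_⟩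
  rintro γ (rfl | rfl) t ht
  · refine (h₁ t ht).trans ?_
    gcongr; exact le_max_left _ _
  · refine (h₂ t ht).trans ?_
    gcongr; exact le_max_right _ _

/-- The potential energy of a cut-off profile exceeds that of the profile only by the contribution of
`[p, p + 1]`, since `V` vanishes at `γ`. -/
theorem lintegral_potential_cutoff_le (hV : IsDoubleWell V α' β') {γ : ℝ} (hγ : γ = α' ∨ γ = β')
    (hαβ : α' ≤ β') {τ C : ℝ} (hτ : 0 ≤ τ) (hC : 0 ≤ C)
    (h : ∀ t ∈ Icc α' β', V t ≤ τ + C * |t - γ|) {w : ℝ → ℝ}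
    (hw' : ∀ x, w x ∈ Icc α' β') (J : Set ℝ) {p L : ℝ} (hL : 0 < L) :
    ∫⁻ x in J ∪ Iic (p - L), ENNReal.ofReal (V (cutoff γ p w x)) ≤
      (∫⁻ x in J, ENNReal.ofReal (V (w x))) +
        (ENNReal.ofReal τ + ENNReal.ofReal C * ∫⁻ y in Icc (p - L) (p + 1 + L), ‖w y - γ‖ₑ) := by
  have hγV : V γ = 0 := (hV.eq_zero_iff _).2 hγ
  have hγm : γ ∈ Icc α' β' := by rcases hγ with rfl | rfl <;> simp [hαβ]
  have hU : J ∪ Iic (p - L) ⊆ (J ∩ Ioi (p + 1)) ∪ (Iio p ∪ Icc p (p + 1)) := by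
    rintro x hx
    simp only [mem_union, mem_inter_iff, mem_Ioi, mem_Iio, mem_Icc]
    rcases hx with hx | hx
    · by_cases h1 : p + 1 < x
      · exact Or.inl ⟨hx, h1⟩
      · by_cases h2 : x < p
        · exact Or.inr (Or.inl h2)
        · exact Or.inr (Or.inr ⟨not_lt.1 h2, not_lt.1 h1⟩)
    · exact Or.inr (Or.inl (by have := mem_Iic.1 hx; linarith))
  have h1 : ∫⁻ x in J ∩ Ioi (p + 1), ENNReal.ofReal (V (cutoff γ p w x)) ≤
      ∫⁻ x in J, ENNReal.ofReal (V (w x)) := by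
    refine le_trans ?_ (lintegral_mono_set (inter_subset_left (t := Ioi (p + 1))))
    refine lintegral_mono_ae ?_
    have : ∀ᵐ x ∂(volume.restrict (J ∩ Ioi (p + 1))), x ∈ Ioi (p + 1) :=
      ae_restrict_of_ae_restrict_of_subset inter_subset_right (ae_restrict_mem measurableSet_Ioi)
    filter_upwards [this] with x hx
    rw [cutoff_of_add_one_le w (le_of_lt hx)]
  have h2 : ∫⁻ x in Iio p, ENNReal.ofReal (V (cutoff γ p w x)) = 0 := by
    rw [setLIntegral_congr_fun (g := fun _ => 0) measurableSet_Iio]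
    · simp
    · intro x hx
      simp [cutoff_of_le w (le_of_lt hx), hγV]
  have h3 : ∫⁻ x in Icc p (p + 1), ENNReal.ofReal (V (cutoff γ p w x)) ≤
      ENNReal.ofReal τ + ENNReal.ofReal C * ∫⁻ y in Icc (p - L) (p + 1 + L), ‖w y - γ‖ₑ := by
    calc ∫⁻ x in Icc p (p + 1), ENNReal.ofReal (V (cutoff γ p w x))
        ≤ ∫⁻ x in Icc p (p + 1), (ENNReal.ofReal τ + ENNReal.ofReal C * ‖w x - γ‖ₑ) := by
          refine lintegral_mono fun x => ?_
          rw [Real.enorm_eq_ofReal_abs, ← ENNReal.ofReal_mul hC, ← ENNReal.ofReal_add hτ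
            (by positivity)]
          refine ENNReal.ofReal_le_ofReal ((h _ (cutoff_mem hγm (hw' x))).trans ?_)
          exact add_le_add_right (mul_le_mul_of_nonneg_left (abs_cutoff_sub_le γ p w x) hC) _
      _ = ENNReal.ofReal τ + ENNReal.ofReal C * (∫⁻ x in Icc p (p + 1), ‖w x - γ‖ₑ) := by
          rw [lintegral_add_left measurable_const, lintegral_const_mul' _ _ ENNReal.ofReal_ne_top]
          simp
      _ ≤ _ := by
          have : Icc p (p + 1) ⊆ Icc (p - L) (p + 1 + L) :=
            Icc_subset_Icc (by linarith) (by linarith)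
          gcongr
  calc ∫⁻ x in J ∪ Iic (p - L), ENNReal.ofReal (V (cutoff γ p w x))
      ≤ _ := lintegral_mono_set hU
    _ ≤ _ := lintegral_union_le _ _ _
    _ ≤ _ := add_le_add h1 ((lintegral_union_le _ _ _).trans (add_le_add h2.le h3))
    _ = _ := by rw [zero_add]

/-- A profile that is close to a well on a long window may be replaced by that well to the left of
the window, at a small cost in energy. -/
theorem exists_energy_cutoff_le (ha : -1 < a) (ha' : a < 0) (hD : 0 < D) (hαβ : α' < β')
    (hV : IsDoubleWell V α' β') {δ : ℝ} (hδ : 0 < δ) :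
    ∃ L σ : ℝ, 1 ≤ L ∧ 0 < σ ∧ ∀ γ, γ = α' ∨ γ = β' → ∀ w : ℝ → ℝ, Measurable w →
      (∀ x, w x ∈ Icc α' β') → ∀ (J : Set ℝ) (p : ℝ),
      ∫⁻ y in Icc (p - L) (p + 1 + L), ‖w y - γ‖ₑ ≤ ENNReal.ofReal σ →
      energy a D V 1 (cutoff γ p w) (J ∪ Iic (p - L)) ≤
        ENNReal.ofReal (1 + δ) * energy a D V 1 w J + ENNReal.ofReal δ := by
  set s := (1 - a) / 2
  have hs : 1 / 2 < s := by simp only [s]; linarith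
  have hs1 : s < 1 := by simp only [s]; linarith
  obtain ⟨C, hC, hCV⟩ := hV.exists_le_add_mul (show 0 < δ / 3 by linarith)
  set d := β' - α'
  have hd : 0 < d := sub_pos.2 hαβ
  set K := (localConst s).toReal
  have hK : localConst s = ENNReal.ofReal K :=
    (ENNReal.ofReal_toReal (localConst_lt_top hs hs1).ne).symm
  have hK0 : 0 ≤ K := ENNReal.toReal_nonneg
  set A := 1 / D * ((1 + 1 / δ) * (K * d)) + C
  set B := 1 / D * ((1 + 1 / δ) * (2 * d ^ 2) + 2 * d ^ 2)
  have hA : 0 ≤ A := by positivity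
  have hB : 0 ≤ B := by positivity
  set σ := δ / 3 / (A + 1)
  have hσ : 0 < σ := by positivity
  have hAσ : A * σ ≤ δ / 3 := by
    simp only [σ]
    rw [← mul_div_assoc, div_le_iff₀ (by positivity)]
    nlinarith
  obtain ⟨L, hL1, hL⟩ := ((eventually_ge_atTop (1 : ℝ)).and ((tendsto_tailBound hs).eventually
    (gt_mem_nhds (show 0 < δ / 3 / (B + 1) by positivity)))).exists
  have hL0 : 0 < L := by linarith
  set t := tailBound s L
  have ht : 0 ≤ t := tailBound_nonneg hs hL0.le
  have hBt : B * t ≤ δ / 3 := by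
    have : B * t ≤ B * (δ / 3 / (B + 1)) := by gcongr
    refine this.trans ?_
    rw [← mul_div_assoc, div_le_iff₀ (by positivity)]
    nlinarith
  refine ⟨L, σ, hL1, hσ, fun γ hγ w hw hw' J p hwin => ?_⟩
  have hwd : ∀ x, |w x - γ| ≤ d := fun x => by
    have := hw' x
    rw [abs_le]
    rcases hγ with rfl | rfl <;> constructor <;> simp only [d] <;> linarith [this.1, this.2]
  have hsq : ∫⁻ y in Icc (p - L) (p + 1 + L), ENNReal.ofReal (|w y - γ| ^ 2) ≤
      ENNReal.ofReal (d * σ) := by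
    rw [ENNReal.ofReal_mul hd.le]
    refine le_trans ?_ (mul_le_mul_right hwin _)
    rw [← lintegral_const_mul' _ _ ENNReal.ofReal_ne_top]
    refine lintegral_mono fun y => ?_
    rw [Real.enorm_eq_ofReal_abs, ← ENNReal.ofReal_mul hd.le, sq]
    gcongr
    exact hwd y
  have hg : gagliardoSq s (cutoff γ p w) (J ∪ Iic (p - L)) ≤
      ENNReal.ofReal (1 + δ) * gagliardoSq s w J + ENNReal.ofReal
        ((1 + 1 / δ) * (K * (d * σ) + 2 * (d ^ 2 * t)) + 2 * (d ^ 2 * t)) := by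
    refine (gagliardoSq_cutoff_union_le hs hL0 hwd J).trans ?_
    refine (add_le_add_left (gagliardoSq_cutoff_le (p := p) hs hL0 hw hwd hδ J) _).trans ?_
    rw [add_assoc]
    gcongr
    rw [ENNReal.ofReal_add (p := (1 + 1 / δ) * _) (by positivity) (by positivity),
      ENNReal.ofReal_mul (p := 1 + 1 / δ) (by positivity),
      ENNReal.ofReal_add (p := K * _) (by positivity) (by positivity), ENNReal.ofReal_mul hK0,
      ENNReal.ofReal_mul (p := 2) (by positivity), ENNReal.ofReal_mul (p := d ^ 2) (by positivity),
      hK, ENNReal.ofReal_ofNat]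
    gcongr
  have hp := lintegral_potential_cutoff_le hV hγ hαβ.le (by positivity) hC (hCV γ hγ) hw' J
    (p := p) hL0
  rw [energy_one, energy_one]
  calc _ ≤ ENNReal.ofReal (1 / D) * (ENNReal.ofReal (1 + δ) * gagliardoSq s w J + ENNReal.ofReal
          ((1 + 1 / δ) * (K * (d * σ) + 2 * (d ^ 2 * t)) + 2 * (d ^ 2 * t))) +
          ((∫⁻ x in J, ENNReal.ofReal (V (w x))) +
          (ENNReal.ofReal (δ / 3) + ENNReal.ofReal C * ENNReal.ofReal σ)) := by
        gcongr
        exact hp.trans (by gcongr)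
    _ = ENNReal.ofReal (1 + δ) * (ENNReal.ofReal (1 / D) * gagliardoSq s w J) +
          (∫⁻ x in J, ENNReal.ofReal (V (w x))) + ENNReal.ofReal (A * σ + B * t + δ / 3) := by
        have : A * σ + B * t + δ / 3 =
          1 / D * ((1 + 1 / δ) * (K * (d * σ) + 2 * (d ^ 2 * t)) + 2 * (d ^ 2 * t)) +
            (δ / 3 + C * σ) := by simp only [A, B]; ring
        rw [this, ENNReal.ofReal_add (p := 1 / D * _) (by positivity) (by positivity),
          ENNReal.ofReal_mul (p := 1 / D) (by positivity),
          ENNReal.ofReal_add (p := δ / 3) (by positivity) (by positivity),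
          ENNReal.ofReal_mul (p := C) hC]
        ring
    _ ≤ _ := by
        rw [mul_add]
        gcongr
        · exact le_mul_of_one_le_left (by simp) (ENNReal.one_le_ofReal.2 (by linarith))
        · linarith

/-- If `w` is close to `α'` on a long window and close to `β'` on a long window further right, it
can be turned into a competitor for the optimal profile problem at a small cost. -/
theorem exists_bridge (ha : -1 < a) (ha' : a < 0) (hD : 0 < D) (hαβ : α' < β')
    (hV : IsDoubleWell V α' β') {δ : ℝ} (hδ : 0 < δ) :
    ∃ L σ : ℝ, 1 ≤ L ∧ 0 < σ ∧ ∀ w : ℝ → ℝ, Measurable w → (∀ x, w x ∈ Icc α' β') →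
      ∀ p q : ℝ, p + 2 + L ≤ q →
      ∫⁻ y in Icc (p - L) (p + 1 + L), ‖w y - α'‖ₑ ≤ ENNReal.ofReal σ →
      ∫⁻ y in Icc (q - 1 - L) (q + L), ‖w y - β'‖ₑ ≤ ENNReal.ofReal σ →
      ∃ W : ℝ → ℝ, Measurable W ∧ (∀ x, W x ∈ Icc α' β') ∧ (∀ x ≤ p, W x = α') ∧
        (∀ x, q ≤ x → W x = β') ∧
        energy a D V 1 W univ ≤
          ENNReal.ofReal (1 + δ) * energy a D V 1 w (Icc (p - L) (q + L)) +
            ENNReal.ofReal δ := by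
  set δ₁ := min δ 1 / 3
  have hδ₁ : 0 < δ₁ := by positivity
  have hδ1 : 3 * δ₁ ≤ 1 := by simp only [δ₁]; linarith [min_le_right δ 1]
  have hδδ : 3 * δ₁ ≤ δ := by simp only [δ₁]; linarith [min_le_left δ 1]
  obtain ⟨L, σ, hL, hσ, H⟩ := exists_energy_cutoff_le ha ha' hD hαβ hV hδ₁
  refine ⟨L, σ, hL, hσ, fun w hw hw' p q hpq hp hq => ?_⟩
  have hαm : α' ∈ Icc α' β' := left_mem_Icc.2 hαβ.le
  have hβm : β' ∈ Icc α' β' := right_mem_Icc.2 hαβ.le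
  set W₁ := cutoff α' p w
  have hW₁ : Measurable W₁ := measurable_cutoff _ _ hw
  have hW₁' : ∀ x, W₁ x ∈ Icc α' β' := fun x => cutoff_mem hαm (hw' x)
  have e₁ := H α' (Or.inl rfl) w hw hw' (Icc (p - L) (q + L)) p hp
  have e₁' : energy a D V 1 W₁ (Iic (q + L)) ≤ _ := (energy_mono_set a D V 1 W₁ (by
    intro x hx
    rcases le_total x (p - L) with h | h
    · exact Or.inr h
    · exact Or.inl ⟨h, hx⟩)).trans e₁
  set w₂ : ℝ → ℝ := fun x => W₁ (-x)
  have hw₂ : Measurable w₂ := hW₁.comp measurable_neg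
  have hpre : (fun x : ℝ => -x) ⁻¹' Iic (q + L) = Ici (-q - L) := by
    ext x
    simp only [mem_preimage, mem_Iic, mem_Ici]
    constructor <;> intro h <;> linarith
  have hwin : ∫⁻ y in Icc (-q - L) (-q + 1 + L), ‖w₂ y - β'‖ₑ ≤ ENNReal.ofReal σ := by
    have h := setLIntegral_comp_affine 0 (neg_ne_zero.2 one_ne_zero)
      (fun y => ‖W₁ y - β'‖ₑ) (Icc (q - 1 - L) (q + L))
    have hset : (fun x : ℝ => 0 + -1 * x) ⁻¹' Icc (q - 1 - L) (q + L) =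
        Icc (-q - L) (-q + 1 + L) := by
      ext x
      simp only [mem_preimage, mem_Icc]
      constructor <;> intro h <;> constructor <;> linarith [h.1, h.2]
    rw [hset] at h
    simp only [zero_add, neg_mul, one_mul, inv_neg, inv_one, abs_neg, abs_one,
      ENNReal.ofReal_one] at h
    rw [show (∫⁻ y in Icc (-q - L) (-q + 1 + L), ‖w₂ y - β'‖ₑ) = _ from h]
    refine le_trans (le_of_eq ?_) hq
    refine setLIntegral_congr_fun measurableSet_Icc fun y hy => ?_
    rw [show W₁ y = w y from cutoff_of_add_one_le w (by linarith [hy.1])]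
  have e₂ := H β' (Or.inr rfl) w₂ hw₂ (fun x => hW₁' _) (Ici (-q - L)) (-q) hwin
  have hun : Ici (-q - L) ∪ Iic (-q - L) = univ := by
    rw [union_comm]; exact Iic_union_Ici
  rw [hun, ← hpre, energy_one_comp_neg ha'] at e₂
  refine ⟨fun x => cutoff β' (-q) w₂ (-x), (measurable_cutoff _ _ hw₂).comp measurable_neg,
    fun x => cutoff_mem hβm (hW₁' _), fun x hx => ?_, fun x hx => ?_, ?_⟩
  · simp only
    rw [cutoff_of_add_one_le w₂ (by linarith)]
    simp only [w₂, neg_neg]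
    exact cutoff_of_le w hx
  · exact cutoff_of_le w₂ (by linarith)
  · have := energy_one_comp_neg ha' D V (cutoff β' (-q) w₂) univ
    rw [preimage_univ] at this
    rw [this]
    refine e₂.trans ?_
    refine (add_le_add_left (mul_le_mul_right e₁' _) _).trans ?_
    rw [mul_add, ← mul_assoc, add_assoc, ← ENNReal.ofReal_mul (by positivity),
      ← ENNReal.ofReal_mul (by positivity), ← ENNReal.ofReal_add (by positivity) (by positivity)]
    gcongr <;> nlinarith

end

section

variable {a D : ℝ} {V : ℝ → ℝ} {α' β' : ℝ}

/-! ### Competitors for the optimal profile -/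

theorem optimalProfile_le_energy {W : ℝ → ℝ} (hW : Measurable W) (hW' : ∀ x, W x ∈ Icc α' β')
    {p q : ℝ} (hp : ∀ x ≤ p, W x = α') (hq : ∀ x, q ≤ x → W x = β') (hD : 0 < D) :
    optimalProfile a D V α' β' ≤ energy a D V 1 W univ := by
  by_cases hfin : energy a D V 1 W univ = ⊤
  · rw [hfin]; exact le_top
  have hg : gagliardoSq ((1 - a) / 2) W univ < ⊤ := by
    rw [energy_one] at hfin
    have h1 := (ENNReal.add_ne_top.1 hfin).1
    by_contra h
    rw [not_lt, top_le_iff] at h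
    rw [h, ENNReal.mul_top (by simpa using hD)] at h1
    exact h1 rfl
  refine iInf₂_le W ⟨fun x y => ⟨?_, ?_⟩, ?_, ?_⟩
  · refine MemLp.of_bound hW.aestronglyMeasurable (max |α'| |β'|) (Eventually.of_forall fun x => ?_)
    exact abs_le_max_abs_abs (hW' x).1 (hW' x).2
  · exact (gagliardoSq_mono_set _ _ (subset_univ _)).trans_lt hg
  · refine tendsto_const_nhds.congr' ?_
    filter_upwards [Iic_mem_atBot p] with x hx using (hp x hx).symm
  · refine tendsto_const_nhds.congr' ?_
    filter_upwards [Ici_mem_atTop q] with x hx using (hq x hx).symm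

theorem MemHsLoc.aemeasurable {s : ℝ} {v : ℝ → ℝ} (hv : MemHsLoc s v) : AEMeasurable v volume := by
  have : AEMeasurable v (volume.restrict (⋃ n : ℕ, Ioo (-(n : ℝ)) n)) :=
    aemeasurable_iUnion_iff.2 fun n => (hv _ _).1.1.aemeasurable
  rwa [show (⋃ n : ℕ, Ioo (-(n : ℝ)) n) = univ from ?_, Measure.restrict_univ] at this
  refine eq_univ_of_forall fun x => ?_
  obtain ⟨n, hn⟩ := exists_nat_gt |x|
  exact mem_iUnion.2 ⟨n, abs_lt.1 hn⟩

theorem gagliardoSq_const (s c : ℝ) (E : Set ℝ) : gagliardoSq s (fun _ => c) E = 0 := by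
  simp [gagliardoSq]

/-- The piecewise affine transition has finite energy. -/
theorem optimalProfile_lt_top (ha : -1 < a) (ha' : a < 0) (hD : 0 < D) (hαβ : α' < β')
    (hV : IsDoubleWell V α' β') : optimalProfile a D V α' β' < ⊤ := by
  have hs : 1 / 2 < (1 - a) / 2 := by linarith
  have hs1 : (1 - a) / 2 < 1 := by linarith
  have hαm : α' ∈ Icc α' β' := left_mem_Icc.2 hαβ.le
  have hβm : β' ∈ Icc α' β' := right_mem_Icc.2 hαβ.le
  set W := cutoff α' 0 (fun _ => β')
  have hW : Measurable W := measurable_cutoff _ _ measurable_const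
  refine (optimalProfile_le_energy hW (fun x => cutoff_mem hαm hβm) (p := 0) (q := 1)
    (fun x hx => cutoff_of_le _ hx) (fun x hx => cutoff_of_add_one_le _ (by simpa using hx))
    hD).trans_lt ?_
  rw [energy_one]
  refine ENNReal.add_lt_top.2 ⟨ENNReal.mul_lt_top ENNReal.ofReal_lt_top ?_, ?_⟩
  · refine (gagliardoSq_cutoff_le hs zero_lt_one measurable_const (d := |β' - α'|)
      (fun _ => le_rfl) zero_lt_one univ).trans_lt ?_
    rw [gagliardoSq_const, mul_zero, zero_add]
    refine ENNReal.mul_lt_top ENNReal.ofReal_lt_top (ENNReal.add_lt_top.2 ⟨?_, ?_⟩)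
    · refine ENNReal.mul_lt_top (localConst_lt_top hs hs1) ?_
      rw [setLIntegral_const]
      exact ENNReal.mul_lt_top ENNReal.ofReal_lt_top measure_Icc_lt_top
    · exact ENNReal.mul_lt_top (by simp) (ENNReal.mul_lt_top ENNReal.ofReal_lt_top
        ENNReal.ofReal_lt_top)
  · obtain ⟨C, hC, hCV⟩ := hV.exists_le_add_mul zero_lt_one
    have := lintegral_potential_cutoff_le hV (Or.inl rfl) hαβ.le zero_le_one hC
      (hCV α' (Or.inl rfl)) (w := fun _ => β') (fun _ => hβm) univ (p := 0) (L := 1) zero_lt_one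
    rw [univ_union] at this
    refine this.trans_lt ?_
    simp only [hV.apply_right, ENNReal.ofReal_zero, lintegral_zero, zero_add]
    refine ENNReal.add_lt_top.2 ⟨ENNReal.ofReal_lt_top, ENNReal.mul_lt_top ENNReal.ofReal_lt_top ?_⟩
    rw [setLIntegral_const]
    exact ENNReal.mul_lt_top enorm_lt_top measure_Icc_lt_top

/-- Almost optimal profiles may be taken to be constant outside a bounded interval. -/
theorem exists_profile (ha : -1 < a) (ha' : a < 0) (hD : 0 < D) (hαβ : α' < β')
    (hV : IsDoubleWell V α' β') {δ : ℝ} (hδ : 0 < δ) :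
    ∃ (W : ℝ → ℝ) (T : ℝ), 0 < T ∧ Measurable W ∧ (∀ x, W x ∈ Icc α' β') ∧
      (∀ x ≤ -T, W x = α') ∧ (∀ x, T ≤ x → W x = β') ∧
      energy a D V 1 W univ ≤ optimalProfile a D V α' β' + ENNReal.ofReal δ := by
  have hfin := optimalProfile_lt_top ha ha' hD hαβ hV
  have hlt : optimalProfile a D V α' β' <
      optimalProfile a D V α' β' + ENNReal.ofReal (δ / 2) :=
    ENNReal.lt_add_right hfin.ne (by simpa using hδ)
  obtain ⟨v, hv⟩ := iInf_lt_iff.1 hlt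
  obtain ⟨⟨hvs, hvα, hvβ⟩, hve⟩ := iInf_lt_iff.1 hv
  have hvm := hvs.aemeasurable
  set g := hvm.mk v
  have hg : Measurable g := hvm.measurable_mk
  have hvg : v =ᵐ[volume] g := hvm.ae_eq_mk
  set w : ℝ → ℝ := fun x => clamp α' β' (g x)
  have hw : Measurable w := (measurable_clamp _ _).comp hg
  have hw' : ∀ x, w x ∈ Icc α' β' := fun x => clamp_mem hαβ.le _
  have hwe : energy a D V 1 w univ ≤ energy a D V 1 v univ := by
    refine (energy_clamp_le hV hαβ.le a D 1 g univ).trans_eq ?_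
    exact (energy_congr_ae a D V 1 (by rwa [Measure.restrict_univ])).symm
  set e := (optimalProfile a D V α' β').toReal + δ / 2
  have he : optimalProfile a D V α' β' + ENNReal.ofReal (δ / 2) = ENNReal.ofReal e := by
    rw [ENNReal.ofReal_add ENNReal.toReal_nonneg (by positivity), ENNReal.ofReal_toReal hfin.ne]
  have he0 : 0 ≤ e := add_nonneg ENNReal.toReal_nonneg (by positivity)
  set δ₁ := δ / 2 / (e + 1)
  have hδ₁ : 0 < δ₁ := by positivity
  obtain ⟨L, σ, hL, hσ, H⟩ := exists_bridge ha ha' hD hαβ hV hδ₁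
  set η := σ / (2 * L + 1)
  have hη : 0 < η := by positivity
  have hησ : η * (2 * L + 1) = σ := by simp only [η]; field_simp
  have hclose : ∀ γ ∈ Icc α' β', ∀ A : Set ℝ, MeasurableSet A →
      volume A = ENNReal.ofReal (2 * L + 1) → (∀ x ∈ A, |v x - γ| ≤ η) →
      ∫⁻ y in A, ‖w y - γ‖ₑ ≤ ENNReal.ofReal σ := by
    intro γ hγ A hA hvol h
    rw [← hησ, ENNReal.ofReal_mul hη.le, ← hvol, ← setLIntegral_const]
    refine lintegral_mono_ae ?_
    filter_upwards [ae_restrict_mem hA, ae_restrict_of_ae hvg] with y hy hvgy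
    rw [Real.enorm_eq_ofReal_abs]
    refine ENNReal.ofReal_le_ofReal (le_trans ?_ (h y hy))
    rw [hvgy]
    conv_lhs => rw [← clamp_of_mem hγ]
    exact abs_clamp_sub_clamp_le _ _ _ _
  obtain ⟨T₁, hT₁⟩ := eventually_atBot.1 (hvα.eventually (Metric.closedBall_mem_nhds α' hη))
  obtain ⟨T₂, hT₂⟩ := eventually_atTop.1 (hvβ.eventually (Metric.closedBall_mem_nhds β' hη))
  set T := max 1 (max (-(T₁ - 1 - L)) (T₂ + 1 + L)) + L
  have hT0 : 1 + L ≤ T := by simp only [T]; linarith [le_max_left 1 (max (-(T₁ - 1 - L)) (T₂ + 1 + L))]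
  have hT1 : -(T₁ - 1 - L) ≤ T := by
    simp only [T]
    linarith [(le_max_left (-(T₁ - 1 - L)) (T₂ + 1 + L)).trans (le_max_right 1 _)]
  have hT2 : T₂ + 1 + L ≤ T := by
    simp only [T]
    linarith [(le_max_right (-(T₁ - 1 - L)) (T₂ + 1 + L)).trans (le_max_right 1 _)]
  obtain ⟨W, hW, hW', hWα, hWβ, hWe⟩ := H w hw hw' (-T) T (by linarith)
    (hclose α' (left_mem_Icc.2 hαβ.le) _ measurableSet_Icc
      (by rw [Real.volume_Icc]; congr 1; ring)
      (fun x hx => by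
        have := hT₁ x (by linarith [hx.2])
        rwa [Real.dist_eq] at this))
    (hclose β' (right_mem_Icc.2 hαβ.le) _ measurableSet_Icc
      (by rw [Real.volume_Icc]; congr 1; ring)
      (fun x hx => by
        have := hT₂ x (by linarith [hx.1])
        rwa [Real.dist_eq] at this))
  refine ⟨W, T, by linarith, hW, hW', hWα, hWβ, hWe.trans ?_⟩
  have hwe2 : energy a D V 1 w (Icc (-T - L) (T + L)) ≤ ENNReal.ofReal e :=
    (energy_mono_set a D V 1 w (subset_univ _)).trans (hwe.trans (hve.le.trans_eq he))
  calc _ ≤ ENNReal.ofReal (1 + δ₁) * ENNReal.ofReal e + ENNReal.ofReal δ₁ := by gcongr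
    _ = ENNReal.ofReal (e + δ / 2) := by
        rw [← ENNReal.ofReal_mul (by positivity), ← ENNReal.ofReal_add (by positivity) hδ₁.le]
        congr 1
        simp only [δ₁]
        field_simp
        ring
    _ = _ := by
        rw [ENNReal.ofReal_add he0 (by positivity), ← he, add_assoc,
          ← ENNReal.ofReal_add (by positivity) (by positivity), add_halves]

/-! ### Windows that see both phases -/

theorem continuous_windowMass {A : Set ℝ} (hA : MeasurableSet A) {H : ℝ} (hH : 0 ≤ H) :
    Continuous fun y => volume.real (A ∩ Ioc y (y + H)) := by
  have hi : ∀ x y : ℝ, IntervalIntegrable (A.indicator (1 : ℝ → ℝ)) volume x y := fun x y =>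
    ((intervalIntegrable_iff.2 ((integrableOn_const (by simp)).indicator hA)) :
      IntervalIntegrable (A.indicator fun _ => (1 : ℝ)) volume x y)
  have hc := intervalIntegral.continuous_primitive hi 0
  have : (fun y => volume.real (A ∩ Ioc y (y + H))) = fun y =>
      (∫ x in (0 : ℝ)..(y + H), A.indicator (1 : ℝ → ℝ) x) -
        ∫ x in (0 : ℝ)..y, A.indicator (1 : ℝ → ℝ) x := by
    funext y
    rw [intervalIntegral.integral_interval_sub_left (hi _ _) (hi _ _),
      intervalIntegral.integral_of_le (by linarith), integral_indicator_one hA,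
      measureReal_restrict_apply hA]
  rw [this]
  exact (hc.comp (continuous_id.add_const H)).sub hc

/-- Let `A` and `B` fill every window `(y, y + H]`, `y ∈ T`, up to a small part. Since the mass of
`A` in the window depends continuously on `y`, either some window contains a definite part of both
sets, or one of the two sets is negligible in every window. -/
theorem window_trichotomy {A B : Set ℝ} (hA : MeasurableSet A) {H μ : ℝ}
    (hH : 0 < H) (hμ : μ ≤ 1 / 4) {T : Set ℝ} (hT : IsPreconnected T)
    (hM : ∀ y ∈ T, volume.real ((A ∪ B)ᶜ ∩ Ioc y (y + H)) ≤ μ * H) :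
    (∃ y ∈ T, μ * H ≤ volume.real (A ∩ Ioc y (y + H)) ∧
      μ * H ≤ volume.real (B ∩ Ioc y (y + H))) ∨
    (∀ y ∈ T, volume.real (A ∩ Ioc y (y + H)) ≤ μ * H) ∨
    (∀ y ∈ T, volume.real (B ∩ Ioc y (y + H)) ≤ μ * H) := by
  have hsum : ∀ y ∈ T, H ≤ volume.real (A ∩ Ioc y (y + H)) + volume.real (B ∩ Ioc y (y + H)) +
      μ * H := by
    intro y hy
    have hsub : Ioc y (y + H) ⊆ (A ∩ Ioc y (y + H)) ∪ (B ∩ Ioc y (y + H)) ∪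
        ((A ∪ B)ᶜ ∩ Ioc y (y + H)) := by
      intro x hx
      by_cases h1 : x ∈ A
      · exact Or.inl (Or.inl ⟨h1, hx⟩)
      by_cases h2 : x ∈ B
      · exact Or.inl (Or.inr ⟨h2, hx⟩)
      · exact Or.inr ⟨by simp [h1, h2], hx⟩
    have hfin : ∀ C : Set ℝ, volume (C ∩ Ioc y (y + H)) ≠ ⊤ := fun C =>
      ((measure_mono inter_subset_right).trans_lt measure_Ioc_lt_top).ne
    have h1 : volume.real (Ioc y (y + H)) = H := by
      rw [Measure.real, Real.volume_Ioc, add_sub_cancel_left, ENNReal.toReal_ofReal hH.le]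
    calc H = volume.real (Ioc y (y + H)) := h1.symm
      _ ≤ _ := measureReal_mono hsub (measure_union_ne_top (measure_union_ne_top (hfin _) (hfin _))
          (hfin _))
      _ ≤ _ := measureReal_union_le _ _
      _ ≤ _ := add_le_add (measureReal_union_le _ _) (hM y hy)
  by_contra! hcon
  obtain ⟨h1, ⟨y₁, hy₁, h2⟩, ⟨y₂, hy₂, h3⟩⟩ := hcon
  have hB1 := h1 y₁ hy₁ h2.le
  have hA2 : volume.real (A ∩ Ioc y₂ (y₂ + H)) < μ * H := by
    by_contra h
    exact absurd (h1 y₂ hy₂ (not_lt.1 h)) (not_lt.2 h3.le)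
  have hμH : μ * H ≤ 1 / 4 * H := by gcongr
  obtain ⟨y, hy, hyeq⟩ := hT.intermediate_value hy₂ hy₁ (continuous_windowMass hA hH.le).continuousOn
    (show H / 2 ∈ Icc _ _ from ⟨by linarith, by linarith [hsum y₁ hy₁]⟩)
  simp only at hyeq
  have := h1 y hy (by linarith)
  linarith [hsum y hy]

/-- The set where `w` is in the lower phase. -/
def lowerPhase (α' β' : ℝ) (w : ℝ → ℝ) : Set ℝ := {x | w x ≤ α' + (β' - α') / 4}

/-- The set where `w` is in the upper phase. -/
def upperPhase (α' β' : ℝ) (w : ℝ → ℝ) : Set ℝ := {x | β' - (β' - α') / 4 ≤ w x}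

theorem measurableSet_lowerPhase {w : ℝ → ℝ} (hw : Measurable w) :
    MeasurableSet (lowerPhase α' β' w) := measurableSet_le hw measurable_const

theorem measurableSet_upperPhase {w : ℝ → ℝ} (hw : Measurable w) :
    MeasurableSet (upperPhase α' β' w) := measurableSet_le measurable_const hw

theorem IsDoubleWell.exists_pos_le (hV : IsDoubleWell V α' β') (hαβ : α' < β') :
    ∃ c > 0, ∀ t, α' + (β' - α') / 4 < t → t < β' - (β' - α') / 4 → c ≤ V t := by
  have hne : (Icc (α' + (β' - α') / 4) (β' - (β' - α') / 4)).Nonempty :=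
    nonempty_Icc.2 (by linarith)
  obtain ⟨t₀, ht₀, hmin⟩ := isCompact_Icc.exists_isMinOn hne hV.continuous.continuousOn
  refine ⟨V t₀, lt_of_le_of_ne (hV.nonneg _) fun h => ?_, fun t h1 h2 => hmin ⟨h1.le, h2.le⟩⟩
  rcases (hV.eq_zero_iff t₀).1 h.symm with h | h
  · linarith [ht₀.1]
  · linarith [ht₀.2]

theorem volume_transition_le {c : ℝ}
    (hc' : ∀ t, α' + (β' - α') / 4 < t → t < β' - (β' - α') / 4 → c ≤ V t) {w : ℝ → ℝ}
    (hw : Measurable w) (J : Set ℝ) :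
    ENNReal.ofReal c * volume ((lowerPhase α' β' w ∪ upperPhase α' β' w)ᶜ ∩ J) ≤
      ∫⁻ x in J, ENNReal.ofReal (V (w x)) := by
  have hm : MeasurableSet (lowerPhase α' β' w ∪ upperPhase α' β' w)ᶜ :=
    ((measurableSet_lowerPhase hw).union (measurableSet_upperPhase hw)).compl
  rw [← Measure.restrict_apply hm, ← setLIntegral_const]
  refine le_trans (setLIntegral_mono' hm fun x hx => ?_) (setLIntegral_le_lintegral _ _)
  simp only [lowerPhase, upperPhase, compl_union, mem_inter_iff, mem_compl_iff, mem_ofPred_eq,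
    not_le] at hx
  exact ENNReal.ofReal_le_ofReal (hc' _ hx.1 hx.2)

/-- If both phases fill a definite part of a window, the Gagliardo seminorm is bounded below. -/
theorem le_gagliardoSq_of_window {s : ℝ} (hs : 0 < s) (hαβ : α' < β') {w : ℝ → ℝ}
    (hw : Measurable w) {y H m : ℝ} (hm : 0 ≤ m)
    (hA : m ≤ volume.real (lowerPhase α' β' w ∩ Ioc y (y + H)))
    (hB : m ≤ volume.real (upperPhase α' β' w ∩ Ioc y (y + H))) {J : Set ℝ}
    (hJ : Ioc y (y + H) ⊆ J) :
    ENNReal.ofReal (((β' - α') / 2) ^ 2 / H ^ (1 + 2 * s) * m ^ 2) ≤ gagliardoSq s w J := by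
  set A := lowerPhase α' β' w ∩ Ioc y (y + H)
  set B := upperPhase α' β' w ∩ Ioc y (y + H)
  have hAm : MeasurableSet A := (measurableSet_lowerPhase hw).inter measurableSet_Ioc
  have hBm : MeasurableSet B := (measurableSet_upperPhase hw).inter measurableSet_Ioc
  have hfin : ∀ C : Set ℝ, volume (C ∩ Ioc y (y + H)) ≠ ⊤ := fun C =>
    ((measure_mono inter_subset_right).trans_lt measure_Ioc_lt_top).ne
  rcases lt_or_ge H 0 with hH | hH
  · have hE : Ioc y (y + H) = ∅ := Ioc_eq_empty (by linarith)
    have : m = 0 := le_antisymm (by simpa [A, hE] using hA) hm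
    simp [this]
  calc ENNReal.ofReal (((β' - α') / 2) ^ 2 / H ^ (1 + 2 * s) * m ^ 2)
      ≤ ENNReal.ofReal (((β' - α') / 2) ^ 2 / H ^ (1 + 2 * s)) * (volume A * volume B) := by
        rw [ENNReal.ofReal_mul (by positivity), sq m, ENNReal.ofReal_mul hm]
        gcongr
        · exact (ENNReal.ofReal_le_ofReal hA).trans_eq (ofReal_measureReal (hfin _))
        · exact (ENNReal.ofReal_le_ofReal hB).trans_eq (ofReal_measureReal (hfin _))
    _ = ∫⁻ z in A ×ˢ B, ENNReal.ofReal (((β' - α') / 2) ^ 2 / H ^ (1 + 2 * s)) := by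
        rw [setLIntegral_const, Measure.volume_eq_prod, Measure.prod_prod]
    _ ≤ ∫⁻ z in A ×ˢ B, ENNReal.ofReal (|w z.1 - w z.2| ^ 2 / |z.1 - z.2| ^ (1 + 2 * s)) := by
        refine setLIntegral_mono' (hAm.prod hBm) fun z hz => ENNReal.ofReal_le_ofReal ?_
        obtain ⟨⟨h1, h2⟩, h3, h4⟩ := hz
        simp only [lowerPhase, upperPhase, mem_ofPred_eq] at h1 h3
        have hne : z.1 ≠ z.2 := by
          intro h
          rw [h] at h1
          linarith
        have hpos : 0 < |z.1 - z.2| := abs_pos.2 (sub_ne_zero.2 hne)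
        have hle : |z.1 - z.2| ≤ H := by
          rw [abs_le]; constructor <;> linarith [h2.1, h2.2, h4.1, h4.2]
        have hw2 : (β' - α') / 2 ≤ |w z.1 - w z.2| := by
          rw [abs_sub_comm]
          refine le_trans ?_ (le_abs_self _)
          linarith
        gcongr
    _ ≤ _ := lintegral_mono_set (prod_mono (inter_subset_right.trans hJ)
        (inter_subset_right.trans hJ))

theorem volume_real_window_eq {A : Set ℝ} {y H : ℝ} (hH : 0 ≤ H)
    (h : ∀ᵐ x, x ∈ Ioc y (y + H) → x ∈ A) : volume.real (A ∩ Ioc y (y + H)) = H := by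
  have : (A ∩ Ioc y (y + H) : Set ℝ) =ᵐ[volume] Ioc y (y + H) := by
    filter_upwards [h] with x hx
    exact propext ⟨fun h => h.2, fun h => ⟨hx h, h⟩⟩
  rw [Measure.real, measure_congr this, Real.volume_Ioc, add_sub_cancel_left,
    ENNReal.toReal_ofReal hH]

/-- A transition from `α'` to `β'` either spends a definite length away from the wells, or some
window of length `1` contains a definite part of both phases. -/
theorem optimalProfile_pos (ha' : a < 0) (hD : 0 < D) (hαβ : α' < β')
    (hV : IsDoubleWell V α' β') : 0 < optimalProfile a D V α' β' := by
  obtain ⟨c, hc, hcV⟩ := hV.exists_pos_le hαβ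
  set k := ((β' - α') / 2) ^ 2 / (1 : ℝ) ^ (1 + 2 * ((1 - a) / 2)) * (1 / 4) ^ 2
  have hk : 0 < k := by
    have : 0 < β' - α' := sub_pos.2 hαβ
    positivity
  have hpos : 0 < min (ENNReal.ofReal (1 / D) * ENNReal.ofReal k) (ENNReal.ofReal (c / 4)) :=
    lt_min (ENNReal.mul_pos (by simpa using hD) (by simpa using hk)) (by simpa using hc)
  refine hpos.trans_le (le_iInf₂ ?_)
  rintro v ⟨hvs, hvα, hvβ⟩
  have hvm := hvs.aemeasurable
  set g := hvm.mk v
  have hg : Measurable g := hvm.measurable_mk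
  have hvg : v =ᵐ[volume] g := hvm.ae_eq_mk
  rw [energy_congr_ae a D V 1 (show v =ᵐ[volume.restrict univ] g by rwa [Measure.restrict_univ])]
  by_cases hE : energy a D V 1 g univ < ENNReal.ofReal (c / 4)
  swap
  · exact (min_le_right _ _).trans (not_lt.1 hE)
  refine (min_le_left _ _).trans ?_
  have hpot : ∫⁻ x in univ, ENNReal.ofReal (V (g x)) < ENNReal.ofReal (c / 4) := by
    refine lt_of_le_of_lt ?_ hE
    rw [energy_one]
    exact le_add_self
  have hM : ∀ y ∈ (univ : Set ℝ), volume.real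
      ((lowerPhase α' β' g ∪ upperPhase α' β' g)ᶜ ∩ Ioc y (y + 1)) ≤ 1 / 4 * 1 := by
    intro y _
    have h1 := (volume_transition_le hcV hg (Ioc y (y + 1))).trans
      ((lintegral_mono_set (subset_univ _)).trans hpot.le)
    have h2 := ENNReal.toReal_mono ENNReal.ofReal_ne_top h1
    rw [ENNReal.toReal_mul, ENNReal.toReal_ofReal hc.le, ENNReal.toReal_ofReal (by positivity)]
      at h2
    rw [Measure.real]
    rw [mul_comm, ← le_div_iff₀ hc] at h2
    refine h2.trans_eq ?_
    field_simp
  rcases window_trichotomy (measurableSet_lowerPhase hg) one_pos le_rfl isPreconnected_univ hM with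
    ⟨y, -, hy1, hy2⟩ | h | h
  · rw [energy_one]
    refine le_trans ?_ le_self_add
    gcongr
    exact le_gagliardoSq_of_window (by linarith) hαβ hg (by norm_num)
      (by simpa using hy1) (by simpa using hy2) (subset_univ _)
  · obtain ⟨T, hT⟩ := eventually_atBot.1
      (hvα.eventually (ge_mem_nhds (show α' < α' + (β' - α') / 4 by linarith)))
    have h1 := h (T - 1) (mem_univ _)
    rw [volume_real_window_eq zero_le_one] at h1
    · norm_num at h1
    · filter_upwards [hvg] with x hx hxT
      have := hT x (by linarith [hxT.2])
      rwa [hx] at this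
  · obtain ⟨T, hT⟩ := eventually_atTop.1
      (hvβ.eventually (le_mem_nhds (show β' - (β' - α') / 4 < β' by linarith)))
    have h1 := h T (mem_univ _)
    rw [volume_real_window_eq zero_le_one] at h1
    · norm_num at h1
    · filter_upwards [hvg] with x hx hxT
      have := hT x hxT.1.le
      rwa [hx] at this

end

section

variable {a D : ℝ} {V : ℝ → ℝ} {α' β' : ℝ}

/-! ### The energy of one transition -/

/-- Averaging: some window of length `H` carries at most twice its share of the integral. The factor
`2` accounts for `B - A` not being a multiple of `H`. -/
theorem exists_window_le {f : ℝ → ℝ≥0∞} {A B H θ : ℝ} (hH : 0 < H) (hAB : H ≤ B - A)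
    (hθ : 0 ≤ θ) (h : ∫⁻ x in Icc A B, f x ≤ ENNReal.ofReal (θ * (B - A))) :
    ∃ y, A ≤ y ∧ y + H ≤ B ∧ ∫⁻ x in Icc y (y + H), f x ≤ ENNReal.ofReal (2 * θ * H) := by
  by_contra! hcon
  set k := ⌊(B - A) / H⌋₊
  have hk1 : 1 ≤ k := Nat.one_le_floor_iff _ |>.2 ((one_le_div hH).2 hAB)
  have hkle : (k : ℝ) * H ≤ B - A := by
    rw [← le_div_iff₀ hH]
    exact Nat.floor_le (div_nonneg (by linarith) hH.le)
  have hklt : B - A < (k + 1) * H := by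
    rw [← div_lt_iff₀ hH]
    exact Nat.lt_floor_add_one _
  have hk1' : (1 : ℝ) ≤ k := by exact_mod_cast hk1
  set I : ℕ → Set ℝ := fun i => Ioc (A + i * H) (A + (i + 1) * H)
  have hlt : ∀ i ∈ Finset.range k, ENNReal.ofReal (2 * θ * H) < ∫⁻ x in I i, f x := by
    intro i hi
    have hi' : ((i : ℝ) + 1) ≤ k := by exact_mod_cast Finset.mem_range.1 hi
    have h1 := hcon (A + i * H) (by nlinarith [(Nat.cast_nonneg i : (0 : ℝ) ≤ i)])
      (by nlinarith)
    rw [setLIntegral_congr Ioc_ae_eq_Icc.symm] at h1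
    simp only [I]
    rwa [show A + ((i : ℝ) + 1) * H = A + i * H + H by ring]
  have hsum := ENNReal.sum_lt_sum_of_nonempty
    (Finset.nonempty_range_iff.2 (by omega)) hlt
  have hdisj : (Finset.range k : Set ℕ).PairwiseDisjoint I := by
    intro i _ j _ hij
    wlog hlt : i < j generalizing i j
    · exact (this ‹_› ‹_› hij.symm (lt_of_le_of_ne (not_lt.1 hlt) hij.symm)).symm
    refine Set.disjoint_left.2 fun x hx hx' => ?_
    have : ((i : ℝ) + 1) ≤ j := by exact_mod_cast hlt
    have h1 := hx.2
    have h2 := hx'.1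
    nlinarith
  rw [← lintegral_biUnion_finset hdisj (fun i _ => measurableSet_Ioc), Finset.sum_const,
    Finset.card_range, nsmul_eq_mul] at hsum
  have hsub : (⋃ i ∈ Finset.range k, I i) ⊆ Icc A B := by
    refine iUnion₂_subset fun i hi x hx => ?_
    have hi' : ((i : ℝ) + 1) ≤ k := by exact_mod_cast Finset.mem_range.1 hi
    exact ⟨by nlinarith [hx.1, (Nat.cast_nonneg i : (0 : ℝ) ≤ i)], by nlinarith [hx.2]⟩
  refine absurd (hsum.trans_le ((lintegral_mono_set hsub).trans h)) (not_lt.2 ?_)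
  rw [← ENNReal.ofReal_natCast, ← ENNReal.ofReal_mul (by positivity)]
  refine ENNReal.ofReal_le_ofReal ?_
  have : B - A ≤ 2 * k * H := by nlinarith
  calc θ * (B - A) ≤ θ * (2 * k * H) := by gcongr
    _ = _ := by ring

/-- `p` is a Lebesgue point of `u` with value `γ`: the integral of `|u - γ|` over the ball of radius
`ρ` around `p` is `o(ρ)`. -/
def HasLebesgueValue (u : ℝ → ℝ) (p γ : ℝ) : Prop :=
  ∀ θ > 0, ∀ᶠ ρ in 𝓝[>] (0 : ℝ),
    ∫⁻ y in Metric.closedBall p ρ, ‖u y - γ‖ₑ ≤ ENNReal.ofReal (θ * ρ)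

theorem ae_hasLebesgueValue {u : ℝ → ℝ} {A B : ℝ}
    (hu : Integrable u (volume.restrict (Ioo A B))) :
    ∀ᵐ p, p ∈ Ioo A B → HasLebesgueValue u p (u p) := by
  have hi : LocallyIntegrable ((Ioo A B).indicator u) volume :=
    ((integrable_indicator_iff measurableSet_Ioo).2 hu).locallyIntegrable
  filter_upwards [(Besicovitch.vitaliFamily (volume : Measure ℝ)).ae_tendsto_lintegral_enorm_sub_div
    hi] with p hp hpI θ hθ
  have h1 := hp.comp (Besicovitch.tendsto_filterAt volume p)
  have h2 := h1.eventually (ge_mem_nhds (show (0 : ℝ≥0∞) < ENNReal.ofReal (θ / 2) by simpa))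
  obtain ⟨ρ₀, hρ₀, hball⟩ := Metric.isOpen_iff.1 isOpen_Ioo p hpI
  filter_upwards [h2, self_mem_nhdsWithin, Ioo_mem_nhdsGT hρ₀] with ρ hρ hρ0 hρ1
  have hρ0 : 0 < ρ := hρ0
  have hsub : Metric.closedBall p ρ ⊆ Ioo A B :=
    (Metric.closedBall_subset_ball hρ1.2).trans hball
  have hvol : volume (Metric.closedBall p ρ) = ENNReal.ofReal (2 * ρ) := Real.volume_closedBall p ρ
  simp only [Function.comp_apply, hvol] at hρ
  rw [ENNReal.div_le_iff (by simpa using hρ0) ENNReal.ofReal_ne_top,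
    ← ENNReal.ofReal_mul (by positivity)] at hρ
  refine le_of_eq_of_le ?_ (hρ.trans_eq (by congr 1; ring))
  refine setLIntegral_congr_fun Metric.isClosed_closedBall.measurableSet fun y hy => ?_
  simp [indicator_of_mem (hsub hy), indicator_of_mem hpI]

theorem preimage_mul_closedBall {k : ℝ} (hk : k ≠ 0) (p ρ : ℝ) :
    (fun x => 0 + k * x) ⁻¹' Metric.closedBall p ρ = Metric.closedBall (p / k) (ρ / |k|) := by
  ext x
  have hk' : 0 < |k| := abs_pos.2 hk
  rw [mem_preimage, Metric.mem_closedBall, Metric.mem_closedBall, Real.dist_eq, Real.dist_eq,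
    le_div_iff₀ hk', ← abs_mul]
  have : 0 + k * x - p = (x - p / k) * k := by field_simp; ring
  rw [this]

theorem preimage_mul_ball {k : ℝ} (hk : k ≠ 0) (p ρ : ℝ) :
    (fun x => 0 + k * x) ⁻¹' Metric.ball p ρ = Metric.ball (p / k) (ρ / |k|) := by
  ext x
  have hk' : 0 < |k| := abs_pos.2 hk
  rw [mem_preimage, Metric.mem_ball, Metric.mem_ball, Real.dist_eq, Real.dist_eq,
    lt_div_iff₀ hk', ← abs_mul]
  have : 0 + k * x - p = (x - p / k) * k := by field_simp; ring
  rw [this]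

theorem tendsto_lengthScale (ha : -1 < a) (ha' : a < 0) {ε : ℕ → ℝ} (hε : Tendsto ε atTop (𝓝 0)) :
    Tendsto (fun n => lengthScale a (ε n)) atTop (𝓝 0) := by
  have h : 0 < (1 - a) / (-a) := div_pos (by linarith) (by linarith)
  have := hε.rpow_const (p := (1 - a) / (-a)) (Or.inr h.le)
  rwa [Real.zero_rpow h.ne'] at this

/-- The lower bound for one transition. Around the Lebesgue points of the limit the functions are
close to the wells on average, hence on some window of length comparable to `Λ_ε`; the part between
two such windows is almost a competitor for the optimal profile. -/
theorem eventually_lt_energy_of_transition (ha : -1 < a) (ha' : a < 0) (hD : 0 < D)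
    (hαβ : α' < β') (hV : IsDoubleWell V α' β') {ε : ℕ → ℝ} (hε : ∀ n, 0 < ε n)
    (hε0 : Tendsto ε atTop (𝓝 0)) {v : ℕ → ℝ → ℝ} (hv : ∀ n, Measurable (v n)) {u : ℝ → ℝ}
    (hu : Measurable u)
    {x r : ℝ} (hvu : Tendsto (fun n => ∫⁻ y in Metric.ball x r, ‖v n y - u y‖ₑ) atTop (𝓝 0))
    {p q : ℝ} (hp : p ∈ Metric.ball x r) (hq : q ∈ Metric.ball x r)
    (hpα : HasLebesgueValue u p α') (hqβ : HasLebesgueValue u q β') (hpq : p ≠ q)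
    {c : ℝ≥0∞} (hc : c < optimalProfile a D V α' β') :
    ∀ᶠ n in atTop, c < energy a D V (ε n) (v n) (Metric.ball x r) := by
  obtain ⟨δ, hδ, hδc⟩ : ∃ δ : ℝ, 0 < δ ∧
      ENNReal.ofReal (1 + δ) * c + ENNReal.ofReal δ < optimalProfile a D V α' β' := by
    have ht : Tendsto (fun δ : ℝ => ENNReal.ofReal (1 + δ) * c + ENNReal.ofReal δ) (𝓝[>] 0)
        (𝓝 (ENNReal.ofReal (1 + 0) * c + ENNReal.ofReal 0)) := by
      have hid : Tendsto (fun δ : ℝ => δ) (𝓝[>] 0) (𝓝 0) := nhdsWithin_le_nhds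
      exact (ENNReal.Tendsto.mul_const (ENNReal.tendsto_ofReal (hid.const_add 1))
        (Or.inr hc.ne_top)).add (ENNReal.tendsto_ofReal hid)
    have h2 := (ht.eventually (gt_mem_nhds (by simpa using hc))).and self_mem_nhdsWithin
    obtain ⟨δ, h, hδ⟩ := h2.exists
    exact ⟨δ, hδ, h⟩
  obtain ⟨L, σ, hL, hσ, H⟩ := exists_bridge ha ha' hD hαβ hV hδ
  set h := 2 * L + 1
  have hh : 0 < h := by positivity
  set θ := σ / (2 * h)
  have hθ : 0 < θ := by positivity
  have hθσ : 2 * θ * h = σ := by simp only [θ]; field_simp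
  have hd : 0 < |q - p| := abs_pos.2 (sub_ne_zero.2 hpq.symm)
  obtain ⟨rp, hrp, hbp⟩ := Metric.isOpen_iff.1 Metric.isOpen_ball p hp
  obtain ⟨rq, hrq, hbq⟩ := Metric.isOpen_iff.1 Metric.isOpen_ball q hq
  obtain ⟨ρ, ⟨⟨⟨⟨hρp, hρq⟩, h1⟩, h2⟩, h3⟩, hρ⟩ :=
    ((((((hpα θ hθ).and (hqβ θ hθ)).and (Ioo_mem_nhdsGT hrp)).and (Ioo_mem_nhdsGT hrq)).and
      (Ioo_mem_nhdsGT (show 0 < |q - p| / 2 by positivity))).and self_mem_nhdsWithin).exists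
  have hρ : 0 < ρ := hρ
  have hρ2 : 2 * ρ ≤ |q - p| := by linarith [h3.2]
  have hsp : Metric.closedBall p ρ ⊆ Metric.ball x r :=
    (Metric.closedBall_subset_ball h1.2).trans hbp
  have hsq : Metric.closedBall q ρ ⊆ Metric.ball x r :=
    (Metric.closedBall_subset_ball h2.2).trans hbq
  have ev1 := hvu.eventually (ge_mem_nhds (show (0 : ℝ≥0∞) < ENNReal.ofReal (θ * ρ) by
    simp only [ENNReal.ofReal_pos]; positivity))
  have ev2 := (tendsto_lengthScale ha ha' hε0).eventually
    (ge_mem_nhds (show 0 < 2 * ρ / h by positivity))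
  filter_upwards [ev1, ev2] with n hn1 hn2
  set Λ := lengthScale a (ε n)
  have hΛ : 0 < Λ := lengthScale_pos a (hε n)
  obtain ⟨k, hk, hkpq⟩ : ∃ k : ℝ, |k| = Λ ∧ q / k - p / k = |q - p| / Λ := by
    rcases lt_or_gt_of_ne hpq with hlt | hlt
    · exact ⟨Λ, abs_of_pos hΛ, by rw [abs_of_pos (sub_pos.2 hlt), sub_div]⟩
    · exact ⟨-Λ, by rw [abs_neg, abs_of_pos hΛ],
        by rw [abs_of_neg (sub_neg.2 hlt), div_neg, div_neg, neg_div, sub_div]; ring⟩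
  have hk0 : k ≠ 0 := abs_pos.1 (hk ▸ hΛ)
  set w : ℝ → ℝ := fun y => clamp α' β' (v n (0 + k * y))
  have hw : Measurable w := (measurable_clamp _ _).comp ((hv n).comp (by fun_prop))
  -- in the rescaled variable, `w` is close to the wells on average
  have hclose : ∀ γ ∈ Icc α' β', ∀ z, Metric.closedBall z ρ ⊆ Metric.ball x r →
      ∫⁻ y in Metric.closedBall z ρ, ‖u y - γ‖ₑ ≤ ENNReal.ofReal (θ * ρ) →
      ∃ y, z / k - ρ / Λ ≤ y ∧ y + h ≤ z / k + ρ / Λ ∧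
        ∫⁻ t in Icc y (y + h), ‖w t - γ‖ₑ ≤ ENNReal.ofReal σ := by
    intro γ hγ z hz hzu
    have e1 : ∫⁻ y in Metric.closedBall z ρ, ‖clamp α' β' (v n y) - γ‖ₑ ≤
        ENNReal.ofReal (θ * ρ) + ENNReal.ofReal (θ * ρ) := by
      calc ∫⁻ y in Metric.closedBall z ρ, ‖clamp α' β' (v n y) - γ‖ₑ
          ≤ ∫⁻ y in Metric.closedBall z ρ, (‖v n y - u y‖ₑ + ‖u y - γ‖ₑ) := by
            refine lintegral_mono fun y => ?_
            refine le_trans ?_ (enorm_add_le _ _)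
            rw [sub_add_sub_cancel, Real.enorm_eq_ofReal_abs, Real.enorm_eq_ofReal_abs]
            refine ENNReal.ofReal_le_ofReal ?_
            conv_lhs => rw [← clamp_of_mem hγ]
            exact abs_clamp_sub_clamp_le _ _ _ _
        _ = (∫⁻ y in Metric.closedBall z ρ, ‖v n y - u y‖ₑ) +
            ∫⁻ y in Metric.closedBall z ρ, ‖u y - γ‖ₑ :=
            lintegral_add_left ((hv n).sub hu).enorm _
        _ ≤ _ := add_le_add ((lintegral_mono_set hz).trans hn1) hzu
    have e2 := setLIntegral_comp_affine 0 hk0 (fun y => ‖clamp α' β' (v n y) - γ‖ₑ)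
      (Metric.closedBall z ρ)
    rw [preimage_mul_closedBall hk0, hk, Real.closedBall_eq_Icc, abs_inv, hk] at e2
    refine (exists_window_le (f := fun t => ‖w t - γ‖ₑ) hh ?_ hθ.le ?_).imp fun y hy =>
      ⟨hy.1, hy.2.1, hy.2.2.trans_eq (by rw [hθσ])⟩
    · rw [le_div_iff₀ hh] at hn2
      have : z / k + ρ / Λ - (z / k - ρ / Λ) = 2 * ρ / Λ := by ring
      rw [this, le_div_iff₀ hΛ, mul_comm]
      exact hn2
    · refine (le_of_eq e2).trans ((mul_le_mul_right e1 _).trans_eq ?_)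
      rw [← ENNReal.ofReal_add (by positivity) (by positivity),
        ← ENNReal.ofReal_mul (by positivity)]
      congr 1
      ring
  obtain ⟨y₁, hy₁, hy₁', hy₁σ⟩ := hclose α' (left_mem_Icc.2 hαβ.le) p hsp hρp
  obtain ⟨y₂, hy₂, hy₂', hy₂σ⟩ := hclose β' (right_mem_Icc.2 hαβ.le) q hsq hρq
  have hgap : 2 * (ρ / Λ) ≤ q / k - p / k := by
    rw [hkpq, ← mul_div_assoc]; gcongr
  obtain ⟨W, hW, hW', hWα, hWβ, hWe⟩ := H w hw (fun _ => clamp_mem hαβ.le _) (y₁ + L)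
    (y₂ + 1 + L) (by simp only [h] at *; linarith)
    (by rwa [show y₁ + L - L = y₁ by ring, show y₁ + L + 1 + L = y₁ + h by simp only [h]; ring])
    (by rwa [show y₂ + 1 + L - 1 - L = y₂ by ring,
      show y₂ + 1 + L + L = y₂ + h by simp only [h]; ring])
  have hκ := (optimalProfile_le_energy hW hW' hWα hWβ hD).trans hWe
  have hin : Icc (y₁ + L - L) (y₂ + 1 + L + L) ⊆ (fun t => 0 + k * t) ⁻¹' Metric.ball x r := by
    have hb : ∀ z, Metric.closedBall z ρ ⊆ Metric.ball x r →
        Icc (z / k - ρ / Λ) (z / k + ρ / Λ) ⊆ (fun t => 0 + k * t) ⁻¹' Metric.ball x r := by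
      intro z hz
      rw [← Real.closedBall_eq_Icc, ← hk, ← preimage_mul_closedBall hk0]
      exact preimage_mono hz
    have m1 := hb p hsp (show y₁ + L - L ∈ _ from ⟨by linarith, by linarith⟩)
    have m2 := hb q hsq (show y₂ + 1 + L + L ∈ _ from
      ⟨by linarith, by simp only [h] at *; linarith⟩)
    rw [preimage_mul_ball hk0, Real.ball_eq_Ioo] at m1 m2 ⊢
    exact ordConnected_Ioo.out m1 m2
  by_contra hcon
  rw [not_lt] at hcon
  refine absurd (hκ.trans ?_) (not_le.2 hδc)
  gcongr
  refine (energy_mono_set a D V 1 w hin).trans ?_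
  rw [energy_comp_affine ha' D V (hε n) 0 hk (fun y => clamp α' β' (v n y))]
  exact (energy_clamp_le hV hαβ.le _ _ _ _ _).trans hcon

/-! ### The jump set -/

/-- `u` agrees almost everywhere with a constant in a neighbourhood of `x`. -/
def LocallyAEConst (u : ℝ → ℝ) (x : ℝ) : Prop :=
  ∃ c, ∃ r > 0, ∀ᵐ y, y ∈ Metric.ball x r → u y = c

/-- The points of `(A, B)` around which `u` is not almost everywhere constant. -/
def jumpSet (A B : ℝ) (u : ℝ → ℝ) : Set ℝ := {x ∈ Ioo A B | ¬ LocallyAEConst u x}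

theorem exists_hasLebesgueValue {A B : ℝ} {u : ℝ → ℝ}
    (hu : Integrable u (volume.restrict (Ioo A B)))
    (hu2 : ∀ᵐ x, x ∈ Ioo A B → u x = α' ∨ u x = β') {x r : ℝ} (hx : x ∈ jumpSet A B u)
    (hr : 0 < r) (hxr : Metric.ball x r ⊆ Ioo A B) :
    (∃ p ∈ Metric.ball x r, HasLebesgueValue u p α') ∧
      ∃ p ∈ Metric.ball x r, HasLebesgueValue u p β' := by
  constructor
  · by_contra! hcon
    refine hx.2 ⟨β', r, hr, ?_⟩
    filter_upwards [ae_hasLebesgueValue hu, hu2] with y h1 h2 hy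
    refine (h2 (hxr hy)).resolve_left fun h => hcon y hy ?_
    rw [← h]
    exact h1 (hxr hy)
  · by_contra! hcon
    refine hx.2 ⟨α', r, hr, ?_⟩
    filter_upwards [ae_hasLebesgueValue hu, hu2] with y h1 h2 hy
    refine (h2 (hxr hy)).resolve_right fun h => hcon y hy ?_
    rw [← h]
    exact h1 (hxr hy)

theorem HasLebesgueValue.ne {u : ℝ → ℝ} (hu : Measurable u) {p q γ γ' : ℝ}
    (hp : HasLebesgueValue u p γ) (hq : HasLebesgueValue u q γ') (h : γ ≠ γ') : p ≠ q := by
  rintro rfl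
  have hd : 0 < |γ - γ'| := abs_pos.2 (sub_ne_zero.2 h)
  obtain ⟨ρ, ⟨h1, h2⟩, hρ⟩ := (((hp (|γ - γ'| / 2) (by positivity)).and
    (hq (|γ - γ'| / 2) (by positivity))).and self_mem_nhdsWithin).exists
  have hρ : 0 < ρ := hρ
  have h3 : ∫⁻ y in Metric.closedBall p ρ, ‖γ - γ'‖ₑ ≤
      ENNReal.ofReal (|γ - γ'| / 2 * ρ) + ENNReal.ofReal (|γ - γ'| / 2 * ρ) := by
    refine le_trans ?_ (add_le_add h1 h2)
    rw [← lintegral_add_left (hu.sub_const γ).enorm]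
    refine lintegral_mono fun y => ?_
    rw [← enorm_neg (u y - γ), neg_sub]
    refine le_trans ?_ (enorm_add_le _ _)
    rw [sub_add_sub_cancel]
  rw [setLIntegral_const, Real.volume_closedBall, Real.enorm_eq_ofReal_abs,
    ← ENNReal.ofReal_add (by positivity) (by positivity), ← ENNReal.ofReal_mul (by positivity),
    ENNReal.ofReal_le_ofReal_iff (by positivity)] at h3
  nlinarith [mul_pos hd hρ]

theorem exists_separating_radius (F : Finset ℝ) {U : Set ℝ} (hU : IsOpen U)
    (hF : ∀ x ∈ F, x ∈ U) :
    ∃ r > 0, (∀ x ∈ F, Metric.ball x (2 * r) ⊆ U) ∧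
      ∀ x ∈ F, ∀ y ∈ F, x ≠ y → 4 * r < dist x y := by
  have h1 : ∀ᶠ r in 𝓝[>] (0 : ℝ), ∀ x ∈ F, Metric.ball x (2 * r) ⊆ U := by
    rw [Filter.eventually_all_finset]
    intro x hx
    obtain ⟨ρ, hρ, h⟩ := Metric.isOpen_iff.1 hU x (hF x hx)
    filter_upwards [Ioo_mem_nhdsGT (show 0 < ρ / 2 by positivity)] with r hr
    exact (Metric.ball_subset_ball (by linarith [hr.2])).trans h
  have h2 : ∀ᶠ r in 𝓝[>] (0 : ℝ), ∀ x ∈ F, ∀ y ∈ F, x ≠ y → 4 * r < dist x y := by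
    rw [Filter.eventually_all_finset]
    intro x _
    rw [Filter.eventually_all_finset]
    intro y _
    by_cases hxy : x = y
    · exact Eventually.of_forall fun r h => absurd hxy h
    · filter_upwards [Ioo_mem_nhdsGT (show 0 < dist x y / 4 by
        have := dist_pos.2 hxy; positivity)] with r hr _
      linarith [hr.2]
  obtain ⟨r, ⟨h1, h2⟩, hr⟩ := ((h1.and h2).and self_mem_nhdsWithin).exists
  exact ⟨r, hr, h1, h2⟩

theorem pairwiseDisjoint_ball {F : Finset ℝ} {r : ℝ}
    (h : ∀ x ∈ F, ∀ y ∈ F, x ≠ y → 4 * r < dist x y) (hr : 0 < r) :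
    (F : Set ℝ).PairwiseDisjoint fun x => Metric.ball x r := fun x hx y hy hxy =>
  Metric.ball_disjoint_ball (by linarith [h x hx y hy hxy])

/-- The Γ-liminf inequality: each point of the jump set of the limit costs at least the optimal
profile energy. -/
theorem card_mul_optimalProfile_le_liminf (ha : -1 < a) (ha' : a < 0) (hD : 0 < D)
    (hαβ : α' < β') (hV : IsDoubleWell V α' β') {ε : ℕ → ℝ} (hε : ∀ n, 0 < ε n)
    (hε0 : Tendsto ε atTop (𝓝 0)) {v : ℕ → ℝ → ℝ} (hv : ∀ n, Measurable (v n)) {u : ℝ → ℝ}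
    (hu : Measurable u) {A B : ℝ} (hui : Integrable u (volume.restrict (Ioo A B)))
    (hu2 : ∀ᵐ x, x ∈ Ioo A B → u x = α' ∨ u x = β')
    (hvu : Tendsto (fun n => ∫⁻ y in Ioo A B, ‖v n y - u y‖ₑ) atTop (𝓝 0))
    (F : Finset ℝ) (hF : ∀ x ∈ F, x ∈ jumpSet A B u) :
    (F.card : ℝ≥0∞) * optimalProfile a D V α' β' ≤
      liminf (fun n => energy a D V (ε n) (v n) (Ioo A B)) atTop := by
  obtain ⟨r, hr, hball, hsep⟩ := exists_separating_radius F isOpen_Ioo fun x hx => (hF x hx).1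
  have hball' : ∀ x ∈ F, Metric.ball x r ⊆ Ioo A B := fun x hx =>
    (Metric.ball_subset_ball (by linarith)).trans (hball x hx)
  refine ENNReal.mul_le_of_forall_lt fun m hm c hc => ?_
  refine le_liminf_of_le (by isBoundedDefault) ?_
  have key : ∀ᶠ n in atTop, ∀ x ∈ F, c < energy a D V (ε n) (v n) (Metric.ball x r) := by
    rw [Filter.eventually_all_finset]
    intro x hx
    obtain ⟨⟨p, hp, hpα⟩, q, hq, hqβ⟩ :=
      exists_hasLebesgueValue hui hu2 (hF x hx) hr (hball' x hx)
    refine eventually_lt_energy_of_transition ha ha' hD hαβ hV hε hε0 hv hu ?_ hp hq hpα hqβ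
      (hpα.ne hu hqβ hαβ.ne) hc
    exact tendsto_of_tendsto_of_tendsto_of_le_of_le tendsto_const_nhds hvu (fun _ => bot_le)
      (fun n => lintegral_mono_set (hball' x hx))
  filter_upwards [key] with n hn
  calc m * c ≤ F.card * c := by gcongr
    _ = ∑ x ∈ F, c := by rw [Finset.sum_const, nsmul_eq_mul]
    _ ≤ ∑ x ∈ F, energy a D V (ε n) (v n) (Metric.ball x r) :=
        Finset.sum_le_sum fun x hx => (hn x hx).le
    _ ≤ _ := energy_superadd a D V (ε n) (v n) F _ (fun _ _ => Metric.isOpen_ball.measurableSet)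
        (pairwiseDisjoint_ball hsep hr) hball'

/-- The limit of a sequence of bounded energy takes its values in the wells. -/
theorem ae_eq_or_eq_of_liminf_lt_top (ha : -1 < a) (ha' : a < 0)
    (hV : IsDoubleWell V α' β') {ε : ℕ → ℝ} (hε : ∀ n, 0 < ε n)
    (hε0 : Tendsto ε atTop (𝓝 0)) {v : ℕ → ℝ → ℝ} (hv : ∀ n, Measurable (v n)) {u : ℝ → ℝ}
    (hu : Measurable u) {I : Set ℝ} (hI : MeasurableSet I)
    (hvu : Tendsto (fun n => ∫⁻ y in I, ‖v n y - u y‖ₑ) atTop (𝓝 0))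
    (hfin : liminf (fun n => energy a D V (ε n) (v n) I) atTop < ⊤) :
    ∀ᵐ x, x ∈ I → u x = α' ∨ u x = β' := by
  obtain ⟨C, hC1, hC2⟩ := exists_between hfin
  have hfreq : ∃ᶠ n in atTop, energy a D V (ε n) (v n) I < C :=
    frequently_lt_of_liminf_lt (by isBoundedDefault) hC1
  obtain ⟨φ, hφ, hφC⟩ := extraction_of_frequently_atTop hfreq
  have hpot : ∀ n, ∫⁻ x in I, ENNReal.ofReal (V (v (φ n) x)) ≤
      ENNReal.ofReal (lengthScale a (ε (φ n))) * C := by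
    intro n
    have hΛ := lengthScale_pos a (hε (φ n))
    have h1 : ENNReal.ofReal (1 / lengthScale a (ε (φ n))) *
        ∫⁻ x in I, ENNReal.ofReal (V (v (φ n) x)) ≤ C := le_trans le_add_self (hφC n).le
    calc _ = ENNReal.ofReal (lengthScale a (ε (φ n))) *
          (ENNReal.ofReal (1 / lengthScale a (ε (φ n))) *
          ∫⁻ x in I, ENNReal.ofReal (V (v (φ n) x))) := by
            rw [← mul_assoc, ← ENNReal.ofReal_mul hΛ.le, mul_one_div_cancel hΛ.ne',
              ENNReal.ofReal_one, one_mul]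
      _ ≤ _ := by gcongr
  have hΛ0 : Tendsto (fun n => ENNReal.ofReal (lengthScale a (ε (φ n))) * C) atTop (𝓝 0) := by
    have h1 := ENNReal.tendsto_ofReal ((tendsto_lengthScale ha ha' hε0).comp hφ.tendsto_atTop)
    have h2 := ENNReal.Tendsto.mul_const h1 (Or.inr hC2.ne)
    simpa using h2
  have hmeas : TendstoInMeasure (volume.restrict I) (fun n => v (φ n)) atTop u := by
    refine tendstoInMeasure_of_tendsto_eLpNorm (p := 1) one_ne_zero
      (fun n => (hv _).aestronglyMeasurable) hu.aestronglyMeasurable ?_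
    simp only [eLpNorm_one_eq_lintegral_enorm, Pi.sub_apply]
    exact hvu.comp hφ.tendsto_atTop
  obtain ⟨ψ, hψ, hae⟩ := hmeas.exists_seq_tendsto_ae
  have hzero : ∫⁻ x in I, ENNReal.ofReal (V (u x)) = 0 := by
    refine le_antisymm ?_ bot_le
    calc ∫⁻ x in I, ENNReal.ofReal (V (u x))
        = ∫⁻ x in I, liminf (fun n => ENNReal.ofReal (V (v (φ (ψ n)) x))) atTop := by
          refine lintegral_congr_ae ?_
          filter_upwards [hae] with x hx
          exact (((ENNReal.continuous_ofReal.comp hV.continuous).tendsto _).comp hx).liminf_eq.symm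
      _ ≤ liminf (fun n => ∫⁻ x in I, ENNReal.ofReal (V (v (φ (ψ n)) x))) atTop :=
          lintegral_liminf_le fun n => (hV.continuous.measurable.comp (hv _)).ennreal_ofReal
      _ ≤ liminf (fun n => ENNReal.ofReal (lengthScale a (ε (φ (ψ n)))) * C) atTop :=
          liminf_le_liminf (Eventually.of_forall fun n => hpot _)
      _ = 0 := (hΛ0.comp hψ.tendsto_atTop).liminf_eq
  have hm : Measurable fun x => ENNReal.ofReal (V (u x)) :=
    (hV.continuous.measurable.comp hu).ennreal_ofReal
  rw [lintegral_eq_zero_iff hm] at hzero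
  rw [← ae_restrict_iff' hI]
  filter_upwards [hzero] with x hx
  simp only [Pi.zero_apply, ENNReal.ofReal_eq_zero] at hx
  exact (hV.eq_zero_iff _).1 (le_antisymm hx (hV.nonneg _))

end

section

variable {α' β' : ℝ}

/-! ### Piecewise constant functions -/

theorem exists_mem_of_ae_of_isOpen {U : Set ℝ} (hU : IsOpen U) (hne : U.Nonempty) {P : ℝ → Prop}
    (h : ∀ᵐ y, y ∈ U → P y) : ∃ y ∈ U, P y := by
  by_contra! hcon
  have : volume U = 0 := by
    refine measure_mono_null ?_ (ae_iff.1 h)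
    intro y hy hP
    exact hcon y hy (hP hy)
  exact (hU.measure_pos volume hne).ne' this

theorem exists_ae_eq_const {A B : ℝ} {u : ℝ → ℝ} (hu : ∀ x ∈ Ioo A B, LocallyAEConst u x) :
    ∃ c, ∀ᵐ x, x ∈ Ioo A B → u x = c := by
  rcases (Ioo A B).eq_empty_or_nonempty with hE | ⟨x₀, hx₀⟩
  · exact ⟨0, by simp [hE]⟩
  choose! g r hr hg using hu
  have hloc : ∀ x ∈ Ioo A B, ∀ y ∈ Ioo A B, y ∈ Metric.ball x (r x) → g y = g x := by
    intro x hx y hy hyx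
    have hae : ∀ᵐ z, z ∈ Metric.ball x (r x) ∩ Metric.ball y (r y) → u z = g x ∧ u z = g y := by
      filter_upwards [hg x hx, hg y hy] with z h1 h2 hz using ⟨h1 hz.1, h2 hz.2⟩
    obtain ⟨z, -, h1, h2⟩ := exists_mem_of_ae_of_isOpen (Metric.isOpen_ball.inter Metric.isOpen_ball)
      ⟨y, hyx, Metric.mem_ball_self (hr y hy)⟩ hae
    rw [← h1, h2]
  have hder : ∀ x ∈ Ioo A B, HasDerivAt g 0 x := by
    intro x hx
    refine (hasDerivAt_const x (g x)).congr_of_eventuallyEq ?_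
    filter_upwards [isOpen_Ioo.mem_nhds hx, Metric.ball_mem_nhds x (hr x hx)] with y hy hyx
    exact hloc x hx y hy hyx
  have hconst : ∀ x ∈ Ioo A B, g x = g x₀ := fun x hx =>
    isOpen_Ioo.is_const_of_deriv_eq_zero isPreconnected_Ioo
      (fun y hy => (hder y hy).differentiableAt.differentiableWithinAt)
      (fun y hy => (hder y hy).deriv) hx hx₀
  refine ⟨g x₀, ?_⟩
  rw [ae_iff]
  refine measure_null_of_locally_null _ fun x hx => ?_
  simp only [Classical.not_imp, mem_ofPred_eq] at hx
  refine ⟨_, inter_mem_nhdsWithin _ (Metric.ball_mem_nhds x (hr x hx.1)), ?_⟩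
  refine measure_mono_null ?_ (ae_iff.1 (hg x hx.1))
  rintro y ⟨hy, hyx⟩ h
  simp only [Classical.not_imp, mem_ofPred_eq] at hy
  exact hy.2 ((h hyx).trans (hconst x hx.1))

theorem exists_one_sided_values {A B : ℝ} {u : ℝ → ℝ} {S : Set ℝ} (hS : S.Finite)
    (hu : ∀ x ∈ Ioo A B, x ∉ S → LocallyAEConst u x) {x : ℝ} (hx : x ∈ Ioo A B) :
    ∃ ρ > 0, Metric.ball x ρ ⊆ Ioo A B ∧ ∃ l m, (∀ᵐ y, y ∈ Ioo (x - ρ) x → u y = l) ∧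
      ∀ᵐ y, y ∈ Ioo x (x + ρ) → u y = m := by
  have ho : IsOpen (Ioo A B ∩ (S \ {x})ᶜ) :=
    isOpen_Ioo.inter (hS.subset sdiff_subset).isClosed.isOpen_compl
  obtain ⟨ρ, hρ, hball⟩ := Metric.isOpen_iff.1 ho x ⟨hx, by simp⟩
  rw [Real.ball_eq_Ioo] at hball
  have hloc : ∀ y ∈ Ioo (x - ρ) (x + ρ), y ≠ x → LocallyAEConst u y := fun y hy hne =>
    hu y (hball hy).1 fun h => (hball hy).2 ⟨h, hne⟩
  obtain ⟨l, hl⟩ := exists_ae_eq_const (A := x - ρ) (B := x) (u := u)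
    fun y hy => hloc y ⟨hy.1, by linarith [hy.2]⟩ hy.2.ne
  obtain ⟨m, hm⟩ := exists_ae_eq_const (A := x) (B := x + ρ) (u := u)
    fun y hy => hloc y ⟨by linarith [hy.1], hy.2⟩ hy.1.ne'
  exact ⟨ρ, hρ, by rw [Real.ball_eq_Ioo]; exact fun y hy => (hball hy).1, l, m, hl, hm⟩

theorem locallyAEConst_of_one_sided {u : ℝ → ℝ} {x ρ l : ℝ} (hρ : 0 < ρ)
    (hl : ∀ᵐ y, y ∈ Ioo (x - ρ) x → u y = l) (hm : ∀ᵐ y, y ∈ Ioo x (x + ρ) → u y = l) :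
    LocallyAEConst u x := by
  refine ⟨l, ρ, hρ, ?_⟩
  filter_upwards [hl, hm, Measure.ae_ne volume x] with y h1 h2 h3 hy
  rw [Real.ball_eq_Ioo] at hy
  rcases lt_or_gt_of_ne h3 with h | h
  · exact h1 ⟨hy.1, h⟩
  · exact h2 ⟨h, hy.2⟩

/-- The left-continuous step function with value `c₀` at `-∞` and a jump `c x` at each `x ∈ S`. -/
noncomputable def stepFunction (c₀ : ℝ) (S : Finset ℝ) (c : ℝ → ℝ) (y : ℝ) : ℝ :=
  c₀ + ∑ x ∈ S, (Ioi x).indicator (fun _ => c x) y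

theorem measurable_stepFunction (c₀ : ℝ) (S : Finset ℝ) (c : ℝ → ℝ) :
    Measurable (stepFunction c₀ S c) :=
  (Finset.measurable_sum S fun _ _ => measurable_const.indicator measurableSet_Ioi).const_add c₀

theorem stepFunction_eq_of_no_jump (c₀ : ℝ) {S : Finset ℝ} (c : ℝ → ℝ) {y z : ℝ}
    (h : ∀ x ∈ S, x < y ↔ x < z) : stepFunction c₀ S c y = stepFunction c₀ S c z := by
  unfold stepFunction
  congr 1
  refine Finset.sum_congr rfl fun x hx => ?_
  simp only [indicator, mem_Ioi]
  rw [if_congr (h x hx) rfl rfl]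

/-- A function that is locally almost everywhere constant off a finite set is a step function.
The jumps are removed one at a time. -/
theorem exists_stepFunction {A B : ℝ} (S : Finset ℝ) : ∀ {u : ℝ → ℝ},
    (∀ x ∈ Ioo A B, x ∉ S → LocallyAEConst u x) →
    ∃ (c₀ : ℝ) (c : ℝ → ℝ), ∀ᵐ y, y ∈ Ioo A B → u y = stepFunction c₀ S c y := by
  classical
  induction S using Finset.induction_on with
  | empty =>
    intro u hu
    obtain ⟨c, hc⟩ := exists_ae_eq_const fun x hx => hu x hx (by simp)
    exact ⟨c, fun _ => 0, by simpa [stepFunction] using hc⟩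
  | insert x S hxS ih =>
    intro u hu
    obtain ⟨k, hk⟩ : ∃ k : ℝ, ∀ y ∈ Ioo A B, y ∉ S →
        LocallyAEConst (fun z => u z - (Ioi x).indicator (fun _ => k) z) y := by
      have haway : ∀ k, ∀ y ∈ Ioo A B, y ∉ S → y ≠ x →
          LocallyAEConst (fun z => u z - (Ioi x).indicator (fun _ => k) z) y := by
        intro k y hy hyS hyx
        obtain ⟨c, r, hr, h⟩ := hu y hy (by simp [hyS, hyx])
        have hd : 0 < dist y x := dist_pos.2 hyx
        refine ⟨c - (Ioi x).indicator (fun _ => k) y, min r (dist y x), lt_min hr hd, ?_⟩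
        filter_upwards [h] with z hz hzb
        have h1 := Metric.ball_subset_ball (min_le_left _ _) hzb
        have h2 := Metric.ball_subset_ball (min_le_right r _) hzb
        rw [hz h1]
        congr 1
        rw [Metric.mem_ball, Real.dist_eq, Real.dist_eq] at h2
        simp only [indicator, mem_Ioi]
        refine if_congr ?_ rfl rfl
        rcases lt_or_gt_of_ne hyx with hlt | hlt
        · rw [abs_of_neg (sub_neg.2 hlt)] at h2
          have := (abs_lt.1 h2).2
          constructor <;> intro h <;> linarith
        · rw [abs_of_pos (sub_pos.2 hlt)] at h2
          have := (abs_lt.1 h2).1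
          constructor <;> intro h <;> linarith
      by_cases hx : x ∈ Ioo A B
      · obtain ⟨ρ, hρ, -, l, m, hl, hm⟩ := exists_one_sided_values (insert x S).finite_toSet
          (fun y hy hyS => hu y hy (by simpa using hyS)) hx
        refine ⟨m - l, fun y hy hyS => ?_⟩
        by_cases hyx : y = x
        · rw [hyx]
          refine locallyAEConst_of_one_sided (l := l) hρ ?_ ?_
          · filter_upwards [hl] with z hz hzI
            have : z ∉ Ioi x := notMem_Ioi.2 hzI.2.le
            simp [hz hzI, this]
          · filter_upwards [hm] with z hz hzI
            have : z ∈ Ioi x := hzI.1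
            simp [hz hzI, this]
        · exact haway _ y hy hyS hyx
      · exact ⟨0, fun y hy hyS => haway 0 y hy hyS (by rintro rfl; exact hx hy)⟩
    obtain ⟨c₀, c, hc⟩ := ih hk
    refine ⟨c₀, Function.update c x k, ?_⟩
    filter_upwards [hc] with y hy hyI
    have h1 := hy hyI
    have h2 : ∑ z ∈ S, (Ioi z).indicator (fun _ => Function.update c x k z) y =
        ∑ z ∈ S, (Ioi z).indicator (fun _ => c z) y := by
      refine Finset.sum_congr rfl fun z hz => ?_
      rw [Function.update_of_ne (ne_of_mem_of_not_mem hz hxS)]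
    rw [stepFunction, Finset.sum_insert hxS, h2, Function.update_self]
    rw [stepFunction] at h1
    linarith

/-- The structure of a two-valued function with finitely many jumps: it has a representative that
takes only the values `α'` and `β'`, and jumps from one to the other at each point of `S`. -/
theorem exists_two_valued_representative {A B : ℝ} {u : ℝ → ℝ} {S : Finset ℝ}
    (hS : ∀ x, x ∈ S ↔ x ∈ jumpSet A B u) (hu2 : ∀ᵐ x, x ∈ Ioo A B → u x = α' ∨ u x = β')
    {r : ℝ} (hr : 0 < r) (hball : ∀ x ∈ S, Metric.ball x (2 * r) ⊆ Ioo A B)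
    (hsep : ∀ x ∈ S, ∀ y ∈ S, x ≠ y → 4 * r < dist x y) :
    ∃ w : ℝ → ℝ, Measurable w ∧ (∀ᵐ x, x ∈ Ioo A B → u x = w x) ∧
      (∀ x ∈ Ioo A B, w x = α' ∨ w x = β') ∧
      (∀ y z, (∀ x ∈ S, x < y ↔ x < z) → w y = w z) ∧
      ∀ x ∈ S, (∀ y ∈ Metric.ball x (2 * r), w y = if y ≤ x then α' else β') ∨
        (∀ y ∈ Metric.ball x (2 * r), w y = if y ≤ x then β' else α') := by
  obtain ⟨c₀, c, hc⟩ := exists_stepFunction (A := A) (B := B) S (u := u) fun x hx hxS => by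
    by_contra h
    exact hxS ((hS x).2 ⟨hx, h⟩)
  set w := stepFunction c₀ S c
  have hno : ∀ y z, (∀ x ∈ S, x < y ↔ x < z) → w y = w z := fun y z h =>
    stepFunction_eq_of_no_jump c₀ c h
  have hval : ∀ x ∈ Ioo A B, w x = α' ∨ w x = β' := by
    intro x hx
    -- to the left of `x` there is an interval without jumps
    have ho : IsOpen (Ioo A B ∩ ((S : Set ℝ) \ {x})ᶜ) :=
      isOpen_Ioo.inter (S.finite_toSet.subset sdiff_subset).isClosed.isOpen_compl
    obtain ⟨ρ, hρ, hb⟩ := Metric.isOpen_iff.1 ho x ⟨hx, by simp⟩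
    rw [Real.ball_eq_Ioo] at hb
    have hae : ∀ᵐ y, y ∈ Ioo (x - ρ) x → (u y = α' ∨ u y = β') ∧ u y = w y := by
      filter_upwards [hu2, hc] with y h1 h2 hy
      have : y ∈ Ioo A B := (hb ⟨hy.1, by linarith [hy.2]⟩).1
      exact ⟨h1 this, h2 this⟩
    obtain ⟨y, hy, h1, h2⟩ := exists_mem_of_ae_of_isOpen isOpen_Ioo
      (nonempty_Ioo.2 (by linarith)) hae
    have : w x = w y := by
      refine hno x y fun z hz => ⟨fun h => ?_, fun h => h.trans hy.2⟩
      by_contra hle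
      exact (hb (show z ∈ _ from ⟨by linarith [hy.1], by linarith⟩)).2 ⟨hz, h.ne⟩
    rw [this, ← h2]
    exact h1
  refine ⟨w, measurable_stepFunction c₀ S c, hc, hval, hno, fun x hx => ?_⟩
  have honly : ∀ z ∈ S, z ∈ Metric.ball x (2 * r) → z = x := by
    intro z hz hzx
    by_contra hne
    have := hsep z hz x hx hne
    rw [Metric.mem_ball] at hzx
    linarith
  have hleft : ∀ y ∈ Metric.ball x (2 * r), y ≤ x → w y = w x := by
    intro y hy hyx
    refine hno y x fun z hz => ⟨fun h => h.trans_le hyx, fun h => ?_⟩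
    by_contra hle
    rw [Real.ball_eq_Ioo] at hy honly
    exact h.ne (honly z hz ⟨by linarith [hy.1], by linarith⟩)
  have hright : ∀ y ∈ Metric.ball x (2 * r), x < y → w y = w (x + r) := by
    intro y hy hyx
    rw [Real.ball_eq_Ioo] at hy honly
    have key : ∀ z ∈ S, ∀ t, x < t → t < x + 2 * r → (z < t ↔ z ≤ x) := by
      intro z hz t h1 h2
      refine ⟨fun h => ?_, fun h => h.trans_lt h1⟩
      by_contra hle
      exact hle (honly z hz ⟨by linarith, by linarith⟩).le
    exact hno y (x + r) fun z hz => (key z hz y hyx hy.2).trans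
      (key z hz (x + r) (by linarith) (by linarith)).symm
  have hxb : x ∈ Metric.ball x (2 * r) := Metric.mem_ball_self (by positivity)
  have hxr : x + r ∈ Metric.ball x (2 * r) := by
    rw [Real.ball_eq_Ioo]; constructor <;> linarith
  have hne : w x ≠ w (x + r) := by
    intro h
    refine ((hS x).1 hx).2 ⟨w x, 2 * r, by positivity, ?_⟩
    filter_upwards [hc] with y hy hyb
    rw [hy (hball x hx hyb)]
    rcases le_or_gt y x with h1 | h1
    · exact hleft y hyb h1
    · rw [h]; exact hright y hyb h1
  rcases hval x (hball x hx hxb) with h1 | h1 <;> rcases hval _ (hball x hx hxr) with h2 | h2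
  · exact absurd (h1.trans h2.symm) hne
  · left
    intro y hy
    split_ifs with h
    · rw [hleft y hy h, h1]
    · rw [hright y hy (not_le.1 h), h2]
  · right
    intro y hy
    split_ifs with h
    · rw [hleft y hy h, h1]
    · rw [hright y hy (not_le.1 h), h2]
  · exact absurd (h1.trans h2.symm) hne

/-! ### The jump set and the approximate limits -/

theorem LocallyAEConst.exists_hasApproxLimit {u : ℝ → ℝ} {x : ℝ} (h : LocallyAEConst u x) :
    ∃ z, HasApproxLimit u x z := by
  obtain ⟨c, r, hr, h⟩ := h
  refine ⟨c, fun η hη => tendsto_const_nhds.congr' ?_⟩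
  filter_upwards [Ioo_mem_nhdsGT hr] with ρ hρ
  have : volume (Metric.ball x ρ ∩ {y | η ≤ |u y - c|}) = 0 := by
    refine measure_mono_null ?_ (ae_iff.1 h)
    rintro y ⟨hy, hyη⟩ hc
    simp only [mem_ofPred_eq, hc (Metric.ball_subset_ball hρ.2.le hy), sub_self, abs_zero] at hyη
    linarith
  rw [this, ENNReal.zero_div]

theorem not_hasApproxLimit_of_mem_jumpSet {A B : ℝ} {u : ℝ → ℝ} (hfin : (jumpSet A B u).Finite)
    {x : ℝ} (hx : x ∈ jumpSet A B u) (z : ℝ) : ¬ HasApproxLimit u x z := by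
  intro hz
  obtain ⟨ρ, hρ, hball, l, m, hl, hm⟩ := exists_one_sided_values hfin
    (fun y hy hyS => by
      by_contra h
      exact hyS ⟨hy, h⟩) hx.1
  have hlm : l ≠ m := by
    rintro rfl
    exact hx.2 (locallyAEConst_of_one_sided hρ hl hm)
  have hd : 0 < |l - m| := abs_pos.2 (sub_ne_zero.2 hlm)
  obtain ⟨r, h1, h2⟩ := (((hz (|l - m| / 2) (by positivity)).eventually
    (gt_mem_nhds (show (0 : ℝ≥0∞) < 1 / 2 by simp))).and (Ioo_mem_nhdsGT hρ)).exists
  have hr : 0 < r := h2.1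
  -- one of the two halves of the ball lies in the exceptional set
  have hhalf : ENNReal.ofReal r ≤ volume (Metric.ball x r ∩ {y | |l - m| / 2 ≤ |u y - z|}) := by
    have htri : |l - m| ≤ |l - z| + |m - z| := by
      rw [abs_sub_comm m z]; exact abs_sub_le l z m
    rcases le_total (|l - m| / 2) |l - z| with h | h
    · have : volume (Ioo (x - r) x) = ENNReal.ofReal r := by rw [Real.volume_Ioo, sub_sub_cancel]
      rw [← this]
      refine measure_mono_ae ?_
      filter_upwards [hl] with y hy hyI
      refine ⟨by rw [Real.ball_eq_Ioo]; exact ⟨hyI.1, by linarith [hyI.2]⟩, ?_⟩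
      rw [mem_ofPred_eq, hy ⟨by linarith [hyI.1, h2.2], hyI.2⟩]
      exact h
    · have : volume (Ioo x (x + r)) = ENNReal.ofReal r := by
        rw [Real.volume_Ioo, add_sub_cancel_left]
      rw [← this]
      refine measure_mono_ae ?_
      filter_upwards [hm] with y hy hyI
      refine ⟨by rw [Real.ball_eq_Ioo]; exact ⟨by linarith [hyI.1], hyI.2⟩, ?_⟩
      rw [mem_ofPred_eq, hy ⟨hyI.1, by linarith [hyI.2, h2.2]⟩]
      linarith
  have hvol : volume (Metric.ball x r) = 2 * ENNReal.ofReal r := by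
    rw [Real.volume_ball, ENNReal.ofReal_mul zero_le_two, ENNReal.ofReal_ofNat]
  rw [hvol, ENNReal.div_lt_iff (Or.inl (by simp [hr]))
    (Or.inl (ENNReal.mul_ne_top (by simp) ENNReal.ofReal_ne_top))] at h1
  refine absurd h1 (not_lt.2 (le_trans (le_of_eq ?_) hhalf))
  rw [← mul_assoc, one_div, ENNReal.inv_mul_cancel two_ne_zero ENNReal.ofNat_ne_top, one_mul]

theorem singularSet_subset_jumpSet {E : Set ℝ} {A B : ℝ} (hE : interior E = Ioo A B)
    (u : ℝ → ℝ) : singularSet E u ⊆ jumpSet A B u := fun _ hx =>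
  ⟨hE ▸ hx.1, fun h => hx.2 h.exists_hasApproxLimit⟩

theorem singularSet_eq_jumpSet {E : Set ℝ} {A B : ℝ} (hE : interior E = Ioo A B)
    {u : ℝ → ℝ} (hfin : (jumpSet A B u).Finite) : singularSet E u = jumpSet A B u :=
  (singularSet_subset_jumpSet hE u).antisymm fun _ hx =>
    ⟨hE ▸ hx.1, fun ⟨z, hz⟩ => not_hasApproxLimit_of_mem_jumpSet hfin hx z hz⟩

end

section

variable {α' β' : ℝ}

/-! ### Functions of bounded variation with two values -/

theorem integral_stepFunction_mul_deriv_le (c₀ : ℝ) (S : Finset ℝ) (c : ℝ → ℝ) {φ : ℝ → ℝ}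
    (hφ : ContDiff ℝ 1 φ) (hφc : HasCompactSupport φ) (hφ1 : ∀ x, |φ x| ≤ 1) :
    ∫ x, stepFunction c₀ S c x * deriv φ x ≤ ∑ x ∈ S, |c x| := by
  have hcont : Continuous (deriv φ) := hφ.continuous_deriv le_rfl
  have hi : Integrable (deriv φ) := hcont.integrable_of_hasCompactSupport hφc.deriv
  have h0 : ∫ x, deriv φ x = 0 :=
    integral_eq_zero_of_hasDerivAt_of_integrable
      (fun x => (hφ.differentiable one_ne_zero x).hasDerivAt) hi
      (hφ.continuous.integrable_of_hasCompactSupport hφc)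
  have hx : ∀ x ∈ S, Integrable fun y => (Ioi x).indicator (fun _ => c x) y * deriv φ y := by
    intro x _
    have : (fun y => (Ioi x).indicator (fun _ => c x) y * deriv φ y) =
        (Ioi x).indicator fun y => c x * deriv φ y := by
      funext y
      by_cases hy : y ∈ Ioi x <;> simp [hy]
    rw [this]
    exact (hi.const_mul _).indicator measurableSet_Ioi
  have hval : ∀ x ∈ S, ∫ y, (Ioi x).indicator (fun _ => c x) y * deriv φ y = c x * -φ x := by
    intro x _
    have : (fun y => (Ioi x).indicator (fun _ => c x) y * deriv φ y) =
        (Ioi x).indicator fun y => c x * deriv φ y := by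
      funext y
      by_cases hy : y ∈ Ioi x <;> simp [hy]
    rw [this, integral_indicator measurableSet_Ioi, integral_const_mul,
      hφc.integral_Ioi_deriv_eq hφ]
  simp only [stepFunction, add_mul, Finset.sum_mul]
  rw [integral_add (hi.const_mul c₀) (integrable_finsetSum S hx), integral_const_mul, h0,
    mul_zero, zero_add, integral_finsetSum S hx]
  refine Finset.sum_le_sum fun x hxS => ?_
  rw [hval x hxS]
  refine (le_abs_self _).trans ?_
  rw [abs_mul, abs_neg]
  exact mul_le_of_le_one_right (abs_nonneg _) (hφ1 x)

theorem memBVTwo_iff {E : Set ℝ} {A B : ℝ} (hE : interior E = Ioo A B)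
    (hEr : volume.restrict E = volume.restrict (Ioo A B)) {u : L1 E} :
    MemBVTwo E α' β' u ↔ (∀ᵐ x, x ∈ Ioo A B → u x = α' ∨ u x = β') ∧
      ∃ C : ℝ, ∀ φ : ℝ → ℝ, ContDiff ℝ 1 φ → HasCompactSupport φ → tsupport φ ⊆ Ioo A B →
        (∀ x, |φ x| ≤ 1) → ∫ x in Ioo A B, u x * deriv φ x ≤ C := by
  unfold MemBVTwo
  generalize (u : ℝ → ℝ) = f
  rw [hE, hEr, ae_restrict_iff' measurableSet_Ioo]

theorem memBVTwo_of_finite_jumpSet {E : Set ℝ} {A B : ℝ} (hE : interior E = Ioo A B)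
    (hEr : volume.restrict E = volume.restrict (Ioo A B)) {u : L1 E}
    (hu2 : ∀ᵐ x, x ∈ Ioo A B → u x = α' ∨ u x = β') (hfin : (jumpSet A B u).Finite) :
    MemBVTwo E α' β' u := by
  rw [memBVTwo_iff hE hEr]
  refine ⟨hu2, ?_⟩
  obtain ⟨c₀, c, hc⟩ := exists_stepFunction (A := A) (B := B) hfin.toFinset (u := u)
    fun x hx hxS => by
      by_contra h
      exact hxS (hfin.mem_toFinset.2 ⟨hx, h⟩)
  refine ⟨∑ x ∈ hfin.toFinset, |c x|, fun φ hφ hφc hφE hφ1 => ?_⟩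
  have h1 : ∫ x in Ioo A B, u x * deriv φ x =
      ∫ x in Ioo A B, stepFunction c₀ hfin.toFinset c x * deriv φ x := by
    refine setIntegral_congr_ae measurableSet_Ioo ?_
    filter_upwards [hc] with x hx hxI
    rw [hx hxI]
  rw [h1, setIntegral_eq_integral_of_forall_compl_eq_zero]
  · exact integral_stepFunction_mul_deriv_le c₀ _ c hφ hφc hφ1
  · intro x hx
    have : x ∉ tsupport (deriv φ) := fun h => hx (hφE (tsupport_deriv_subset h))
    rw [image_eq_zero_of_notMem_tsupport this, mul_zero]

/-- Averaging over a small ball around a Lebesgue point. -/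
theorem abs_setIntegral_mul_normed_sub_le {A B : ℝ} {u : ℝ → ℝ}
    (hu : Integrable u (volume.restrict (Ioo A B))) {p γ θ : ℝ} (f : ContDiffBump p)
    (hf : f.rIn = f.rOut / 2)
    (hball : Metric.closedBall p f.rOut ⊆ Ioo A B) (hθ : 0 ≤ θ)
    (h : ∫⁻ y in Metric.closedBall p f.rOut, ‖u y - γ‖ₑ ≤ ENNReal.ofReal (θ * f.rOut)) :
    Integrable (fun y => u y * f.normed volume y) (volume.restrict (Ioo A B)) ∧
      |(∫ y in Ioo A B, u y * f.normed volume y) - γ| ≤ θ := by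
  have hR := f.rOut_pos
  have hsupp : ∀ y, y ∉ Metric.closedBall p f.rOut → f.normed volume y = 0 := by
    intro y hy
    have : y ∉ Function.support (f.normed volume) := by
      rw [f.support_normed_eq]
      exact fun h => hy (Metric.ball_subset_closedBall h)
    simpa using this
  have hle : ∀ y, ‖f.normed volume y‖ ≤ 1 / f.rOut := by
    intro y
    rw [Real.norm_of_nonneg (f.nonneg_normed y)]
    refine (f.normed_le_div_measure_closedBall_rIn volume y).trans_eq ?_
    rw [Measure.real, Real.volume_closedBall, ENNReal.toReal_ofReal (by have := f.rIn_pos; positivity),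
      hf]
    congr 1; ring
  have hcf : Continuous (f.normed volume : ℝ → ℝ) := f.continuous_normed
  have hfi : Integrable (f.normed volume) (volume.restrict (Ioo A B)) :=
    f.integrable_normed.restrict
  have hui : Integrable (fun y => u y * f.normed volume y) (volume.restrict (Ioo A B)) :=
    hu.mul_bdd (c := 1 / f.rOut) hcf.aestronglyMeasurable (Eventually.of_forall hle)
  refine ⟨hui, ?_⟩
  have hone : ∫ y in Ioo A B, f.normed volume y = 1 := by
    rw [setIntegral_eq_integral_of_forall_compl_eq_zero fun y hy => hsupp y fun h => hy (hball h)]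
    exact f.integral_normed
  have heq : (∫ y in Ioo A B, u y * f.normed volume y) - γ =
      ∫ y in Ioo A B, (u y - γ) * f.normed volume y := by
    simp only [sub_mul]
    rw [integral_sub hui (hfi.const_mul γ), integral_const_mul, hone, mul_one]
  rw [heq, ← ENNReal.ofReal_le_ofReal_iff hθ, ← Real.enorm_eq_ofReal_abs]
  refine (enorm_integral_le_lintegral_enorm _).trans ?_
  have hsub : (∫⁻ y in Ioo A B, ‖(u y - γ) * f.normed volume y‖ₑ) ≤
      ∫⁻ y in Metric.closedBall p f.rOut, ‖u y - γ‖ₑ * ENNReal.ofReal (1 / f.rOut) := by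
    rw [← lintegral_indicator Metric.isClosed_closedBall.measurableSet]
    refine (setLIntegral_le_lintegral _ _).trans (lintegral_mono fun y => ?_)
    by_cases hy : y ∈ Metric.closedBall p f.rOut
    · rw [indicator_of_mem hy, enorm_mul]
      gcongr
      rw [← ofReal_norm]
      exact ENNReal.ofReal_le_ofReal (hle y)
    · rw [hsupp y hy]; simp
  refine hsub.trans ?_
  rw [lintegral_mul_const' _ _ ENNReal.ofReal_ne_top]
  refine (mul_le_mul_left h _).trans_eq ?_
  rw [← ENNReal.ofReal_mul (by positivity)]
  congr 1
  field_simp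

theorem contDiff_primitive {f : ℝ → ℝ} (hf : Continuous f) (y₀ : ℝ) :
    ContDiff ℝ 1 (fun y => ∫ t in y₀..y, f t) ∧
      deriv (fun y => ∫ t in y₀..y, f t) = f := by
  have hd : deriv (fun y => ∫ t in y₀..y, f t) = f :=
    funext fun y => hf.deriv_integral f y₀ y
  refine ⟨contDiff_one_iff_deriv.2 ⟨?_, by rwa [hd]⟩, hd⟩
  exact fun y => (intervalIntegral.integral_hasDerivAt_right (hf.intervalIntegrable _ _)
    (hf.stronglyMeasurableAtFilter _ _) hf.continuousAt).differentiableAt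

theorem primitive_normed_mem {p y₀ : ℝ} (f : ContDiffBump p) (hy₀ : y₀ ≤ p - f.rOut) (y : ℝ) :
    (∫ t in y₀..y, f.normed volume t) ∈ Icc (0 : ℝ) 1 ∧
      (y ≤ p - f.rOut → ∫ t in y₀..y, f.normed volume t = 0) ∧
      (p + f.rOut ≤ y → ∫ t in y₀..y, f.normed volume t = 1) := by
  have hsupp : ∀ t, t ∉ Ioo (p - f.rOut) (p + f.rOut) → f.normed volume t = 0 := by
    intro t ht
    have : t ∉ Function.support (f.normed volume) := by
      rwa [f.support_normed_eq, Real.ball_eq_Ioo]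
    simpa using this
  have hzero : y ≤ p - f.rOut → ∫ t in y₀..y, f.normed volume t = 0 := by
    intro hy
    rw [intervalIntegral.integral_congr (g := fun _ => 0), intervalIntegral.integral_zero]
    intro t ht
    refine hsupp t fun h => ?_
    have := ht.2
    linarith [h.1, max_le hy₀ hy]
  have hle : y₀ ≤ y → (∫ t in y₀..y, f.normed volume t) ∈ Icc (0 : ℝ) 1 := by
    intro h
    rw [intervalIntegral.integral_of_le h]
    refine ⟨integral_nonneg fun t => f.nonneg_normed t, ?_⟩
    rw [← f.integral_normed (μ := volume)]
    exact setIntegral_le_integral f.integrable_normed (Eventually.of_forall f.nonneg_normed)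
  refine ⟨?_, hzero, fun hy => ?_⟩
  · rcases le_total y₀ y with h | h
    · exact hle h
    · rw [hzero (h.trans hy₀)]; simp
  · have hR := f.rOut_pos
    rw [intervalIntegral.integral_of_le (by linarith), setIntegral_eq_integral_of_forall_compl_eq_zero,
      f.integral_normed]
    intro t ht
    refine hsupp t fun h => ht ⟨by linarith [h.1], by linarith [h.2]⟩

/-- A test function supported near a jump that detects it. -/
theorem exists_test_function {A B : ℝ} (hαβ : α' < β') {u : ℝ → ℝ}
    (hu : Integrable u (volume.restrict (Ioo A B))) {x r : ℝ} (hr : Metric.ball x r ⊆ Ioo A B)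
    {p q : ℝ} (hp : p ∈ Metric.ball x r) (hq : q ∈ Metric.ball x r)
    (hpα : HasLebesgueValue u p α') (hqβ : HasLebesgueValue u q β') :
    ∃ b : ℝ → ℝ, ContDiff ℝ 1 b ∧ (∃ r' < r, ∀ y ∉ Metric.closedBall x r', b y = 0) ∧
      (∀ y, |b y| ≤ 1) ∧ Integrable (fun y => u y * deriv b y) (volume.restrict (Ioo A B)) ∧
      (β' - α') / 2 ≤ ∫ y in Ioo A B, u y * deriv b y := by
  set θ := (β' - α') / 4
  have hθ : 0 < θ := div_pos (sub_pos.2 hαβ) (by norm_num)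
  set m := max (dist p x) (dist q x)
  have hm : m < r := max_lt hp hq
  obtain ⟨ρ, ⟨⟨h1, h2⟩, h3⟩⟩ := (((hpα θ hθ).and (hqβ θ hθ)).and
    (Ioo_mem_nhdsGT (show 0 < r - m by linarith))).exists
  have hρ : 0 < ρ := h3.1
  set f : ContDiffBump p := ⟨ρ / 2, ρ, by positivity, by linarith⟩
  set g : ContDiffBump q := ⟨ρ / 2, ρ, by positivity, by linarith⟩
  have hdp : dist p x ≤ m := le_max_left _ _
  have hdq : dist q x ≤ m := le_max_right _ _
  have hsp : Metric.closedBall p ρ ⊆ Ioo A B :=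
    (Metric.closedBall_subset_ball' (by linarith [h3.2])).trans hr
  have hsq : Metric.closedBall q ρ ⊆ Ioo A B :=
    (Metric.closedBall_subset_ball' (by linarith [h3.2])).trans hr
  obtain ⟨hif, hf⟩ := abs_setIntegral_mul_normed_sub_le hu f rfl hsp hθ.le h1
  obtain ⟨hig, hg⟩ := abs_setIntegral_mul_normed_sub_le hu g rfl hsq hθ.le h2
  rw [Real.dist_eq] at hdp hdq
  have hdp' := abs_le.1 hdp
  have hdq' := abs_le.1 hdq
  set y₀ := x - r
  have hfy := primitive_normed_mem f (y₀ := y₀) (by simp only [y₀, f]; linarith [h3.2])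
  have hgy := primitive_normed_mem g (y₀ := y₀) (by simp only [y₀, g]; linarith [h3.2])
  obtain ⟨hf1, hf2⟩ := contDiff_primitive (f.continuous_normed (μ := volume)) y₀
  obtain ⟨hg1, hg2⟩ := contDiff_primitive (g.continuous_normed (μ := volume)) y₀
  have hder : deriv (fun y => (∫ t in y₀..y, g.normed volume t) -
      ∫ t in y₀..y, f.normed volume t) = fun y => g.normed volume y - f.normed volume y := by
    funext y
    rw [deriv_fun_sub (hg1.differentiable one_ne_zero y) (hf1.differentiable one_ne_zero y), hg2,
      hf2]
  refine ⟨fun y => (∫ t in y₀..y, g.normed volume t) - ∫ t in y₀..y, f.normed volume t,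
    hg1.sub hf1, ⟨m + ρ, by linarith [h3.2], fun y hy => ?_⟩, fun y => ?_, ?_, ?_⟩
  · simp only
    rw [Real.closedBall_eq_Icc] at hy
    rcases lt_or_ge y (x - (m + ρ)) with h | h
    · rw [(hfy y).2.1 (by simp only [f]; linarith), (hgy y).2.1 (by simp only [g]; linarith),
        sub_self]
    · have : x + (m + ρ) < y := by
        by_contra h'
        exact hy ⟨h, not_lt.1 h'⟩
      rw [(hfy y).2.2 (by simp only [f]; linarith), (hgy y).2.2 (by simp only [g]; linarith),
        sub_self]
  · have h1 := (hfy y).1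
    have h2 := (hgy y).1
    rw [abs_le]
    constructor <;> linarith [h1.1, h1.2, h2.1, h2.2]
  · rw [hder]
    simp only [mul_sub]
    exact hig.sub hif
  · rw [hder]
    simp only [mul_sub]
    rw [integral_sub hig hif]
    have h1 := (abs_le.1 hf).2
    have h2 := (abs_le.1 hg).1
    simp only [θ] at h1 h2
    linarith

theorem finite_jumpSet_of_memBVTwo (hαβ : α' < β') {E : Set ℝ} {A B : ℝ}
    (hE : interior E = Ioo A B) (hEr : volume.restrict E = volume.restrict (Ioo A B)) {u : L1 E}
    (hui : Integrable u (volume.restrict (Ioo A B))) (hu : MemBVTwo E α' β' u) :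
    (jumpSet A B u).Finite := by
  obtain ⟨hu2, C, hC⟩ := (memBVTwo_iff hE hEr).1 hu
  have hd : 0 < (β' - α') / 2 := half_pos (sub_pos.2 hαβ)
  have key : ∀ F : Finset ℝ, (∀ x ∈ F, x ∈ jumpSet A B u) → F.card * ((β' - α') / 2) ≤ C := by
    intro F hF
    obtain ⟨r, hr, hball, hsep⟩ := exists_separating_radius F isOpen_Ioo fun x hx => (hF x hx).1
    have hball' : ∀ x ∈ F, Metric.ball x r ⊆ Ioo A B := fun x hx =>
      (Metric.ball_subset_ball (by linarith)).trans (hball x hx)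
    have hex : ∀ x ∈ F, ∃ b : ℝ → ℝ, ContDiff ℝ 1 b ∧
        (∃ r' < r, ∀ y ∉ Metric.closedBall x r', b y = 0) ∧ (∀ y, |b y| ≤ 1) ∧
        Integrable (fun y => u y * deriv b y) (volume.restrict (Ioo A B)) ∧
        (β' - α') / 2 ≤ ∫ y in Ioo A B, u y * deriv b y := by
      intro x hx
      obtain ⟨⟨p, hp, hpα⟩, q, hq, hqβ⟩ :=
        exists_hasLebesgueValue hui hu2 (hF x hx) hr (hball' x hx)
      exact exists_test_function hαβ hui (hball' x hx) hp hq hpα hqβ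
    choose! b hb1 hb2 hb3 hb4 hb5 using hex
    choose! r' hr' hb0 using hb2
    have hK : IsCompact (⋃ x ∈ F, Metric.closedBall x (r' x)) :=
      F.isCompact_biUnion fun x _ => isCompact_closedBall x (r' x)
    have hsupp : tsupport (fun y => ∑ x ∈ F, b x y) ⊆ ⋃ x ∈ F, Metric.closedBall x (r' x) := by
      refine closure_minimal (fun y hy => ?_) hK.isClosed
      by_contra hcon
      refine hy (Finset.sum_eq_zero fun x hx => hb0 x hx y fun h => hcon ?_)
      exact mem_iUnion₂.2 ⟨x, hx, h⟩
    have hder : ∀ y, deriv (fun y => ∑ x ∈ F, b x y) y = ∑ x ∈ F, deriv (b x) y := fun y =>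
      deriv_fun_sum fun x hx => (hb1 x hx).differentiable one_ne_zero y
    have h := hC (fun y => ∑ x ∈ F, b x y) (ContDiff.sum fun x hx => hb1 x hx)
      (hK.of_isClosed_subset (isClosed_tsupport _) hsupp)
      (hsupp.trans (iUnion₂_subset fun x hx => (Metric.closedBall_subset_ball (hr' x hx)).trans
        (hball' x hx))) ?_
    · simp only [hder, Finset.mul_sum] at h
      rw [integral_finsetSum F hb4] at h
      refine le_trans ?_ h
      rw [← nsmul_eq_mul, ← Finset.sum_const]
      exact Finset.sum_le_sum hb5
    · -- at most one of the test functions is nonzero at a given point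
      intro y
      by_cases hy : ∃ x ∈ F, y ∈ Metric.ball x r
      · obtain ⟨x, hx, hyx⟩ := hy
        rw [Finset.sum_eq_single_of_mem x hx]
        · exact hb3 x hx y
        · intro z hz hzx
          refine hb0 z hz y fun h => ?_
          exact Set.disjoint_left.1 (pairwiseDisjoint_ball hsep hr hz hx hzx)
            (Metric.closedBall_subset_ball (hr' z hz) h) hyx
      · rw [Finset.sum_eq_zero]
        · simp
        · intro x hx
          refine hb0 x hx y fun h => hy ⟨x, hx, Metric.closedBall_subset_ball (hr' x hx) h⟩
  by_contra hinf
  obtain ⟨N, hN⟩ := exists_nat_gt (C / ((β' - α') / 2))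
  obtain ⟨F, hF, hcard⟩ := Set.Infinite.exists_subset_card_eq hinf N
  have := key F fun x hx => hF hx
  rw [hcard, ← le_div_iff₀ hd] at this
  linarith

end

section

variable {a D : ℝ} {V : ℝ → ℝ} {α' β' : ℝ}

/-! ### Recovery sequences -/

/-- The profile `W` placed at `x` on the scale `Λ`, reflected if `σ = -1`. -/
noncomputable def placedProfile (W : ℝ → ℝ) (Λ σ x y : ℝ) : ℝ := W (σ * (y - x) / Λ)

theorem energy_placedProfile (ha : a < 0) (D : ℝ) (V W : ℝ → ℝ) {ε : ℝ} (hε : 0 < ε) {σ : ℝ}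
    (hσ : |σ| = 1) (x : ℝ) :
    energy a D V ε (placedProfile W (lengthScale a ε) σ x) univ = energy a D V 1 W univ := by
  have hΛ := lengthScale_pos a hε
  have hσ2 : σ * σ = 1 := by rw [← abs_mul_abs_self, hσ, one_mul]
  have h := energy_comp_affine ha D V hε x (k := σ * lengthScale a ε)
    (by rw [abs_mul, hσ, one_mul, abs_of_pos hΛ]) (placedProfile W (lengthScale a ε) σ x) univ
  rw [← h, preimage_univ]
  congr 1
  funext t
  rw [placedProfile]
  congr 1
  rw [add_sub_cancel_left, ← mul_assoc, ← mul_assoc, hσ2, one_mul]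
  field_simp

theorem placedProfile_eq {W : ℝ → ℝ} {T Λ r : ℝ} (hΛ : 0 < Λ) (hTr : T * Λ < r)
    (hWα : ∀ t ≤ -T, W t = α') (hWβ : ∀ t, T ≤ t → W t = β') {x : ℝ} {w : ℝ → ℝ} {σ : ℝ}
    {y : ℝ} (hy : r ≤ |y - x|)
    (hw : (σ = 1 ∧ w y = if y ≤ x then α' else β') ∨ (σ = -1 ∧ w y = if y ≤ x then β' else α')) :
    placedProfile W Λ σ x y = w y := by
  have hp : ∀ t, r ≤ t → T ≤ t / Λ := fun t ht => by rw [le_div_iff₀ hΛ]; linarith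
  have hn : ∀ t, t ≤ -r → t / Λ ≤ -T := fun t ht => by rw [div_le_iff₀ hΛ]; linarith
  unfold placedProfile
  rcases hw with ⟨rfl, hw⟩ | ⟨rfl, hw⟩ <;> rw [hw] <;> split_ifs with h
  · rw [abs_of_nonpos (by linarith)] at hy
    exact hWα _ (hn _ (by linarith))
  · rw [abs_of_pos (by linarith)] at hy
    exact hWβ _ (hp _ (by linarith))
  · rw [abs_of_nonpos (by linarith)] at hy
    exact hWβ _ (hp _ (by linarith))
  · rw [abs_of_pos (by linarith)] at hy
    exact hWα _ (hn _ (by linarith))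

/-- The energy of a function that consists of profiles placed at separate points: distinct profiles
interact only at a positive distance. -/
theorem energy_le_of_placed {A B r : ℝ} (hr : 0 < r) (ha : a < 0) (hαβ : α' < β')
    (hV : IsDoubleWell V α' β') {ε : ℝ}
    {S : Finset ℝ} {v w : ℝ → ℝ} {Q : ℝ → ℝ → ℝ} (hQ : ∀ x, Measurable (Q x))
    (hv : ∀ y ∈ Ioo A B, v y ∈ Icc α' β')
    (hvQ : ∀ x ∈ S, ∀ y ∈ Metric.ball x (2 * r), v y = Q x y)
    (hvw : ∀ y, (∀ x ∈ S, y ∉ Metric.ball x r) → v y = w y)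
    (hwv : ∀ y ∈ Ioo A B, w y = α' ∨ w y = β')
    (hw : ∀ y z, (∀ x ∈ S, x < y ↔ x < z) → w y = w z) :
    energy a D V ε v (Ioo A B) ≤ ∑ x ∈ S, energy a D V ε (Q x) univ +
      ENNReal.ofReal (ε ^ (1 - a) / D) * (ENNReal.ofReal ((β' - α') ^ 2 / r ^ (1 + 2 * ((1 - a) / 2)))
        * (volume (Ioo A B) * volume (Ioo A B))) := by
  set s := (1 - a) / 2
  have hpt : ∀ z ∈ Ioo A B ×ˢ Ioo A B,
      ENNReal.ofReal (|v z.1 - v z.2| ^ 2 / |z.1 - z.2| ^ (1 + 2 * s)) ≤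
        (∑ x ∈ S, ENNReal.ofReal (|Q x z.1 - Q x z.2| ^ 2 / |z.1 - z.2| ^ (1 + 2 * s))) +
          ENNReal.ofReal ((β' - α') ^ 2 / r ^ (1 + 2 * s)) := by
    rintro ⟨y, z⟩ ⟨hy, hz⟩
    simp only at hy hz ⊢
    have hvd : |v y - v z| ≤ β' - α' := by
      have h1 := hv y hy
      have h2 := hv z hz
      rw [abs_le]; constructor <;> linarith [h1.1, h1.2, h2.1, h2.2]
    rcases le_or_gt r |y - z| with hyz | hyz
    · refine le_trans (ENNReal.ofReal_le_ofReal ?_) le_add_self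
      have h1 : (0 : ℝ) ≤ 1 + 2 * s := by simp only [s]; linarith
      gcongr
    · refine le_trans ?_ le_self_add
      have hnear : ∀ x ∈ S, y ∈ Metric.ball x r ∨ z ∈ Metric.ball x r →
          v y = Q x y ∧ v z = Q x z := by
        intro x hx h
        have hd : dist y z < r := by rwa [Real.dist_eq]
        have hyz' : y ∈ Metric.ball x (2 * r) ∧ z ∈ Metric.ball x (2 * r) := by
          simp only [Metric.mem_ball] at h ⊢
          rcases h with h | h
          · exact ⟨by linarith, by linarith [dist_triangle_left z x y]⟩
          · exact ⟨by linarith [dist_triangle y z x], by linarith⟩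
        exact ⟨hvQ x hx y hyz'.1, hvQ x hx z hyz'.2⟩
      by_cases hex : ∃ x ∈ S, y ∈ Metric.ball x r ∨ z ∈ Metric.ball x r
      · obtain ⟨x, hx, h⟩ := hex
        obtain ⟨h1, h2⟩ := hnear x hx h
        rw [h1, h2]
        exact Finset.single_le_sum (f := fun x =>
          ENNReal.ofReal (|Q x y - Q x z| ^ 2 / |y - z| ^ (1 + 2 * s))) (fun _ _ => bot_le) hx
      · push Not at hex
        -- a jump point between `y` and `z` would be closer than `r` to both
        have : v y = v z := by
          rw [hvw y fun x hx => (hex x hx).1, hvw z fun x hx => (hex x hx).2]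
          refine hw y z fun x hx => ?_
          have h1 := (hex x hx).1
          have h2 := (hex x hx).2
          rw [Metric.mem_ball, Real.dist_eq] at h1 h2
          have h3 := abs_lt.1 hyz
          constructor
          · intro h
            by_contra hle
            exact h1 (abs_lt.2 ⟨by linarith, by linarith⟩)
          · intro h
            by_contra hle
            exact h2 (abs_lt.2 ⟨by linarith, by linarith⟩)
        simp [this]
  have hg : gagliardoSq s v (Ioo A B) ≤ ∑ x ∈ S, gagliardoSq s (Q x) univ +
      ENNReal.ofReal ((β' - α') ^ 2 / r ^ (1 + 2 * s)) *
        (volume (Ioo A B) * volume (Ioo A B)) := by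
    refine (setLIntegral_mono' (measurableSet_Ioo.prod measurableSet_Ioo) hpt).trans ?_
    rw [lintegral_add_right _ measurable_const, lintegral_finsetSum]
    · rw [setLIntegral_const, Measure.volume_eq_prod, Measure.prod_prod]
      gcongr with x hx
      exact gagliardoSq_mono_set s (Q x) (subset_univ _)
    · intro x _
      have := hQ x
      fun_prop
  have hp : ∫⁻ y in Ioo A B, ENNReal.ofReal (V (v y)) ≤
      ∑ x ∈ S, ∫⁻ y in univ, ENNReal.ofReal (V (Q x y)) := by
    have hm : ∀ x ∈ S, Measurable fun y => ENNReal.ofReal (V (Q x y)) := fun x _ =>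
      (hV.continuous.measurable.comp (hQ x)).ennreal_ofReal
    rw [← lintegral_finsetSum _ hm]
    refine le_trans ?_ (lintegral_mono_set (subset_univ (Ioo A B)))
    refine setLIntegral_mono' measurableSet_Ioo fun y hy => ?_
    by_cases hex : ∃ x ∈ S, y ∈ Metric.ball x r
    · obtain ⟨x, hx, h⟩ := hex
      rw [hvQ x hx y (Metric.ball_subset_ball (by linarith) h)]
      exact Finset.single_le_sum (f := fun x => ENNReal.ofReal (V (Q x y))) (fun _ _ => bot_le) hx
    · push Not at hex
      rw [hvw y hex, (hV.eq_zero_iff _).2 (hwv y hy), ENNReal.ofReal_zero]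
      exact bot_le
  unfold energy
  rw [Finset.sum_add_distrib, ← Finset.mul_sum, ← Finset.mul_sum]
  calc _ ≤ ENNReal.ofReal (ε ^ (1 - a) / D) * (∑ x ∈ S, gagliardoSq s (Q x) univ +
        ENNReal.ofReal ((β' - α') ^ 2 / r ^ (1 + 2 * s)) *
        (volume (Ioo A B) * volume (Ioo A B))) + ENNReal.ofReal (1 / lengthScale a ε) *
        ∑ x ∈ S, ∫⁻ y in univ, ENNReal.ofReal (V (Q x y)) := by gcongr
    _ = _ := by ring

/-- The Γ-limsup inequality, up to an error `δ`. -/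
theorem eventually_exists_recovery (ha : -1 < a) (ha' : a < 0) (hD : 0 < D)
    (hαβ : α' < β') (hV : IsDoubleWell V α' β') {ε : ℕ → ℝ} (hε : ∀ n, 0 < ε n)
    (hε0 : Tendsto ε atTop (𝓝 0)) {u : ℝ → ℝ} {A B : ℝ} {S : Finset ℝ}
    (hS : ∀ x, x ∈ S ↔ x ∈ jumpSet A B u) (hu2 : ∀ᵐ x, x ∈ Ioo A B → u x = α' ∨ u x = β')
    {δ : ℝ} (hδ : 0 < δ) :
    ∀ᶠ n in atTop, ∃ v : ℝ → ℝ, Measurable v ∧ (∀ x ∈ Ioo A B, v x ∈ Icc α' β') ∧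
      ∫⁻ y in Ioo A B, ‖v y - u y‖ₑ ≤ ENNReal.ofReal δ ∧
      energy a D V (ε n) v (Ioo A B) ≤
        S.card * optimalProfile a D V α' β' + ENNReal.ofReal δ := by
  classical
  obtain ⟨r, hr, hball, hsep⟩ := exists_separating_radius S isOpen_Ioo fun x hx =>
    ((hS x).1 hx).1
  obtain ⟨w, hwm, huw, hwv, hwno, hwS⟩ := exists_two_valued_representative hS hu2 hr hball hsep
  set N : ℝ := (S.card : ℝ)
  have hN : 0 ≤ N := Nat.cast_nonneg _
  have hδ1 : 0 < δ / 2 / (N + 1) := by positivity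
  obtain ⟨W, T, hT, hW, hW', hWα, hWβ, hWe⟩ := exists_profile ha ha' hD hαβ hV hδ1
  have hd : 0 < β' - α' := sub_pos.2 hαβ
  have hσ : ∀ x ∈ S, ∃ σ : ℝ, |σ| = 1 ∧ ∀ y ∈ Metric.ball x (2 * r),
      (σ = 1 ∧ w y = if y ≤ x then α' else β') ∨
        (σ = -1 ∧ w y = if y ≤ x then β' else α') := by
    intro x hx
    rcases hwS x hx with h | h
    · exact ⟨1, by simp, fun y hy => Or.inl ⟨rfl, h y hy⟩⟩
    · exact ⟨-1, by simp, fun y hy => Or.inr ⟨rfl, h y hy⟩⟩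
  choose! σ hσ1 hσw using hσ
  have hΛ0 := tendsto_lengthScale ha ha' hε0
  have ev1 := hΛ0.eventually (gt_mem_nhds (show 0 < r / T by positivity))
  have ev2 := hΛ0.eventually (ge_mem_nhds
    (show 0 < δ / ((N + 1) * ((β' - α') * (2 * T))) by positivity))
  have ev3 : ∀ᶠ n in atTop, ENNReal.ofReal (ε n ^ (1 - a) / D) *
      (ENNReal.ofReal ((β' - α') ^ 2 / r ^ (1 + 2 * ((1 - a) / 2)))
        * (volume (Ioo A B) * volume (Ioo A B))) ≤ ENNReal.ofReal (δ / 2) := by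
    have h1 : Tendsto (fun n => ε n ^ (1 - a) / D) atTop (𝓝 (0 ^ (1 - a) / D)) :=
      (hε0.rpow_const (Or.inr (by linarith))).div_const D
    rw [Real.zero_rpow (by linarith), zero_div] at h1
    have h2 := ENNReal.Tendsto.mul_const (b := ENNReal.ofReal ((β' - α') ^ 2 /
      r ^ (1 + 2 * ((1 - a) / 2))) * (volume (Ioo A B) * volume (Ioo A B)))
      (ENNReal.tendsto_ofReal h1) (Or.inr (ENNReal.mul_ne_top ENNReal.ofReal_ne_top
        (ENNReal.mul_ne_top measure_Ioo_lt_top.ne measure_Ioo_lt_top.ne)))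
    rw [ENNReal.ofReal_zero, zero_mul] at h2
    exact h2.eventually (ge_mem_nhds (by simpa using hδ))
  filter_upwards [ev1, ev2, ev3] with n hn1 hn2 hn3
  set Λ := lengthScale a (ε n)
  have hΛ : 0 < Λ := lengthScale_pos a (hε n)
  have hTr : T * Λ < r := by rwa [lt_div_iff₀ hT, mul_comm] at hn1
  set Q : ℝ → ℝ → ℝ := fun x => placedProfile W Λ (σ x) x
  have hQ : ∀ x, Measurable (Q x) := fun x => hW.comp (by fun_prop)
  set v : ℝ → ℝ := fun y => w y + ∑ x ∈ S, (Metric.ball x r).indicator (fun y => Q x y - w y) y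
  have hvm : Measurable v := hwm.add (Finset.measurable_sum S fun x _ =>
    ((hQ x).sub hwm).indicator Metric.isOpen_ball.measurableSet)
  have hQw : ∀ x ∈ S, ∀ y ∈ Metric.ball x (2 * r), T * Λ < |y - x| → Q x y = w y := by
    intro x hx y hy hyx
    exact placedProfile_eq hΛ hyx hWα hWβ le_rfl (hσw x hx y hy)
  have hvw : ∀ y, (∀ x ∈ S, y ∉ Metric.ball x r) → v y = w y := by
    intro y hy
    simp only [v]
    rw [Finset.sum_eq_zero fun x hx => indicator_of_notMem (hy x hx) _, add_zero]
  have hvball : ∀ x ∈ S, ∀ y ∈ Metric.ball x r, v y = Q x y := by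
    intro x hx y hy
    simp only [v]
    rw [Finset.sum_eq_single_of_mem x hx, indicator_of_mem hy]
    · ring
    · intro z hz hzx
      refine indicator_of_notMem (fun h => ?_) _
      exact Set.disjoint_left.1 (pairwiseDisjoint_ball hsep hr hz hx hzx) h hy
  have hvQ : ∀ x ∈ S, ∀ y ∈ Metric.ball x (2 * r), v y = Q x y := by
    intro x hx y hy
    by_cases hyr : y ∈ Metric.ball x r
    · exact hvball x hx y hyr
    · rw [hQw x hx y hy (by
        rw [Metric.mem_ball, Real.dist_eq, not_lt] at hyr
        linarith)]
      refine hvw y fun z hz hzy => ?_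
      by_cases hzx : z = x
      · exact hyr (hzx ▸ hzy)
      · have := hsep z hz x hx hzx
        rw [Metric.mem_ball] at hzy hy
        linarith [dist_triangle_left z x y]
  have hvI : ∀ y ∈ Ioo A B, v y ∈ Icc α' β' := by
    intro y hy
    by_cases hex : ∃ x ∈ S, y ∈ Metric.ball x r
    · obtain ⟨x, hx, h⟩ := hex
      rw [hvball x hx y h]
      exact hW' _
    · push Not at hex
      rw [hvw y hex]
      rcases hwv y hy with h | h <;> rw [h]
      · exact left_mem_Icc.2 hαβ.le
      · exact right_mem_Icc.2 hαβ.le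
  refine ⟨v, hvm, hvI, ?_, ?_⟩
  · calc ∫⁻ y in Ioo A B, ‖v y - u y‖ₑ
        ≤ ∫⁻ y in Ioo A B, ∑ x ∈ S, (Metric.closedBall x (T * Λ)).indicator
            (fun _ => ENNReal.ofReal (β' - α')) y := by
          refine lintegral_mono_ae ?_
          rw [ae_restrict_iff' measurableSet_Ioo]
          filter_upwards [huw] with y hy hyI
          rw [hy hyI]
          by_cases hex : ∃ x ∈ S, y ∈ Metric.closedBall x (T * Λ)
          · obtain ⟨x, hx, h⟩ := hex
            refine le_trans ?_ (Finset.single_le_sum (f := fun x =>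
              (Metric.closedBall x (T * Λ)).indicator (fun _ => ENNReal.ofReal (β' - α')) y)
              (fun _ _ => bot_le) hx)
            simp only [indicator_of_mem h]
            rw [Real.enorm_eq_ofReal_abs]
            refine ENNReal.ofReal_le_ofReal ?_
            have h1 := hvI y hyI
            rw [abs_le]
            rcases hwv y hyI with h2 | h2 <;> rw [h2] <;> constructor <;> linarith [h1.1, h1.2]
          · push Not at hex
            have : v y = w y := by
              by_cases hex2 : ∃ x ∈ S, y ∈ Metric.ball x r
              · obtain ⟨x, hx, h⟩ := hex2
                have h2 := hex x hx
                rw [Metric.mem_closedBall, Real.dist_eq, not_le] at h2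
                rw [hvball x hx y h, hQw x hx y (Metric.ball_subset_ball (by linarith) h) h2]
              · push Not at hex2
                exact hvw y hex2
            simp [this]
      _ ≤ ∫⁻ y, ∑ x ∈ S, (Metric.closedBall x (T * Λ)).indicator
            (fun _ => ENNReal.ofReal (β' - α')) y := setLIntegral_le_lintegral _ _
      _ = ENNReal.ofReal (N * ((β' - α') * (2 * (T * Λ)))) := by
          rw [lintegral_finsetSum _ fun x _ =>
            measurable_const.indicator Metric.isClosed_closedBall.measurableSet]
          simp only [lintegral_indicator Metric.isClosed_closedBall.measurableSet,
            setLIntegral_const, Real.volume_closedBall, Finset.sum_const, nsmul_eq_mul]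
          rw [ENNReal.ofReal_mul hN, ENNReal.ofReal_mul hd.le, ENNReal.ofReal_natCast]
      _ ≤ ENNReal.ofReal δ := by
          refine ENNReal.ofReal_le_ofReal ?_
          rw [le_div_iff₀ (by positivity)] at hn2
          refine le_trans ?_ hn2
          have : N * ((β' - α') * (2 * (T * Λ))) = Λ * (N * ((β' - α') * (2 * T))) := by ring
          rw [this]
          gcongr
          linarith
  · refine (energy_le_of_placed hr ha' hαβ hV hQ hvI hvQ hvw hwv hwno).trans ?_
    have hsum : ∑ x ∈ S, energy a D V (ε n) (Q x) univ ≤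
        S.card * (optimalProfile a D V α' β' + ENNReal.ofReal (δ / 2 / (N + 1))) := by
      rw [← nsmul_eq_mul, ← Finset.sum_const]
      refine Finset.sum_le_sum fun x hx => ?_
      rw [energy_placedProfile ha' D V W (hε n) (hσ1 x hx)]
      exact hWe
    refine (add_le_add hsum hn3).trans ?_
    rw [mul_add, add_assoc]
    gcongr
    rw [← ENNReal.ofReal_natCast, ← ENNReal.ofReal_mul hN,
      ← ENNReal.ofReal_add (by positivity) (by positivity)]
    refine ENNReal.ofReal_le_ofReal ?_
    have : N * (δ / 2 / (N + 1)) ≤ δ / 2 := by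
      rw [← mul_div_assoc, div_le_iff₀ (by positivity)]
      nlinarith
    linarith

end

section

variable {a D : ℝ} {V : ℝ → ℝ} {α' β' : ℝ}

/-! ### Compactness -/

/-- A set that has mass at most `m` in every window of length `H` has mass at most
`2 (Q - P) m / H` in `(P, Q]`. The factor `2` accounts for `Q - P` not being a multiple of `H`. -/
theorem volume_real_inter_Ioc_le {A : Set ℝ} {P Q H m : ℝ} (hH : 0 < H) (hPQ : H ≤ Q - P)
    (hm : 0 ≤ m) (h : ∀ y ∈ Icc P (Q - H), volume.real (A ∩ Ioc y (y + H)) ≤ m) :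
    volume.real (A ∩ Ioc P Q) ≤ 2 * ((Q - P) / H) * m := by
  have hfin : ∀ y z : ℝ, volume (A ∩ Ioc y z) ≠ ⊤ := fun y z =>
    ((measure_mono inter_subset_right).trans_lt measure_Ioc_lt_top).ne
  have hunion : ∀ x y z t : ℝ, y ≤ t → volume.real (A ∩ Ioc x z) ≤
      volume.real (A ∩ Ioc x t) + volume.real (A ∩ Ioc y z) := by
    intro x y z t hyt
    refine (measureReal_mono ?_ (measure_union_ne_top (hfin _ _) (hfin _ _))).trans
      (measureReal_union_le _ _)
    rintro w ⟨hw, hw1, hw2⟩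
    rcases le_or_gt w t with h | h
    · exact Or.inl ⟨hw, hw1, h⟩
    · exact Or.inr ⟨hw, hyt.trans_lt h, hw2⟩
  have hk : ∀ k : ℕ, P + k * H ≤ Q → volume.real (A ∩ Ioc P (P + k * H)) ≤ k * m := by
    intro k
    induction k with
    | zero => intro _; simp
    | succ k ih =>
      intro hk
      push_cast at hk ⊢
      have h1 := ih (by linarith)
      have h2 := h (P + k * H) ⟨by have : 0 ≤ (k : ℝ) * H := by positivity
                                   linarith, by linarith⟩
      have h3 := hunion P (P + k * H) (P + (k + 1) * H) (P + k * H) le_rfl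
      rw [show P + ((k : ℝ) + 1) * H = P + k * H + H by ring] at h3 ⊢
      linarith
  set k := ⌊(Q - P) / H⌋₊
  have hk1 : (1 : ℝ) ≤ k := by
    exact_mod_cast (Nat.one_le_floor_iff _).2 ((one_le_div hH).2 hPQ)
  have hkle : (k : ℝ) ≤ (Q - P) / H := Nat.floor_le (div_nonneg (by linarith) hH.le)
  have hkle' : (k : ℝ) * H ≤ Q - P := by rwa [← le_div_iff₀ hH]
  have hklt : Q - P < (k + 1) * H := by
    rw [← div_lt_iff₀ hH]
    exact Nat.lt_floor_add_one _
  have h1 := hk k (by linarith)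
  have h2 := h (Q - H) ⟨by linarith, le_rfl⟩
  rw [sub_add_cancel] at h2
  have h3 := hunion P (Q - H) Q (P + k * H) (by linarith)
  calc volume.real (A ∩ Ioc P Q) ≤ k * m + m := by linarith
    _ ≤ 2 * ((Q - P) / H) * m := by nlinarith

/-- On a long interval either the energy is bounded below, or one phase fills the interval up to a
small fraction. -/
theorem exists_phase_alternative (ha' : a < 0) (hD : 0 < D) (hαβ : α' < β')
    (hV : IsDoubleWell V α' β') {η C : ℝ} (hη : 0 < η) (hη1 : η ≤ 1) (hC : 0 ≤ C) :
    ∃ c H : ℝ, 0 < c ∧ 0 < H ∧ ∀ w : ℝ → ℝ, Measurable w → ∀ P Q : ℝ, H ≤ Q - P →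
      energy a D V 1 w (Ioc P Q) ≤ ENNReal.ofReal C →
      ENNReal.ofReal c ≤ energy a D V 1 w (Ioc P Q) ∨
      volume ((upperPhase α' β' w)ᶜ ∩ Ioc P Q) ≤ ENNReal.ofReal (η * (Q - P)) ∨
      volume ((lowerPhase α' β' w)ᶜ ∩ Ioc P Q) ≤ ENNReal.ofReal (η * (Q - P)) := by
  obtain ⟨c₀, hc₀, hcV⟩ := hV.exists_pos_le hαβ
  set μ := η / 4
  have hμ : 0 < μ := by positivity
  set H := C / (c₀ * μ) + 1
  have hH : 0 < H := by positivity
  have hCH : C / c₀ ≤ μ * H := by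
    simp only [H]
    rw [mul_add, mul_one]
    have : μ * (C / (c₀ * μ)) = C / c₀ := by field_simp
    linarith
  set k := 1 / D * (((β' - α') / 2) ^ 2 / H ^ (1 + 2 * ((1 - a) / 2)) * (μ * H) ^ 2)
  have hd : 0 < β' - α' := sub_pos.2 hαβ
  refine ⟨k, H, by positivity, hH, fun w hw P Q hPQ hE => ?_⟩
  have hA := measurableSet_lowerPhase (α' := α') (β' := β') hw
  have hpot : ∫⁻ x in Ioc P Q, ENNReal.ofReal (V (w x)) ≤ ENNReal.ofReal C := by
    refine le_trans ?_ hE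
    rw [energy_one]
    exact le_add_self
  have hM : ∀ J ⊆ Ioc P Q, volume.real ((lowerPhase α' β' w ∪ upperPhase α' β' w)ᶜ ∩ J) ≤
      μ * H := by
    intro J hJ
    have h1 := (volume_transition_le hcV hw J).trans ((lintegral_mono_set hJ).trans hpot)
    have h2 := ENNReal.toReal_mono ENNReal.ofReal_ne_top h1
    rw [ENNReal.toReal_mul, ENNReal.toReal_ofReal hc₀.le, ENNReal.toReal_ofReal hC, mul_comm,
      ← le_div_iff₀ hc₀] at h2
    exact h2.trans hCH
  have hwin : ∀ y ∈ Icc P (Q - H), Ioc y (y + H) ⊆ Ioc P Q := fun y hy =>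
    Ioc_subset_Ioc hy.1 (by linarith [hy.2])
  have hfin : ∀ B : Set ℝ, volume (B ∩ Ioc P Q) ≠ ⊤ := fun B =>
    ((measure_mono inter_subset_right).trans_lt measure_Ioc_lt_top).ne
  have hfill : ∀ B B' : Set ℝ, (∀ y ∈ Icc P (Q - H), volume.real (B ∩ Ioc y (y + H)) ≤ μ * H) →
      B'ᶜ ⊆ B ∪ (lowerPhase α' β' w ∪ upperPhase α' β' w)ᶜ →
      volume (B'ᶜ ∩ Ioc P Q) ≤ ENNReal.ofReal (η * (Q - P)) := by
    intro B B' hB hsub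
    have h1 := volume_real_inter_Ioc_le hH hPQ (by positivity) hB
    have h2 := hM _ Subset.rfl
    rw [← ofReal_measureReal (hfin _)]
    refine ENNReal.ofReal_le_ofReal ?_
    have h3 : volume.real (B'ᶜ ∩ Ioc P Q) ≤ volume.real (B ∩ Ioc P Q) +
        volume.real ((lowerPhase α' β' w ∪ upperPhase α' β' w)ᶜ ∩ Ioc P Q) := by
      refine (measureReal_mono ?_ (measure_union_ne_top (hfin _) (hfin _))).trans
        (measureReal_union_le _ _)
      rw [← union_inter_distrib_right]
      exact inter_subset_inter_left _ hsub
    have h4 : 2 * ((Q - P) / H) * (μ * H) = 2 * μ * (Q - P) := by field_simp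
    have h5 : μ * H ≤ μ * (Q - P) := by gcongr
    have h6 : η * (Q - P) = 4 * (μ * (Q - P)) := by simp only [μ]; ring
    have h7 : 0 ≤ μ * (Q - P) := mul_nonneg hμ.le (by linarith)
    rw [h4] at h1
    rw [h6]
    linarith
  rcases window_trichotomy (B := upperPhase α' β' w) hA hH
    (show μ ≤ 1 / 4 by simp only [μ]; linarith) (isPreconnected_Icc (a := P) (b := Q - H))
    (fun y hy => hM _ (hwin y hy)) with ⟨y, hy, h1, h2⟩ | h | h
  · left
    rw [energy_one]
    refine le_trans ?_ le_self_add
    rw [ENNReal.ofReal_mul (by positivity)]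
    gcongr
    exact le_gagliardoSq_of_window (by linarith) hαβ hw (by positivity) h1 h2 (hwin y hy)
  · right; left
    refine hfill _ _ h fun x hx => ?_
    by_cases h1 : x ∈ lowerPhase α' β' w
    · exact Or.inl h1
    · exact Or.inr (by simp only [mem_compl_iff, mem_union, not_or]; exact ⟨h1, hx⟩)
  · right; right
    refine hfill _ _ h fun x hx => ?_
    by_cases h1 : x ∈ upperPhase α' β' w
    · exact Or.inl h1
    · exact Or.inr (by simp only [mem_compl_iff, mem_union, not_or]; exact ⟨hx, h1⟩)

theorem volume_preimage_affine (c : ℝ) {k : ℝ} (hk : k ≠ 0) (s : Set ℝ) :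
    volume ((fun x => c + k * x) ⁻¹' s) = ENNReal.ofReal |k⁻¹| * volume s := by
  rw [← (measurableEmbedding_affine c hk).map_apply, map_affine_volume c hk, Measure.smul_apply,
    smul_eq_mul]

theorem exists_phase_alternative_scaled (ha' : a < 0) (hD : 0 < D) (hαβ : α' < β')
    (hV : IsDoubleWell V α' β') {η C : ℝ} (hη : 0 < η) (hη1 : η ≤ 1) (hC : 0 ≤ C) :
    ∃ c H : ℝ, 0 < c ∧ 0 < H ∧ ∀ ε : ℝ, 0 < ε → ∀ v : ℝ → ℝ, Measurable v → ∀ P Q : ℝ,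
      H * lengthScale a ε ≤ Q - P → energy a D V ε v (Ioc P Q) ≤ ENNReal.ofReal C →
      ENNReal.ofReal c ≤ energy a D V ε v (Ioc P Q) ∨
      volume ((upperPhase α' β' v)ᶜ ∩ Ioc P Q) ≤ ENNReal.ofReal (η * (Q - P)) ∨
      volume ((lowerPhase α' β' v)ᶜ ∩ Ioc P Q) ≤ ENNReal.ofReal (η * (Q - P)) := by
  obtain ⟨c, H, hc, hH, h⟩ := exists_phase_alternative ha' hD hαβ hV hη hη1 hC
  refine ⟨c, H, hc, hH, fun ε hε v hv P Q hPQ hE => ?_⟩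
  set Λ := lengthScale a ε
  have hΛ : 0 < Λ := lengthScale_pos a hε
  have hpre : (fun x => 0 + Λ * x) ⁻¹' Ioc P Q = Ioc (P / Λ) (Q / Λ) := by
    ext x
    simp only [mem_preimage, mem_Ioc, zero_add, div_lt_iff₀ hΛ, le_div_iff₀ hΛ, mul_comm]
  have hen := energy_comp_affine ha' D V hε 0 (abs_of_pos hΛ) v (Ioc P Q)
  rw [hpre] at hen
  have hscale : ∀ s : Set ℝ, volume ((fun x => 0 + Λ * x) ⁻¹' (s ∩ Ioc P Q)) ≤
      ENNReal.ofReal (η * (Q / Λ - P / Λ)) →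
      volume (s ∩ Ioc P Q) ≤ ENNReal.ofReal (η * (Q - P)) := by
    intro s hs
    rw [volume_preimage_affine 0 hΛ.ne', abs_of_pos (inv_pos.2 hΛ)] at hs
    calc volume (s ∩ Ioc P Q) = ENNReal.ofReal Λ * (ENNReal.ofReal Λ⁻¹ * volume (s ∩ Ioc P Q)) := by
          rw [← mul_assoc, ← ENNReal.ofReal_mul hΛ.le, mul_inv_cancel₀ hΛ.ne', ENNReal.ofReal_one,
            one_mul]
      _ ≤ ENNReal.ofReal Λ * ENNReal.ofReal (η * (Q / Λ - P / Λ)) := by gcongr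
      _ = _ := by
          rw [← ENNReal.ofReal_mul hΛ.le]
          congr 1
          field_simp
  have := h (fun x => v (0 + Λ * x)) (hv.comp (by fun_prop)) (P / Λ) (Q / Λ)
    (by rw [← sub_div, le_div_iff₀ hΛ]; exact hPQ) (hen.trans_le hE)
  rw [hen] at this
  refine this.imp id (Or.imp (fun h => hscale _ ?_) fun h => hscale _ ?_)
  · rw [preimage_inter, hpre]; exact h
  · rw [preimage_inter, hpre]; exact h

/-- The potential controls the distance to the wells, far away by its linear growth. -/
theorem IsDoubleWell.exists_min_dist_le (hV : IsDoubleWell V α' β') {δ : ℝ} (hδ : 0 < δ) :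
    ∃ C : ℝ, 0 ≤ C ∧ ∀ t, min |t - α'| |t - β'| ≤ δ + C * V t := by
  obtain ⟨c, R, hc, hR⟩ := hV.linear_growth
  set R' := max R 1
  have hR1 : 1 ≤ R' := le_max_right _ _
  set K : Set ℝ := Icc (-R') R' ∩ {t | δ ≤ min |t - α'| |t - β'|}
  have hK : IsCompact K := isCompact_Icc.inter_right (isClosed_le continuous_const (by fun_prop))
  obtain ⟨m, hm, hmK⟩ : ∃ m > 0, ∀ t ∈ K, m ≤ V t := by
    rcases K.eq_empty_or_nonempty with h | h
    · exact ⟨1, one_pos, by simp [h]⟩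
    · obtain ⟨t₀, ht₀, hmin⟩ := hK.exists_isMinOn h hV.continuous.continuousOn
      refine ⟨V t₀, lt_of_le_of_ne (hV.nonneg _) fun h0 => ?_, fun t ht => hmin ht⟩
      have h1 : δ ≤ min |t₀ - α'| |t₀ - β'| := ht₀.2
      rcases (hV.eq_zero_iff t₀).1 h0.symm with h | h
      · have := h1.trans (min_le_left _ _)
        rw [h, sub_self, abs_zero] at this
        linarith
      · have := h1.trans (min_le_right _ _)
        rw [h, sub_self, abs_zero] at this
        linarith
  set C₁ := (R' + |α'|) / m
  set C₂ := (1 + |α'|) / c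
  have hC₁ : 0 ≤ C₁ := by positivity
  have hC₂ : 0 ≤ C₂ := by positivity
  have htri : ∀ t, min |t - α'| |t - β'| ≤ |t| + |α'| := fun t =>
    (min_le_left _ _).trans (abs_sub _ _)
  refine ⟨C₁ + C₂, by positivity, fun t => ?_⟩
  have hVt := hV.nonneg t
  have hp1 : 0 ≤ C₁ * V t := by positivity
  have hp2 : 0 ≤ C₂ * V t := by positivity
  rw [add_mul]
  rcases le_or_gt R' |t| with h | h
  · have h1 : c * |t| ≤ V t := hR t ((le_max_left _ _).trans h)
    have h2 : |t| + |α'| ≤ C₂ * V t := by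
      calc |t| + |α'| ≤ (1 + |α'|) * |t| := by nlinarith [abs_nonneg α']
        _ = C₂ * (c * |t|) := by simp only [C₂]; field_simp
        _ ≤ C₂ * V t := by gcongr
    linarith [htri t]
  · by_cases h1 : δ ≤ min |t - α'| |t - β'|
    · have h2 := hmK t ⟨abs_le.1 h.le, h1⟩
      have h3 : R' + |α'| ≤ C₁ * V t := by
        calc R' + |α'| = C₁ * m := by simp only [C₁]; field_simp
          _ ≤ C₁ * V t := by gcongr
      linarith [htri t]
    · linarith

/-- The function that is constant on each of the cells `(A + j h, A + (j + 1) h]`, with value `β'`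
or `α'` according to `g j`, and `0` elsewhere. -/
noncomputable def cellFunction (α' β' A h : ℝ) {K : ℕ} (g : Fin K → Bool) (x : ℝ) : ℝ :=
  ∑ j : Fin K, (Ioc (A + j * h) (A + (j + 1) * h)).indicator
    (fun _ => if g j then β' else α') x

theorem pairwiseDisjoint_cells (A : ℝ) {h : ℝ} (hh : 0 < h) (K : ℕ) :
    ((Finset.univ : Finset (Fin K)) : Set (Fin K)).PairwiseDisjoint
      fun j => Ioc (A + (j : ℝ) * h) (A + ((j : ℝ) + 1) * h) := by
  intro i _ j _ hij
  wlog hlt : i < j generalizing i j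
  · exact (this (i := j) (j := i) (by simp) (by simp) hij.symm
      (lt_of_le_of_ne (not_lt.1 hlt) hij.symm)).symm
  refine Set.disjoint_left.2 fun x hx hx' => ?_
  have : ((i : ℝ) + 1) ≤ j := by exact_mod_cast hlt
  have h1 := hx.2
  have h2 := hx'.1
  nlinarith

theorem Ioc_subset_cells {A B h : ℝ} (hh : 0 < h) {K : ℕ} (hK : A + K * h = B) :
    Ioc A B ⊆ ⋃ j ∈ (Finset.univ : Finset (Fin K)),
      Ioc (A + (j : ℝ) * h) (A + ((j : ℝ) + 1) * h) := by
  intro x hx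
  have hpos : 0 < (x - A) / h := div_pos (by linarith [hx.1]) hh
  have hc : 0 < ⌈(x - A) / h⌉₊ := Nat.ceil_pos.2 hpos
  have hle : ⌈(x - A) / h⌉₊ ≤ K := by
    rw [Nat.ceil_le, div_le_iff₀ hh]
    linarith [hx.2]
  obtain ⟨i, hi⟩ : ∃ i, ⌈(x - A) / h⌉₊ = i + 1 := ⟨_, (Nat.succ_pred_eq_of_pos hc).symm⟩
  have h1 := Nat.le_ceil ((x - A) / h)
  have h2 := Nat.ceil_lt_add_one hpos.le
  rw [hi] at h1 h2
  push_cast at h1 h2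
  rw [div_le_iff₀ hh] at h1
  have h2 : (i : ℝ) * h < x - A := by
    rw [← lt_div_iff₀ hh]; linarith
  exact mem_iUnion₂.2 ⟨⟨i, by omega⟩, by simp, by simp only; linarith, by simp only; linarith⟩

theorem cellFunction_eq (A : ℝ) {h : ℝ} (hh : 0 < h) {K : ℕ} (g : Fin K → Bool) {j : Fin K} {x : ℝ}
    (hx : x ∈ Ioc (A + j * h) (A + (j + 1) * h)) :
    cellFunction α' β' A h g x = if g j then β' else α' := by
  rw [cellFunction, Finset.sum_eq_single_of_mem j (Finset.mem_univ _), indicator_of_mem hx]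
  intro i _ hij
  refine indicator_of_notMem (fun h' => ?_) _
  exact Set.disjoint_left.1 (pairwiseDisjoint_cells A hh K (by simp) (by simp) hij) h' hx

theorem lintegral_sub_well_le (hαβ : α' < β') {v : ℝ → ℝ} (hv : Measurable v) (I : Set ℝ)
    (b : Bool) :
    ∫⁻ x in I, ‖v x - if b then β' else α'‖ₑ ≤
      (∫⁻ x in I, ENNReal.ofReal (min |v x - α'| |v x - β'|)) + ENNReal.ofReal (β' - α') *
        volume ((if b then (upperPhase α' β' v)ᶜ else (lowerPhase α' β' v)ᶜ) ∩ I) := by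
  set W : Set ℝ := if b then (upperPhase α' β' v)ᶜ else (lowerPhase α' β' v)ᶜ
  have hW : MeasurableSet W := by
    simp only [W]
    split_ifs
    · exact (measurableSet_upperPhase hv).compl
    · exact (measurableSet_lowerPhase hv).compl
  rw [← Measure.restrict_apply hW, ← setLIntegral_const, ← lintegral_indicator hW,
    ← lintegral_add_right _ (measurable_const.indicator hW)]
  refine lintegral_mono fun x => ?_
  have key : |v x - if b then β' else α'| ≤ min |v x - α'| |v x - β'| +
      W.indicator (fun _ => β' - α') x := by
    by_cases hx : x ∈ W
    · rw [indicator_of_mem hx]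
      have h1 : |v x - α'| ≤ |v x - β'| + (β' - α') := by
        have := abs_sub_le (v x) β' α'
        rwa [abs_of_pos (sub_pos.2 hαβ)] at this
      have h2 : |v x - β'| ≤ |v x - α'| + (β' - α') := by
        have := abs_sub_le (v x) α' β'
        rwa [abs_sub_comm α', abs_of_pos (sub_pos.2 hαβ)] at this
      rcases le_total |v x - α'| |v x - β'| with h | h
      · rw [min_eq_left h]
        split_ifs <;> linarith
      · rw [min_eq_right h]
        split_ifs <;> linarith
    · rw [indicator_of_notMem hx, add_zero]
      cases b with
      | true =>
        simp only [W, if_true, mem_compl_iff, not_not, upperPhase, mem_ofPred_eq] at hx ⊢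
        refine le_min ?_ le_rfl
        rw [abs_of_nonneg (show 0 ≤ v x - α' by linarith), abs_le]
        constructor <;> linarith
      | false =>
        simp only [W, Bool.false_eq_true, if_false, mem_compl_iff, not_not, lowerPhase,
          mem_ofPred_eq] at hx ⊢
        refine le_min le_rfl ?_
        rw [abs_of_nonpos (show v x - β' ≤ 0 by linarith), abs_le]
        constructor <;> linarith
  rw [Real.enorm_eq_ofReal_abs]
  refine (ENNReal.ofReal_le_ofReal key).trans ?_
  rw [ENNReal.ofReal_add (by positivity)
    (indicator_nonneg (fun _ _ => (sub_pos.2 hαβ).le) _)]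
  gcongr
  by_cases hx : x ∈ W <;> simp [hx]

/-- Functions of bounded energy are close in `L¹` to functions from a finite set: most cells are
filled by one phase, and the number of the other cells is bounded independently of their size. -/
theorem exists_cellFunction_close (ha : -1 < a) (ha' : a < 0) (hD : 0 < D) (hαβ : α' < β')
    (hV : IsDoubleWell V α' β') {ε : ℕ → ℝ} (hε : ∀ n, 0 < ε n)
    (hε0 : Tendsto ε atTop (𝓝 0)) {A B : ℝ} (hAB : A < B) {C : ℝ} (hC : 0 ≤ C) {δ : ℝ}
    (hδ : 0 < δ) :
    ∃ (K : ℕ) (h : ℝ), ∀ᶠ n in atTop, ∀ v : ℝ → ℝ, Measurable v →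
      energy a D V (ε n) v (Ioc A B) ≤ ENNReal.ofReal C →
      ∃ g : Fin K → Bool,
        ∫⁻ x in Ioc A B, ‖v x - cellFunction α' β' A h g x‖ₑ ≤ ENNReal.ofReal δ := by
  classical
  set ℓ := B - A
  have hℓ : 0 < ℓ := sub_pos.2 hAB
  set d := β' - α'
  have hd : 0 < d := sub_pos.2 hαβ
  set η := min 1 (δ / (4 * d * ℓ))
  have hη : 0 < η := by positivity
  have hηδ : d * η * ℓ ≤ δ / 4 := by
    have : η ≤ δ / (4 * d * ℓ) := min_le_right _ _
    calc d * η * ℓ ≤ d * (δ / (4 * d * ℓ)) * ℓ := by gcongr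
      _ = δ / 4 := by field_simp
  obtain ⟨c, H, hc, hH, hphase⟩ := exists_phase_alternative_scaled (D := D) ha' hD hαβ hV hη
    (min_le_left _ _) hC
  obtain ⟨K, hK⟩ := exists_nat_gt (d * ℓ * (C / c) / (δ / 4))
  have hK0 : (0 : ℝ) < K := lt_of_le_of_lt (by positivity) hK
  set h := ℓ / K
  have hh : 0 < h := by positivity
  have hhK : K * h = ℓ := by simp only [h]; field_simp
  have hbad : d * (C / c) * h ≤ δ / 4 := by
    rw [div_lt_iff₀ (by positivity)] at hK
    simp only [h]
    rw [← mul_div_assoc, div_le_iff₀ hK0]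
    linarith
  obtain ⟨C₂, hC₂, hdist⟩ := hV.exists_min_dist_le (show 0 < δ / (8 * ℓ) by positivity)
  have hΛ0 := tendsto_lengthScale ha ha' hε0
  have ev1 := hΛ0.eventually (ge_mem_nhds (show 0 < h / H by positivity))
  have ev2 := hΛ0.eventually (ge_mem_nhds (show 0 < δ / 8 / (C₂ * C + 1) by positivity))
  refine ⟨K, h, ?_⟩
  filter_upwards [ev1, ev2] with n hn1 hn2 v hv hE
  set Λ := lengthScale a (ε n)
  have hΛ : 0 < Λ := lengthScale_pos a (hε n)
  set I : Fin K → Set ℝ := fun j => Ioc (A + (j : ℝ) * h) (A + ((j : ℝ) + 1) * h)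
  have hIlen : ∀ j : Fin K, A + ((j : ℝ) + 1) * h - (A + (j : ℝ) * h) = h := fun j => by ring
  have hIsub : ∀ j, I j ⊆ Ioc A B := by
    intro j x hx
    have h1 : ((j : ℝ) + 1) ≤ K := by exact_mod_cast j.2
    have h2 : (0 : ℝ) ≤ j := Nat.cast_nonneg _
    have h3 : ((j : ℝ) + 1) * h ≤ ℓ := by rw [← hhK]; gcongr
    have h4 : 0 ≤ (j : ℝ) * h := by positivity
    exact ⟨by linarith [hx.1], by simp only [ℓ] at h3; linarith [hx.2]⟩
  have hIvol : ∀ j, volume (I j) = ENNReal.ofReal h := fun j => by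
    rw [Real.volume_Ioc, hIlen]
  have hdisj := pairwiseDisjoint_cells A hh K
  set bad : Finset (Fin K) :=
    Finset.univ.filter fun j => ENNReal.ofReal c ≤ energy a D V (ε n) v (I j)
  have hbadcard : (bad.card : ℝ) ≤ C / c := by
    have h1 : ∑ j ∈ bad, ENNReal.ofReal c ≤ ENNReal.ofReal C :=
      (Finset.sum_le_sum fun j hj => (Finset.mem_filter.1 hj).2).trans
        ((energy_superadd a D V (ε n) v bad I (fun _ _ => measurableSet_Ioc)
          (hdisj.subset (by simp)) (fun j _ => hIsub j)).trans hE)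
    rw [Finset.sum_const, nsmul_eq_mul, ← ENNReal.ofReal_natCast,
      ← ENNReal.ofReal_mul (Nat.cast_nonneg _), ENNReal.ofReal_le_ofReal_iff hC] at h1
    rwa [le_div_iff₀ hc]
  have hgood : ∀ j, ∃ b : Bool, volume ((if b then (upperPhase α' β' v)ᶜ
      else (lowerPhase α' β' v)ᶜ) ∩ I j) ≤
      ENNReal.ofReal (η * h + if j ∈ bad then h else 0) := by
    intro j
    by_cases hj : j ∈ bad
    · refine ⟨true, (measure_mono inter_subset_right).trans ?_⟩
      rw [hIvol, if_pos hj]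
      exact ENNReal.ofReal_le_ofReal (by have := mul_pos hη hh; linarith)
    · have hj' : ¬ ENNReal.ofReal c ≤ energy a D V (ε n) v (I j) := fun h =>
        hj (Finset.mem_filter.2 ⟨Finset.mem_univ _, h⟩)
      rw [if_neg hj, add_zero]
      have hlen : H * Λ ≤ A + ((j : ℝ) + 1) * h - (A + (j : ℝ) * h) := by
        rw [hIlen]
        rwa [le_div_iff₀ hH, mul_comm] at hn1
      have h1 := hphase (ε n) (hε n) v hv _ _ hlen
        ((energy_mono_set a D V (ε n) v (hIsub j)).trans hE)
      rw [hIlen] at h1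
      rcases h1 with h1 | h1 | h1
      · exact absurd h1 hj'
      · exact ⟨true, by simpa using h1⟩
      · exact ⟨false, by simpa using h1⟩
  choose g hg using hgood
  refine ⟨g, ?_⟩
  have hpot : ∫⁻ x in Ioc A B, ENNReal.ofReal (V (v x)) ≤ ENNReal.ofReal (Λ * C) := by
    have h1 : ENNReal.ofReal (1 / Λ) * ∫⁻ x in Ioc A B, ENNReal.ofReal (V (v x)) ≤
        ENNReal.ofReal C := le_trans le_add_self hE
    calc _ = ENNReal.ofReal Λ * (ENNReal.ofReal (1 / Λ) *
          ∫⁻ x in Ioc A B, ENNReal.ofReal (V (v x))) := by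
            rw [← mul_assoc, ← ENNReal.ofReal_mul hΛ.le, mul_one_div_cancel hΛ.ne',
              ENNReal.ofReal_one, one_mul]
      _ ≤ _ := by rw [ENNReal.ofReal_mul hΛ.le]; gcongr
  have hmin : ∫⁻ x in Ioc A B, ENNReal.ofReal (min |v x - α'| |v x - β'|) ≤
      ENNReal.ofReal (δ / 4) := by
    calc _ ≤ ∫⁻ x in Ioc A B, (ENNReal.ofReal (δ / (8 * ℓ)) +
          ENNReal.ofReal C₂ * ENNReal.ofReal (V (v x))) := by
          refine lintegral_mono fun x => ?_
          rw [← ENNReal.ofReal_mul hC₂, ← ENNReal.ofReal_add (by positivity)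
            (mul_nonneg hC₂ (hV.nonneg _))]
          exact ENNReal.ofReal_le_ofReal (hdist _)
      _ = ENNReal.ofReal (δ / (8 * ℓ)) * ENNReal.ofReal ℓ + ENNReal.ofReal C₂ *
          ∫⁻ x in Ioc A B, ENNReal.ofReal (V (v x)) := by
          rw [lintegral_add_left measurable_const, setLIntegral_const, Real.volume_Ioc,
            lintegral_const_mul' _ _ ENNReal.ofReal_ne_top]
      _ ≤ ENNReal.ofReal (δ / (8 * ℓ)) * ENNReal.ofReal ℓ + ENNReal.ofReal C₂ *
          ENNReal.ofReal (Λ * C) := by gcongr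
      _ ≤ _ := by
          rw [← ENNReal.ofReal_mul (by positivity), ← ENNReal.ofReal_mul hC₂,
            ← ENNReal.ofReal_add (by positivity) (by positivity)]
          refine ENNReal.ofReal_le_ofReal ?_
          have h1 : δ / (8 * ℓ) * ℓ = δ / 8 := by field_simp
          have h2 : C₂ * (Λ * C) ≤ δ / 8 := by
            rw [le_div_iff₀ (by positivity)] at hn2
            nlinarith
          linarith
  calc ∫⁻ x in Ioc A B, ‖v x - cellFunction α' β' A h g x‖ₑ
      ≤ ∫⁻ x in ⋃ j ∈ (Finset.univ : Finset (Fin K)), I j,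
          ‖v x - cellFunction α' β' A h g x‖ₑ :=
        lintegral_mono_set (Ioc_subset_cells hh (by rw [hhK]; simp only [ℓ]; ring))
    _ = ∑ j, ∫⁻ x in I j, ‖v x - cellFunction α' β' A h g x‖ₑ :=
        lintegral_biUnion_finset hdisj (fun _ _ => measurableSet_Ioc) _
    _ = ∑ j, ∫⁻ x in I j, ‖v x - if g j then β' else α'‖ₑ := by
        refine Finset.sum_congr rfl fun j _ =>
          setLIntegral_congr_fun measurableSet_Ioc fun x hx => ?_
        simp only [cellFunction_eq A hh g hx]
    _ ≤ ∑ j, ((∫⁻ x in I j, ENNReal.ofReal (min |v x - α'| |v x - β'|)) +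
          ENNReal.ofReal d * ENNReal.ofReal (η * h + if j ∈ bad then h else 0)) := by
        refine Finset.sum_le_sum fun j _ => (lintegral_sub_well_le hαβ hv (I j) (g j)).trans ?_
        gcongr
        exact hg j
    _ = (∫⁻ x in ⋃ j ∈ (Finset.univ : Finset (Fin K)), I j,
          ENNReal.ofReal (min |v x - α'| |v x - β'|)) +
          ENNReal.ofReal (d * (K * (η * h) + bad.card * h)) := by
        rw [Finset.sum_add_distrib, ← lintegral_biUnion_finset hdisj
          (fun _ _ => measurableSet_Ioc), ← Finset.mul_sum, ENNReal.ofReal_mul hd.le,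
          ← ENNReal.ofReal_sum_of_nonneg]
        · congr 3
          rw [Finset.sum_add_distrib, Finset.sum_const, Finset.card_univ, Fintype.card_fin,
            nsmul_eq_mul, Finset.sum_ite_mem, Finset.univ_inter, Finset.sum_const, nsmul_eq_mul]
        · intro j _
          split_ifs <;> positivity
    _ ≤ ENNReal.ofReal (δ / 4) + ENNReal.ofReal (d * (K * (η * h) + bad.card * h)) := by
        gcongr
        exact (lintegral_mono_set (iUnion₂_subset fun j _ => hIsub j)).trans hmin
    _ ≤ ENNReal.ofReal δ := by
        rw [← ENNReal.ofReal_add (by positivity) (by positivity)]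
        refine ENNReal.ofReal_le_ofReal ?_
        have h1 : d * (K * (η * h) + bad.card * h) = d * η * ℓ + d * bad.card * h := by
          rw [← hhK]; ring
        have h2 : d * bad.card * h ≤ d * (C / c) * h := by gcongr
        linarith

end

section

variable {a D : ℝ} {V : ℝ → ℝ} {α' β' : ℝ}

/-! ### Γ-convergence and compactness on a bounded interval -/

theorem exists_interior_eq_Ioo {E : Set ℝ} (hE : E.OrdConnected) (hEb : Bornology.IsBounded E) :
    ∃ A B : ℝ, A ≤ B ∧ interior E = Ioo A B ∧
      volume.restrict E = volume.restrict (Ioo A B) := by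
  rcases E.eq_empty_or_nonempty with rfl | hne
  · exact ⟨0, 0, le_rfl, by simp, by simp⟩
  have h1 : Ioo (sInf E) (sSup E) ⊆ E :=
    IsConnected.Ioo_csInf_csSup_subset ⟨hne, hE.isPreconnected⟩ hEb.bddBelow hEb.bddAbove
  have h2 : E ⊆ Icc (sInf E) (sSup E) :=
    subset_Icc_csInf_csSup hEb.bddBelow hEb.bddAbove
  refine ⟨sInf E, sSup E, Real.sInf_le_sSup E hEb.bddBelow hEb.bddAbove, ?_, ?_⟩
  · exact ((interior_mono h2).trans interior_Icc.subset).antisymm (isOpen_Ioo.subset_interior_iff.2 h1)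
  · exact Measure.restrict_congr_set
      ((h2.eventuallyLE.trans Ioo_ae_eq_Icc.symm.le).antisymm h1.eventuallyLE)

theorem edist_eq_setLIntegral {E : Set ℝ} (f g : L1 E) :
    edist f g = ∫⁻ x in E, ‖f x - g x‖ₑ := by
  rw [Lp.edist_def, eLpNorm_one_eq_lintegral_enorm]
  rfl

theorem tendsto_setLIntegral {E : Set ℝ} {w : ℕ → L1 E} {u : L1 E} (hw : Tendsto w atTop (𝓝 u)) :
    Tendsto (fun n => ∫⁻ x in E, ‖w n x - u x‖ₑ) atTop (𝓝 0) := by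
  simpa only [edist_eq_setLIntegral] using tendsto_iff_edist_tendsto_0.1 hw

/-- The lower bound, for the energy without the `H^s` constraint: finiteness of the limit inferior
alone forces `u` to be a two-valued `BV` function, because an infinite jump set would make the lower
bound `N κ` arbitrarily large. -/
theorem limitEnergy_le_liminf_energy (ha : -1 < a) (ha' : a < 0) (hD : 0 < D) (hαβ : α' < β')
    (hV : IsDoubleWell V α' β') {E : Set ℝ} {A B : ℝ} (hE : interior E = Ioo A B)
    (hEr : volume.restrict E = volume.restrict (Ioo A B)) {ε : ℕ → ℝ} (hε : ∀ n, 0 < ε n)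
    (hε0 : Tendsto ε atTop (𝓝 0)) {w : ℕ → L1 E} {u : L1 E} (hw : Tendsto w atTop (𝓝 u)) :
    limitEnergy a D V α' β' E u ≤ liminf (fun n => energy a D V (ε n) (w n) E) atTop := by
  rcases eq_or_ne (liminf (fun n => energy a D V (ε n) (w n) E) atTop) ⊤ with htop | htop
  · exact htop ▸ le_top
  have hvu := tendsto_setLIntegral hw
  have hui := L1.integrable_coeFn u
  have hwm : ∀ n, Measurable (w n : ℝ → ℝ) := fun n => (Lp.stronglyMeasurable (w n)).measurable
  have hum : Measurable (u : ℝ → ℝ) := (Lp.stronglyMeasurable u).measurable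
  simp only [energy_congr_set a D V _ _ hEr] at htop ⊢
  have hvu' : Tendsto (fun n => ∫⁻ x in Ioo A B, ‖w n x - u x‖ₑ) atTop (𝓝 0) := by
    refine hvu.congr fun n => ?_
    generalize (w n : ℝ → ℝ) = f
    generalize (u : ℝ → ℝ) = g
    rw [hEr]
  have hui' : Integrable (u : ℝ → ℝ) (volume.restrict (Ioo A B)) := by
    revert hui
    generalize (u : ℝ → ℝ) = g
    rw [hEr]
    exact id
  have hu2 := ae_eq_or_eq_of_liminf_lt_top ha ha' hV hε hε0 hwm hum measurableSet_Ioo hvu'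
    (lt_top_iff_ne_top.2 htop)
  have hcard := card_mul_optimalProfile_le_liminf ha ha' hD hαβ hV hε hε0 hwm hum hui' hu2 hvu'
  have hκ := optimalProfile_pos (D := D) ha' hD hαβ hV
  have hfin : (jumpSet A B u).Finite := by
    by_contra hinf
    obtain ⟨N, hN⟩ := ENNReal.exists_nat_mul_gt hκ.ne' htop
    obtain ⟨F, hF, rfl⟩ := (Set.not_finite.1 hinf).exists_subset_card_eq N
    exact (hcard F fun x hx => hF hx).not_gt hN
  rw [limitEnergy, if_pos (memBVTwo_of_finite_jumpSet hE hEr hu2 hfin),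
    singularSet_eq_jumpSet hE hfin, hfin.encard_eq_coe_toFinset_card, mul_comm]
  exact hcard _ fun x hx => hfin.mem_toFinset.1 hx

theorem energy_le_energyExt (ε : ℝ) {E : Set ℝ} (v : L1 E) :
    energy a D V ε v E ≤ energyExt a D V ε E v := by
  unfold energyExt
  split_ifs
  exacts [le_rfl, le_top]

theorem memBVTwo_of_limitEnergy_ne_top {E : Set ℝ} {u : L1 E}
    (h : limitEnergy a D V α' β' E u ≠ ⊤) : MemBVTwo E α' β' u := by
  by_contra hu
  exact h (if_neg hu)

theorem gagliardoSq_lt_top_of_energy_lt_top (hD : 0 < D) {ε : ℝ} (hε : 0 < ε) {v : ℝ → ℝ}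
    {E : Set ℝ} (h : energy a D V ε v E < ⊤) : gagliardoSq ((1 - a) / 2) v E < ⊤ := by
  have h1 := (le_self_add.trans_lt h : ENNReal.ofReal (ε ^ (1 - a) / D) *
    gagliardoSq ((1 - a) / 2) v E < ⊤)
  refine lt_top_iff_ne_top.2 fun htop => h1.ne ?_
  rw [htop, ENNReal.mul_top]
  exact (ENNReal.ofReal_pos.2 (div_pos (Real.rpow_pos_of_pos hε _) hD)).ne'

theorem energyExt_toLp (hD : 0 < D) {ε : ℝ} (hε : 0 < ε) {E : Set ℝ} {A B : ℝ}
    (hEr : volume.restrict E = volume.restrict (Ioo A B)) {v : ℝ → ℝ} (hv : Measurable v)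
    (hvI : ∀ x ∈ Ioo A B, v x ∈ Icc α' β') (hfin : energy a D V ε v (Ioo A B) < ⊤) :
    ∃ hL : MemLp v 1 (volume.restrict E),
      energyExt a D V ε E hL.toLp = energy a D V ε v (Ioo A B) := by
  have hbd : ∀ᵐ x ∂(volume.restrict E), ‖v x‖ ≤ max |α'| |β'| := by
    rw [hEr]
    refine (ae_restrict_iff' measurableSet_Ioo).2 (ae_of_all _ fun x hx => ?_)
    exact abs_le_max_abs_abs (hvI x hx).1 (hvI x hx).2
  have : IsFiniteMeasure (volume.restrict E) := by
    rw [hEr]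
    exact ⟨by simp⟩
  have hmem : ∀ p, MemLp v p (volume.restrict E) := fun p =>
    MemLp.of_bound hv.aestronglyMeasurable _ hbd
  refine ⟨hmem 1, ?_⟩
  have hae := (hmem 1).coeFn_toLp
  have hen : energy a D V ε (hmem 1).toLp E = energy a D V ε v (Ioo A B) :=
    (energy_congr_ae a D V ε hae).trans (energy_congr_set a D V ε v hEr)
  rw [energyExt, if_pos, hen]
  exact ⟨(memLp_congr_ae hae).2 (hmem 2),
    gagliardoSq_lt_top_of_energy_lt_top hD hε (hen ▸ hfin)⟩

/-- Almost-recovery at every tolerance `δ`, in `L¹(E)`. -/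
theorem eventually_exists_energyExt_le (ha : -1 < a) (ha' : a < 0) (hD : 0 < D) (hαβ : α' < β')
    (hV : IsDoubleWell V α' β') {E : Set ℝ} {A B : ℝ} (hE : interior E = Ioo A B)
    (hEr : volume.restrict E = volume.restrict (Ioo A B)) {ε : ℕ → ℝ} (hε : ∀ n, 0 < ε n)
    (hε0 : Tendsto ε atTop (𝓝 0)) {u : L1 E} (hu : MemBVTwo E α' β' u) {δ : ℝ} (hδ : 0 < δ) :
    ∀ᶠ n in atTop, ∃ w : L1 E, edist w u ≤ ENNReal.ofReal δ ∧
      energyExt a D V (ε n) E w ≤ limitEnergy a D V α' β' E u + ENNReal.ofReal δ := by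
  have hui' : Integrable (u : ℝ → ℝ) (volume.restrict (Ioo A B)) := by
    have hui := L1.integrable_coeFn u
    revert hui
    generalize (u : ℝ → ℝ) = g
    rw [hEr]
    exact id
  have hfin := finite_jumpSet_of_memBVTwo hαβ hE hEr hui' hu
  have hlim : limitEnergy a D V α' β' E u =
      hfin.toFinset.card * optimalProfile a D V α' β' := by
    rw [limitEnergy, if_pos hu, singularSet_eq_jumpSet hE hfin, hfin.encard_eq_coe_toFinset_card,
      mul_comm]
    rfl
  have hltop : limitEnergy a D V α' β' E u + ENNReal.ofReal δ < ⊤ := by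
    rw [hlim]
    exact ENNReal.add_lt_top.2 ⟨ENNReal.mul_lt_top (ENNReal.natCast_lt_top _)
      (optimalProfile_lt_top ha ha' hD hαβ hV), ENNReal.ofReal_lt_top⟩
  filter_upwards [eventually_exists_recovery ha ha' hD hαβ hV hε hε0 (S := hfin.toFinset)
    (fun x => hfin.mem_toFinset) ((memBVTwo_iff hE hEr).1 hu).1 hδ] with n hn
  obtain ⟨v, hvm, hvI, hvu, hve⟩ := hn
  rw [← hlim] at hve
  obtain ⟨hL, hLe⟩ := energyExt_toLp hD (hε n) hEr hvm hvI (hve.trans_lt hltop)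
  refine ⟨hL.toLp, ?_, hLe.trans_le hve⟩
  rw [edist_eq_setLIntegral]
  refine le_trans (le_of_eq ?_) hvu
  refine (lintegral_congr_ae ?_).trans (b := ∫⁻ x in E, ‖v x - u x‖ₑ) ?_
  · filter_upwards [hL.coeFn_toLp] with x hx
    rw [hx]
  · generalize (u : ℝ → ℝ) = g
    rw [hEr]

/-- If for every `δ > 0` the points of `X` close to `u` eventually include one on which `F n` is
almost `F₀`, a diagonal choice gives a single sequence `w n → u` with `limsup F n (w n) ≤ F₀`. -/
theorem exists_seq_limsup_le {X : Type*} [PseudoMetricSpace X] {F : ℕ → X → ℝ≥0∞} {F₀ : ℝ≥0∞}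
    {u : X} (h : ∀ δ : ℝ, 0 < δ → ∀ᶠ n in atTop, ∃ w : X, edist w u ≤ ENNReal.ofReal δ ∧
      F n w ≤ F₀ + ENNReal.ofReal δ) :
    ∃ w : ℕ → X, Tendsto w atTop (𝓝 u) ∧ limsup (fun n => F n (w n)) atTop ≤ F₀ := by
  -- At step `n` use the largest `k ≤ n` for which the tolerance `1 / (k + 1)` is attained.
  let P : ℕ → ℕ → X → Prop := fun n k w =>
    edist w u ≤ ENNReal.ofReal (1 / ((k : ℝ) + 1)) ∧
      F n w ≤ F₀ + ENNReal.ofReal (1 / ((k : ℝ) + 1))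
  have hsel : ∀ n, ∃ w : X, ∀ j ≤ n, (∃ w', P n j w') → P n j w := by
    classical
    intro n
    by_cases hne : ∃ k ≤ n, ∃ w', P n k w'
    · obtain ⟨k₀, hk₀, hPk₀⟩ := hne
      have hspec := Nat.findGreatest_spec (P := fun k => ∃ w', P n k w') hk₀ hPk₀
      obtain ⟨w, hw⟩ := hspec
      refine ⟨w, fun j hj hPj => ?_⟩
      have hle := Nat.le_findGreatest (P := fun k => ∃ w', P n k w') hj hPj
      have hmono : ENNReal.ofReal (1 / ((Nat.findGreatest (fun k => ∃ w', P n k w') n : ℕ) + 1 : ℝ))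
          ≤ ENNReal.ofReal (1 / ((j : ℝ) + 1)) := by gcongr
      exact ⟨hw.1.trans hmono, hw.2.trans (add_le_add le_rfl hmono)⟩
    · exact ⟨u, fun j hj hPj => absurd ⟨j, hj, hPj⟩ hne⟩
  choose w hw using hsel
  have hev : ∀ k : ℕ, ∀ᶠ n in atTop, P n k (w n) := fun k => by
    filter_upwards [h (1 / ((k : ℝ) + 1)) (by positivity), eventually_ge_atTop k] with n hn hkn
    exact hw n k hkn hn
  have h0 : Tendsto (fun k : ℕ => ENNReal.ofReal (1 / ((k : ℝ) + 1))) atTop (𝓝 0) := by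
    simpa using ENNReal.tendsto_ofReal tendsto_one_div_add_atTop_nhds_zero_nat
  refine ⟨w, ?_, ?_⟩
  · rw [tendsto_iff_edist_tendsto_0]
    refine ENNReal.tendsto_nhds_zero.2 fun η hη => ?_
    obtain ⟨k, hk⟩ := (h0.eventually (gt_mem_nhds hη)).exists
    filter_upwards [hev k] with n hn
    exact hn.1.trans hk.le
  · have hlim : Tendsto (fun k : ℕ => F₀ + ENNReal.ofReal (1 / ((k : ℝ) + 1))) atTop (𝓝 F₀) := by
      simpa using tendsto_const_nhds.add h0
    exact ge_of_tendsto' hlim fun k => limsup_le_of_le (by isBoundedDefault)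
      ((hev k).mono fun n hn => hn.2)

theorem gammaConverges_energyExt (ha : -1 < a) (ha' : a < 0) (hD : 0 < D) (hαβ : α' < β')
    (hV : IsDoubleWell V α' β') {E : Set ℝ} {A B : ℝ} (hE : interior E = Ioo A B)
    (hEr : volume.restrict E = volume.restrict (Ioo A B)) {ε : ℕ → ℝ} (hε : ∀ n, 0 < ε n)
    (hε0 : Tendsto ε atTop (𝓝 0)) :
    GammaConverges (fun n => energyExt a D V (ε n) E) (limitEnergy a D V α' β' E) := by
  have hliminf : ∀ (u : L1 E) (w : ℕ → L1 E), Tendsto w atTop (𝓝 u) →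
      limitEnergy a D V α' β' E u ≤ liminf (fun n => energyExt a D V (ε n) E (w n)) atTop :=
    fun u w hw => (limitEnergy_le_liminf_energy ha ha' hD hαβ hV hE hEr hε hε0 hw).trans
      (liminf_le_liminf (Eventually.of_forall fun n => energy_le_energyExt _ _))
  refine ⟨hliminf, fun u => ?_⟩
  by_cases hu : MemBVTwo E α' β' u
  · obtain ⟨w, hw, hsup⟩ := exists_seq_limsup_le fun δ hδ =>
      eventually_exists_energyExt_le ha ha' hD hαβ hV hE hEr hε hε0 hu hδ
    exact ⟨w, hw, tendsto_of_le_liminf_of_limsup_le (hliminf u w hw) hsup⟩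
  · -- Off `BV(E, {α', β'})` the limit is `⊤`, so any sequence converging to `u` recovers it.
    refine ⟨fun _ => u, tendsto_const_nhds,
      tendsto_of_le_liminf_of_limsup_le (hliminf u _ tendsto_const_nhds) ?_⟩
    rw [limitEnergy, if_neg hu]
    exact le_top

theorem memBVTwo_of_mapClusterPt (ha : -1 < a) (ha' : a < 0) (hD : 0 < D) (hαβ : α' < β')
    (hV : IsDoubleWell V α' β') {E : Set ℝ} {A B : ℝ} (hE : interior E = Ioo A B)
    (hEr : volume.restrict E = volume.restrict (Ioo A B)) {ε : ℕ → ℝ} (hε : ∀ n, 0 < ε n)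
    (hε0 : Tendsto ε atTop (𝓝 0)) {v : ℕ → L1 E} {C : ℝ≥0}
    (hC : ∀ n, energy a D V (ε n) (v n) E ≤ C) {w : L1 E} (hw : MapClusterPt w atTop v) :
    MemBVTwo E α' β' w := by
  obtain ⟨φ, hφ, hφw⟩ := hw.tendsto_subseq
  refine memBVTwo_of_limitEnergy_ne_top (a := a) (D := D) (V := V) (ne_top_of_le_ne_top
    (ENNReal.coe_ne_top (r := C)) ((limitEnergy_le_liminf_energy ha ha' hD hαβ hV hE hEr
      (fun n => hε (φ n)) (hε0.comp hφ.tendsto_atTop) hφw).trans ?_))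
  exact liminf_le_of_le (by isBoundedDefault) fun b hb =>
    hb.exists.elim fun n hn => hn.trans (hC (φ n))

theorem memLp_cellFunction (A h : ℝ) {K : ℕ} (g : Fin K → Bool) {E : Set ℝ}
    [IsFiniteMeasure (volume.restrict E)] :
    MemLp (cellFunction α' β' A h g) 1 (volume.restrict E) :=
  memLp_finsetSum _ fun _ _ => (memLp_const _).indicator measurableSet_Ioc

/-- Only finitely many cell functions are needed at each scale, so a sequence of bounded energy is
totally bounded in `L¹(E)`. -/
theorem isCompact_closure_range (ha : -1 < a) (ha' : a < 0) (hD : 0 < D) (hαβ : α' < β')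
    (hV : IsDoubleWell V α' β') {E : Set ℝ} {A B : ℝ} (hAB : A ≤ B)
    (hEr : volume.restrict E = volume.restrict (Ioo A B)) {ε : ℕ → ℝ} (hε : ∀ n, 0 < ε n)
    (hε0 : Tendsto ε atTop (𝓝 0)) {v : ℕ → L1 E} {C : ℝ≥0}
    (hC : ∀ n, energy a D V (ε n) (v n) E ≤ C) : IsCompact (closure (range v)) := by
  rw [restrict_Ioo_eq_restrict_Ioc] at hEr
  have : IsFiniteMeasure (volume.restrict E) := by
    rw [hEr]
    exact ⟨by simp⟩
  refine TotallyBounded.isCompact_of_isClosed (TotallyBounded.closure ?_) isClosed_closure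
  rcases hAB.eq_or_lt with rfl | hAB
  · -- On a null set `L¹` is a single point.
    have hsub : ∀ f g : L1 E, f = g := fun f g => by
      refine Lp.ext ?_
      have h0 : volume.restrict E = 0 := by simp [hEr]
      generalize (f : ℝ → ℝ) = f
      generalize (g : ℝ → ℝ) = g
      rw [h0]
      simp [EventuallyEq]
    exact (Set.subsingleton_of_forall_eq 0 fun f _ => hsub f 0).finite.totallyBounded
  refine EMetric.totallyBounded_iff.2 fun η hη => ?_
  obtain ⟨δ, hδ, hδη⟩ : ∃ δ : ℝ, 0 < δ ∧ ENNReal.ofReal δ < η := by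
    obtain ⟨r, hr0, hr⟩ := ENNReal.lt_iff_exists_nnreal_btwn.1 hη
    exact ⟨r, by exact_mod_cast hr0, by simpa using hr⟩
  obtain ⟨K, h, hK⟩ := exists_cellFunction_close ha ha' hD hαβ hV hε hε0 hAB C.2 hδ
  obtain ⟨n₀, hn₀⟩ := eventually_atTop.1 hK
  let cell : (Fin K → Bool) → L1 E := fun g => (memLp_cellFunction (α' := α') (β' := β') A h g).toLp
  refine ⟨v '' Iio n₀ ∪ range cell, ((finite_Iio n₀).image v).union (finite_range cell), ?_⟩
  rintro _ ⟨n, rfl⟩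
  rw [biUnion_union]
  rcases lt_or_ge n n₀ with hn | hn
  · exact Or.inl (mem_biUnion (mem_image_of_mem v hn) (Metric.mem_eball_self hη))
  · have hCn := hC n
    rw [energy_congr_set a D V _ _ hEr] at hCn
    obtain ⟨g, hg⟩ := hn₀ n hn (v n) (Lp.stronglyMeasurable (v n)).measurable (by simpa using hCn)
    refine Or.inr (mem_biUnion (mem_range_self g) ?_)
    rw [Metric.mem_eball, edist_eq_setLIntegral]
    refine lt_of_le_of_lt (le_of_eq ?_) (hg.trans_lt hδη)
    refine (lintegral_congr_ae ?_).trans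
      (b := ∫⁻ x in E, ‖v n x - cellFunction α' β' A h g x‖ₑ) ?_
    · filter_upwards [(memLp_cellFunction (α' := α') (β' := β') A h g (E := E)).coeFn_toLp] with x hx
      rw [hx]
    · generalize (v n : ℝ → ℝ) = f
      rw [hEr]

end

end FractionalGamma


theorem proposition4p1 (a : ℝ) (ha : -1 < a) (ha' : a < 0) (D : ℝ) (hD : 0 < D)
    (α' β' : ℝ) (hαβ : α' < β') (V : ℝ → ℝ) (hV : FractionalGamma.IsDoubleWell V α' β')
    (E : Set ℝ) (hE : E.OrdConnected) (hEb : Bornology.IsBounded E) :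
    (0 < FractionalGamma.optimalProfile a D V α' β' ∧
      FractionalGamma.optimalProfile a D V α' β' < ⊤) ∧
    ∀ ε : ℕ → ℝ, (∀ n, 0 < ε n) → Tendsto ε atTop (𝓝 0) →
      FractionalGamma.GammaConverges
        (fun n => FractionalGamma.energyExt a D V (ε n) E)
        (FractionalGamma.limitEnergy a D V α' β' E) ∧
      ∀ v : ℕ → FractionalGamma.L1 E,
        (∃ C : ℝ≥0, ∀ n, FractionalGamma.energy a D V (ε n) (v n) E ≤ C) →
          IsCompact (closure (range v)) ∧
          ∀ w : FractionalGamma.L1 E, MapClusterPt w atTop v →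
            FractionalGamma.MemBVTwo E α' β' w := by
  obtain ⟨A, B, hAB, hEi, hEr⟩ := FractionalGamma.exists_interior_eq_Ioo hE hEb
  refine ⟨⟨FractionalGamma.optimalProfile_pos ha' hD hαβ hV,
    FractionalGamma.optimalProfile_lt_top ha ha' hD hαβ hV⟩, fun ε hε hε0 =>
    ⟨FractionalGamma.gammaConverges_energyExt ha ha' hD hαβ hV hEi hEr hε hε0, ?_⟩⟩
  rintro v ⟨C, hC⟩
  exact ⟨FractionalGamma.isCompact_closure_range ha ha' hD hαβ hV hAB hEr hε hε0 hC,
    fun w hw => FractionalGamma.memBVTwo_of_mapClusterPt ha ha' hD hαβ hV hEi hEr hε hε0 hC hw⟩
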